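/- Let $k\ge 1$, $m=2k+1$, and let $q(X)=\sum_{1\le i\le j\le m}q_{ij}x_ix_j$ be a positive definite quadratic form with integer coefficients. Its matrix $Q$ is the symmetric matrix with $2q(X)={}^tXQX$, and $\det q:=\det Q$. Write $q[A](Y)=q(AY)$. For forms $q_1,q_2$ in $m$ variables let $R(q_1,q_2)=\{A\in M_m(\mathbb Z): q_1[A]=q_2\}$, let $r^*(q_1,q_2)$ be the number of $A\in R(q_1,q_2)$ whose entries are coprime, let $e(q_1)=|R(q_1,q_1)\cap GL_m(\mathbb Z)|$, and let $r(q_1,n)=|\{X\in\mathbb Z^m: q_1(X)=n\}|$. A form $q'$ in $m$ variables is similar to $q$ if $\det q'=\det q$ and $R(q,bq')\neq\emptyset$ for some integer $b$ prime to $\det q$. Let $q_1,\dots,q_h$ be a complete system of representatives of the integral equivalence classes of forms similar to $q$. For a prime $p\nmid\det q$ put $\chi_p(q)=\left(\frac{(-1)^k\det q}{p}\right)$ (Legendre symbol), $$c_p=\sum_{d=1}^{k}p^{1-d}\prod_{i=1}^{d-1}\frac{p^{2(k-i)}-1}{1-p^{-i}},\qquad \beta_p=\sum_{d=1}^{k}\left(\prod_{i=1}^{d-1}\frac{p^{2(k-i)}-1}{1-p^{-i}}\right)\frac{p^{m-2}-p^{d-1}(p+1)+1}{p^{d-1}(p^d-1)}.$$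 Let $a$ be a square-free integer, and let $(\bar r,\bar t^*)$ be either of the following: (i) $\bar r(n)\in\mathbb Q^h$ is the column vector with entries $r(q_j,n)/e(q_j)$, and $\bar t^*(p^2)$ is the $h\times h$ matrix with entries $r^*(q_i,p^2q_j)/e(q_i)$; (ii) $\bar r(n)=\sum_{j=1}^h r(q_j,n)/e(q_j)\in\mathbb Q$, and $\bar t^*(p^2)=\sum_{j=1}^h r^*(q_j,p^2q)/e(q_j)\in\mathbb Q$. Then, as formal Dirichlet series over the positive integers $n$ prime to $\det q$, $$\sum_{(n,\det q)=1}\frac{\bar r(n^2a)}{n^s}=\prod_{p\nmid\det q}\left(\frac{1-\chi_p(q)\left(\frac{2a}{p}\right)p^{k-1-s}}{1-c_p^{-1}\left(\bar t^*(p^2)-\beta_p\right)p^{-s}+p^{m-2-2s}}\right)\cdot\bar r(a).$$ Here scalars are read as multiples of the identity matrix in case (i); the quotient is that of power series in $p^{-s}$ (the denominator has constant term $1$); the factors for different primes commute; and the product is the formal one: each coefficient of the finite partial products is eventually constant, with the coefficient of the full product as its value. -/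

import Mathlib

noncomputable section

namespace ReprZeta

open scoped PowerSeries

/-! ### Integral quadratic forms and their representations -/

/-- Integral quadratic forms in `m` variables, i.e. `q(X) = ∑_{i ≤ j} q_ij x_i x_j` with arbitrary
integers `q_ij`. -/
abbrev Form (m : ℕ) : Type := QuadraticForm ℤ (Fin m → ℤ)

/-- The matrix `Q` of `q`, normalised by `2 q(X) = ᵗX Q X`: its off-diagonal entries are the
coefficients `q_ij` and its diagonal entries are `2 q_ii`. -/
def formMatrix {m : ℕ} (q : Form m) : Matrix (Fin m) (Fin m) ℤ :=
  Matrix.of fun i j => QuadraticMap.polar q (Pi.single i 1) (Pi.single j 1)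

/-- The determinant of a form is the determinant of its matrix. -/
def formDet {m : ℕ} (q : Form m) : ℤ := (formMatrix q).det

/-- The form `q[A](Y) = q(AY)`. -/
def subst {m n : ℕ} (q : Form m) (A : Matrix (Fin m) (Fin n) ℤ) : Form n :=
  q.comp A.mulVecLin

/-- The set `R(q, q')` of integral representations of the form `q'` by `q`. -/
def Rep {m n : ℕ} (q : Form m) (q' : Form n) : Set (Matrix (Fin m) (Fin n) ℤ) :=
  {A | subst q A = q'}

/-- The set `R^*(q, q')` of primitive representations: those with coprime entries. -/
def PrimRep {m n : ℕ} (q : Form m) (q' : Form n) : Set (Matrix (Fin m) (Fin n) ℤ) :=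
  {A | A ∈ Rep q q' ∧ ∀ d : ℤ, (∀ i j, d ∣ A i j) → IsUnit d}

/-- The group of units `E(q) = R(q, q) ∩ GL_m(ℤ)`, as a set of matrices. -/
def formUnits {m : ℕ} (q : Form m) : Set (Matrix (Fin m) (Fin m) ℤ) :=
  {A | A ∈ Rep q q ∧ IsUnit A.det}

/-- The set `R(q, a)` of integral representations of the number `a` by `q`. -/
def RepNum {m : ℕ} (q : Form m) (a : ℤ) : Set (Fin m → ℤ) := {X | q X = a}

/-- `r(q, a) / e(q)`. -/
def normRep {m : ℕ} (q : Form m) (a : ℤ) : ℚ :=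
  ((RepNum q a).ncard : ℚ) / ((formUnits q).ncard : ℚ)

/-- `r^*(q, p² q') / e(q)`. -/
def normPrimRep {m : ℕ} (q q' : Form m) (p : ℕ) : ℚ :=
  ((PrimRep q (((p : ℤ) ^ 2) • q')).ncard : ℚ) / ((formUnits q).ncard : ℚ)

/-! ### Similarity classes -/

/-- `q'` is similar to `q`: the determinants are equal and `R(q, a q')` is non-empty for some `a`
prime to `det q`. -/
def Similar {m : ℕ} (q q' : Form m) : Prop :=
  formDet q' = formDet q ∧ ∃ a : ℤ, IsCoprime a (formDet q) ∧ (Rep q (a • q')).Nonempty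

/-- Integral equivalence: `q' = q[U]` for some `U ∈ GL_m(ℤ)`. -/
def Equivalent {m : ℕ} (q q' : Form m) : Prop :=
  ∃ U : Matrix (Fin m) (Fin m) ℤ, IsUnit U.det ∧ q' = subst q U

/-- `q_1, …, q_h` is a complete system of representatives of the different integral equivalence
classes contained in the similarity class of `q`. -/
def IsCompleteSystem {m h : ℕ} (q : Form m) (qs : Fin h → Form m) : Prop :=
  (∀ i, Similar q (qs i)) ∧ ∀ q' : Form m, Similar q q' → ∃! i, Equivalent (qs i) q'

/-! ### Representation numbers and Eichler matrices -/

/-- The vector with entries `r(q_j, n) / e(q_j)`. -/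
def repVec {m h : ℕ} (qs : Fin h → Form m) (n : ℤ) : Fin h → ℚ := fun j => normRep (qs j) n

/-- The mean representation number `∑_j r(q_j, n) / e(q_j)`. -/
def repMean {m h : ℕ} (qs : Fin h → Form m) (n : ℤ) : ℚ := ∑ j, normRep (qs j) n

/-- Eichler's matrix with multiplier `p²`, with entries `r^*(q_i, p² q_j) / e(q_i)`. -/
def eichlerMatrix {m h : ℕ} (qs : Fin h → Form m) (p : ℕ) : Matrix (Fin h) (Fin h) ℚ :=
  Matrix.of fun i j => normPrimRep (qs i) (qs j) p

/-- The average `∑_j r^*(q_j, p² q) / e(q_j)`. -/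
def eichlerMean {m h : ℕ} (q : Form m) (qs : Fin h → Form m) (p : ℕ) : ℚ :=
  ∑ j, normPrimRep (qs j) q p

/-! ### Local constants for forms in `2k+1` variables -/

/-- `∏_{i=1}^{a-1} (p^{2(k-i)} - 1) / (1 - p^{-i})`. -/
def localProd (k p a : ℕ) : ℚ :=
  ∏ i ∈ Finset.Ico 1 a, ((p : ℚ) ^ (2 * (k - i)) - 1) / (1 - ((p : ℚ) ^ i)⁻¹)

/-- `c_p = ∑_{a=1}^k p^{1-a} ∏_{i=1}^{a-1} (p^{2(k-i)} - 1) / (1 - p^{-i})`. -/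
def cConst (k p : ℕ) : ℚ :=
  ∑ a ∈ Finset.Icc 1 k, localProd k p a * ((p : ℚ) ^ (a - 1))⁻¹

/-- `β_p = ∑_{a=1}^k ∏_{i=1}^{a-1} (p^{2(k-i)} - 1) / (1 - p^{-i})
  * (p^{m-2} - p^{a-1}(p+1) + 1) / (p^{a-1}(p^a - 1))`, where `m = 2k+1`. -/
def betaConst (k p : ℕ) : ℚ :=
  ∑ a ∈ Finset.Icc 1 k, localProd k p a *
    (((p : ℚ) ^ (2 * k - 1) - (p : ℚ) ^ (a - 1) * ((p : ℚ) + 1) + 1) /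
      ((p : ℚ) ^ (a - 1) * ((p : ℚ) ^ a - 1)))

/-- The character `χ_p(q) = ((-1)^k det q / p)` of a form in `2k+1` variables. -/
def formChar {k : ℕ} (q : Form (2 * k + 1)) (p : Nat.Primes) : ℤ :=
  haveI : Fact (p : ℕ).Prime := ⟨p.2⟩
  legendreSym p ((-1) ^ k * formDet q)

/-- The Legendre symbol `(2a / p)`. -/
def epsSym (a : ℤ) (p : Nat.Primes) : ℤ :=
  haveI : Fact (p : ℕ).Prime := ⟨p.2⟩
  legendreSym p (2 * a)

/-! ### Formal Dirichlet series and formal Euler products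

A formal Dirichlet series `∑_{n ≥ 1} f(n) n^{-s}` with coefficients in a (possibly noncommutative)
ring is an `ArithmeticFunction`; multiplication is Dirichlet convolution. -/

section Formal

variable {R : Type*} [Ring R]

/-- The formal Dirichlet series `f(p^{-s})` obtained from a power series `f(t)`. -/
def ofPower (p : Nat.Primes) (f : R⟦X⟧) : ArithmeticFunction R where
  toFun n := if n = (p : ℕ) ^ n.factorization p then PowerSeries.coeff (n.factorization p) f else 0
  map_zero' := by simp

/-- `Z` is the formal product `∏_{p ∈ P} F_p`: the factors commute with each other, and each
coefficient of the finite partial products is eventually equal to that of `Z`. -/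
def IsFormalProduct (P : Set Nat.Primes) (F : Nat.Primes → ArithmeticFunction R)
    (Z : ArithmeticFunction R) : Prop :=
  ∃ hcomm : P.Pairwise (Function.onFun Commute F),
    ∀ n : ℕ, ∃ S₀ : Finset Nat.Primes, (S₀ : Set Nat.Primes) ⊆ P ∧
      ∀ (S : Finset Nat.Primes) (hS : (S : Set Nat.Primes) ⊆ P), S₀ ⊆ S →
        S.noncommProd F (hcomm.mono hS) n = Z n

end Formal

/-- The primes not dividing `det q`. -/
def goodPrimes {m : ℕ} (q : Form m) : Set Nat.Primes := {p | ¬ ((p : ℕ) : ℤ) ∣ formDet q}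

/-- The power series
`(1 - χ_p(q) (2a/p) p^{k-1} t) / (1 - c_p⁻¹ (T - β_p) t + p^{m-2} t²)`, `m = 2k+1`, in one
variable `t` over a `ℚ`-algebra containing `T`. The numerator is central, and the denominator has
constant coefficient `1`, so that the quotient makes sense. -/
def localFactor {k : ℕ} (q : Form (2 * k + 1)) (a : ℤ) {R : Type*} [Ring R] [Algebra ℚ R]
    (T : R) (p : Nat.Primes) : R⟦X⟧ :=
  (1 - PowerSeries.C (algebraMap ℚ R
      ((formChar q p : ℚ) * (epsSym a p : ℚ) * ((p : ℕ) : ℚ) ^ (k - 1))) * PowerSeries.X) *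
  PowerSeries.invOfUnit
    (1 - PowerSeries.C ((cConst k p)⁻¹ • (T - algebraMap ℚ R (betaConst k p))) * PowerSeries.X
      + PowerSeries.C (algebraMap ℚ R (((p : ℕ) : ℚ) ^ (2 * k - 1))) * PowerSeries.X ^ 2) 1

/-- The formal Dirichlet series `∑_{(n, D) = 1} v(n² a) n^{-s}`, over positive integers `n`. -/
def squareSeries {M : Type*} [AddCommMonoid M] (v : ℤ → M) (D a : ℤ) : ArithmeticFunction M where
  toFun n := if n ≠ 0 ∧ IsCoprime (n : ℤ) D then v ((n : ℤ) ^ 2 * a) else 0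
  map_zero' := by simp

end ReprZeta

end

open scoped PowerSeries

namespace ReprZeta

/-! ### Formal Euler products -/

section FormalProduct

variable {R : Type*} [Ring R]

/-! Fix a good prime `p` (odd, because `det q` is even for `m` odd) and write `L` for `ℤ^m`. The
matrices representing `p² q_l` primitively by `q₀`, taken modulo units of `q_l`, correspond to the
neighbours of `q₀`: the sublattices of `L` of index `p^m` on which `p²` divides `q₀` and which are
not inside `pL`. Hence applying the Eichler matrix to representation numbers of `n` counts pairs
(neighbour `K`, vector `y ∈ K` with `q₀ y = p² n`) (`sum_primRep_eq_sum_nbrs`,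
`sum_primRep_mul_repNum`). Counting by `y` instead requires the number of neighbours through a given
vector. It is `c_p` if `y ∉ pL`; it is `c_p (1 + χ_p(q) (2q₀(x)/p) p^{k-1}) + β_p` if `y = px` with
`x ∉ pL`; it is `c_p (1 + p^{2k-1}) + β_p` if `y ∈ p²L`.

These local numbers come from `L/p²L`, where neighbours become self-orthogonal subgroups other than
`pL/p²L`. They are sorted by the rank `d ≤ k` of their reduction modulo `p` and counted by flags of
isotropic vectors (`Split.ncard_lagr`, `ncard_lagr_mem_up`); the isotropic vectors over `𝔽_p` are
counted by Gauss sums.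

With `γ = c_p⁻¹ (T - β_p)` and `u_e = r(p^{2e} n² a)`, `p ∤ n`, the counts say `γ u_0 = u_1 + ε u_0`
and `γ u_{e+1} = u_{e+2} + p^{m-2} u_e`, where `ε = χ_p(q) (2a/p) p^{k-1}`. So `∑ u_e t^e` is the
local factor applied to `u_0`. Eichler matrices at different primes commute, since their product in
either order counts primitive representations with multiplier `(pp')²` (`commute_eichlerMatrix`),
and the Euler product is obtained by peeling off one prime at a time.

For the averages, the duality `D ↦ p² D⁻¹` gives `r^*(q_i, p² q_j) = r^*(q_j, p² q_i)`. Every column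
of the Eichler matrix therefore sums to the number of neighbours of `q_j`, which does not depend on
`j`, and summing coordinates turns the matrix identities into scalar ones. -/

theorem ofPower_apply_pow (p : Nat.Primes) (f : R⟦X⟧) (e : ℕ) :
    ofPower p f ((p : ℕ) ^ e) = PowerSeries.coeff e f := by
  have h : ((p : ℕ) ^ e).factorization p = e := by
    rw [p.2.factorization_pow, Finsupp.single_eq_same]
  change (if (p : ℕ) ^ e = (p : ℕ) ^ ((p : ℕ) ^ e).factorization p then _ else 0) = _
  rw [h, if_pos rfl]

theorem ofPower_apply_eq_zero (p : Nat.Primes) (f : R⟦X⟧) {n : ℕ}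
    (h : ∀ e, n ≠ (p : ℕ) ^ e) : ofPower p f n = 0 :=
  if_neg (h _)

theorem commute_ofPower {p p' : Nat.Primes} {f g : R⟦X⟧}
    (h : ∀ i j, Commute (PowerSeries.coeff i f) (PowerSeries.coeff j g)) :
    Commute (ofPower p f) (ofPower p' g) := by
  ext n
  rw [ArithmeticFunction.mul_apply, ArithmeticFunction.mul_apply]
  conv_rhs => rw [← Nat.map_swap_divisorsAntidiagonal, Finset.sum_map]
  refine Finset.sum_congr rfl fun ab _ => ?_
  obtain ⟨a, b⟩ := ab
  simp only [Equiv.coe_toEmbedding, Equiv.prodComm_apply, Prod.fst_swap, Prod.snd_swap]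
  by_cases h1 : ∃ e, a = (p : ℕ) ^ e
  · by_cases h2 : ∃ e, b = (p' : ℕ) ^ e
    · obtain ⟨e, rfl⟩ := h1
      obtain ⟨e', h2⟩ := h2
      rw [h2, ofPower_apply_pow, ofPower_apply_pow]
      exact h _ _
    · push Not at h2
      simp [ofPower_apply_eq_zero p' g h2]
  · push Not at h1
    simp [ofPower_apply_eq_zero p f h1]

/-- Because `G` vanishes on multiples of `p`, the only factorisation of `p^e n` that contributes is
`(p^e, n)`. -/
theorem ofPower_mul_apply (p : Nat.Primes) (f : R⟦X⟧) (G : ArithmeticFunction R)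
    (hG : ∀ n, (p : ℕ) ∣ n → G n = 0) (e n : ℕ) (hn : ¬ (p : ℕ) ∣ n) :
    (ofPower p f * G) ((p : ℕ) ^ e * n) = PowerSeries.coeff e f * G n := by
  have hp := p.2
  have hn0 : n ≠ 0 := fun h => hn (h ▸ dvd_zero _)
  rw [ArithmeticFunction.mul_apply, Finset.sum_eq_single ((p : ℕ) ^ e, n), ofPower_apply_pow]
  · rintro ⟨a, b⟩ hab hne
    simp only [Nat.mem_divisorsAntidiagonal] at hab
    by_cases h1 : ∃ i, a = (p : ℕ) ^ i
    · obtain ⟨i, rfl⟩ := h1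
      by_cases hb : (p : ℕ) ∣ b
      · simp [hG b hb]
      · exfalso
        have key := congrArg (fun x => x.factorization p) hab.1
        have hb0 : b ≠ 0 := fun h => hb (h ▸ dvd_zero _)
        simp only [Nat.factorization_mul (pow_ne_zero _ hp.ne_zero) hb0,
          Nat.factorization_mul (pow_ne_zero _ hp.ne_zero) hn0, hp.factorization_pow,
          Finsupp.add_apply, Finsupp.single_eq_same, Nat.factorization_eq_zero_of_not_dvd hb,
          Nat.factorization_eq_zero_of_not_dvd hn, add_zero] at key
        subst key
        exact hne (by rw [Nat.eq_of_mul_eq_mul_left (pow_pos hp.pos _) hab.1])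
    · push Not at h1
      simp [ofPower_apply_eq_zero p f h1]
  · intro h
    exact (h (by simp [hn0, hp.ne_zero])).elim

/-- The coefficient of a finite partial product at `n` sees only the primes dividing `n`, so the
full coefficient is read off from the product over those primes. The action `ρ` covers both matrices
acting on vectors and scalars; `hv`, required for every `n` prime to `p`, is what allows the primes
of `n` to be removed one by one. -/
theorem exists_isFormalProduct_squareSeries {M : Type*} [AddCommGroup M] (P : Set Nat.Primes)
    (f : Nat.Primes → R⟦X⟧) (hf : ∀ p ∈ P, PowerSeries.coeff 0 (f p) = 1)
    (hcomm : ∀ p ∈ P, ∀ p' ∈ P, p ≠ p' →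
      ∀ i j, Commute (PowerSeries.coeff i (f p)) (PowerSeries.coeff j (f p')))
    (ρ : R →+* AddMonoid.End M) (v : ℤ → M) (D a : ℤ)
    (hP : ∀ p : Nat.Primes, p ∈ P ↔ ¬ ((p : ℕ) : ℤ) ∣ D)
    (hv : ∀ p ∈ P, ∀ n : ℕ, ¬ (p : ℕ) ∣ n → ∀ e : ℕ, ρ (PowerSeries.coeff e (f p))
      (v ((n : ℤ) ^ 2 * a)) = v ((((p : ℕ) ^ e * n : ℕ) : ℤ) ^ 2 * a)) :
    ∃ Z : ArithmeticFunction R, IsFormalProduct P (fun p => ofPower p (f p)) Z ∧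
      ∀ n : ℕ, squareSeries v D a n = ρ (Z n) (v a) := by
  classical
  set F : Nat.Primes → ArithmeticFunction R := fun p => ofPower p (f p) with hF
  have hc : P.Pairwise (Function.onFun Commute F) := fun p hp p' hp' hne =>
    commute_ofPower (hcomm p hp p' hp' hne)
  -- the partial products are supported on `S`-smooth numbers
  have hsupp : ∀ (S : Finset Nat.Primes) (hS : (S : Set Nat.Primes) ⊆ P) (n : ℕ)
      (p : Nat.Primes), p ∉ S → (p : ℕ) ∣ n → S.noncommProd F (hc.mono hS) n = 0 := by
    intro S
    induction S using Finset.induction_on with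
    | empty =>
      intro _ n p _ hpn
      rw [Finset.noncommProd_empty, ArithmeticFunction.one_apply_ne]
      rintro rfl
      exact p.2.one_lt.ne' (Nat.dvd_one.1 hpn)
    | insert r S hr ih =>
      intro hS n p hp hpn
      rw [Finset.noncommProd_insert_of_notMem _ _ _ _ hr, ArithmeticFunction.mul_apply]
      refine Finset.sum_eq_zero ?_
      rintro ⟨x, y⟩ hxy
      simp only [Nat.mem_divisorsAntidiagonal] at hxy
      simp only [Finset.mem_insert, not_or] at hp
      rw [Finset.coe_insert, Set.insert_subset_iff] at hS
      by_cases h1 : ∃ i, x = (r : ℕ) ^ i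
      · obtain ⟨i, rfl⟩ := h1
        have : (p : ℕ) ∣ y := by
          rw [← hxy.1] at hpn
          refine (Nat.Coprime.dvd_of_dvd_mul_left ?_ hpn)
          exact Nat.Coprime.pow_right _ ((Nat.coprime_primes p.2 r.2).2
            fun h => hp.1 (Subtype.ext h))
        rw [ih hS.2 y p hp.2 this, mul_zero]
      · push Not at h1
        exact mul_eq_zero_of_left (ofPower_apply_eq_zero r _ h1) _
  -- one more factor
  have hins : ∀ (S : Finset Nat.Primes) (r : Nat.Primes) (hr : r ∉ S)
      (hS : (S : Set Nat.Primes) ⊆ P) (hS' : ((insert r S : Finset _) : Set Nat.Primes) ⊆ P)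
      (e n : ℕ), ¬ (r : ℕ) ∣ n → (insert r S).noncommProd F (hc.mono hS') ((r : ℕ) ^ e * n) =
        PowerSeries.coeff e (f r) * S.noncommProd F (hc.mono hS) n := by
    intro S r hr hS hS' e n hn
    rw [Finset.noncommProd_insert_of_notMem _ _ _ _ hr]
    exact ofPower_mul_apply r (f r) _ (fun n h => hsupp S hS n r hr h) e n hn
  -- A prime not dividing `n` contributes only its constant coefficient, which is `1`.
  have hstab : ∀ (n : ℕ) (S₀ : Finset Nat.Primes) (hS₀ : (S₀ : Set Nat.Primes) ⊆ P),
      (∀ p ∈ P, (p : ℕ) ∣ n → p ∈ S₀) → ∀ (T : Finset Nat.Primes), Disjoint T S₀ →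
      ∀ hT : ((T ∪ S₀ : Finset _) : Set Nat.Primes) ⊆ P,
        (T ∪ S₀).noncommProd F (hc.mono hT) n = S₀.noncommProd F (hc.mono hS₀) n := by
    intro n S₀ hS₀ h0 T
    induction T using Finset.induction_on with
    | empty =>
      intro _ _
      exact congrArg (fun G : ArithmeticFunction R => G n)
        (Finset.noncommProd_congr (Finset.empty_union S₀) (fun _ _ => rfl) _)
    | insert r T hr ih =>
      intro hd hT
      rw [Finset.disjoint_insert_left] at hd
      have hrT : r ∉ T ∪ S₀ := by simp [hr, hd.1]
      have hT' : ((T ∪ S₀ : Finset _) : Set Nat.Primes) ⊆ P := fun x hx => hT (by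
        simp only [Finset.coe_union, Set.mem_union, Finset.mem_coe, Finset.insert_union,
          Finset.coe_insert, Set.mem_insert_iff] at hx ⊢
        exact Or.inr hx)
      have hrP : r ∈ P := hT (by simp)
      have hT'' : ((insert r (T ∪ S₀) : Finset _) : Set Nat.Primes) ⊆ P := by
        rwa [← Finset.insert_union]
      have hrn : ¬ (r : ℕ) ∣ n := fun h => hd.1 (h0 r hrP h)
      have key := hins (T ∪ S₀) r hrT hT' hT'' 0 n hrn
      rw [pow_zero, one_mul, hf r hrP, one_mul, ih hd.2 hT'] at key
      rw [← key]
      exact congrArg (fun G : ArithmeticFunction R => G n)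
        (Finset.noncommProd_congr (Finset.insert_union r T S₀) (fun _ _ => rfl) _)
  have hact : ∀ (S : Finset Nat.Primes) (hS : (S : Set Nat.Primes) ⊆ P) (n : ℕ), n ≠ 0 →
      (∀ p : Nat.Primes, (p : ℕ) ∣ n → p ∈ S) →
      ρ (S.noncommProd F (hc.mono hS) n) (v a) = v ((n : ℤ) ^ 2 * a) := by
    intro S
    induction S using Finset.induction_on with
    | empty =>
      intro _ n hn h
      have : n = 1 := by
        by_contra hne
        obtain ⟨p, hp, hpn⟩ := Nat.exists_prime_and_dvd hne
        exact absurd (h ⟨p, hp⟩ hpn) (Finset.notMem_empty _)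
      subst this
      simp
    | insert r S hr ih =>
      intro hS n hn h
      have hS2 := hS
      rw [Finset.coe_insert, Set.insert_subset_iff] at hS2
      obtain ⟨e, n', hn', rfl⟩ := Nat.exists_eq_pow_mul_and_not_dvd hn (r : ℕ) r.2.ne_one
      rw [hins S r hr hS2.2 hS e n' hn', map_mul, AddMonoid.End.coe_mul, Function.comp_apply,
        ih hS2.2 n' (right_ne_zero_of_mul hn), hv r hS2.1 n' hn' e]
      intro p hp
      rcases Finset.mem_insert.1 (h p (hp.mul_left _)) with rfl | h'
      · exact absurd hp hn'
      · exact h'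
  have hfin : ∀ n : ℕ, n ≠ 0 → ∃ S : Finset Nat.Primes, (S : Set Nat.Primes) ⊆ P ∧
      ∀ p : Nat.Primes, p ∈ S ↔ p ∈ P ∧ (p : ℕ) ∣ n := by
    intro n hn
    have hfi : {p : Nat.Primes | p ∈ P ∧ (p : ℕ) ∣ n}.Finite := by
      refine Set.Finite.of_finite_image (f := fun p : Nat.Primes => (p : ℕ)) ?_
        (Subtype.val_injective.injOn)
      refine n.divisors.finite_toSet.subset ?_
      rintro _ ⟨p, hp, rfl⟩
      simpa [hn] using hp.2
    exact ⟨hfi.toFinset, fun p hp => (hfi.mem_toFinset.1 hp).1, fun p => hfi.mem_toFinset⟩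
  choose S hSP hS using hfin
  refine ⟨⟨fun n => if hn : n ≠ 0 then (S n hn).noncommProd F (hc.mono (hSP n hn)) n else 0,
    by simp⟩, ⟨hc, fun n => ?_⟩, fun n => ?_⟩
  · by_cases hn : n = 0
    · subst hn
      exact ⟨∅, by simp, fun S hS _ => by simp⟩
    · refine ⟨S n hn, hSP n hn, fun S' hS' hsub => ?_⟩
      have hU : S' \ S n hn ∪ S n hn = S' := Finset.sdiff_union_of_subset hsub
      have key := hstab n (S n hn) (hSP n hn) (fun p hp hpn => (hS n hn p).2 ⟨hp, hpn⟩)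
        (S' \ S n hn) Finset.sdiff_disjoint (by rwa [hU])
      refine Eq.trans ?_ (key.trans ?_)
      · exact congrArg (fun G : ArithmeticFunction R => G n)
          (Finset.noncommProd_congr hU.symm (fun _ _ => rfl) _)
      · change _ = (if hn : n ≠ 0 then (S n hn).noncommProd F (hc.mono (hSP n hn)) n else 0)
        rw [dif_pos hn]
  · change (if n ≠ 0 ∧ IsCoprime (n : ℤ) D then v ((n : ℤ) ^ 2 * a) else 0) =
      ρ (if hn : n ≠ 0 then (S n hn).noncommProd F (hc.mono (hSP n hn)) n else 0) (v a)
    by_cases hn : n = 0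
    · simp [hn]
    · rw [dif_pos hn]
      by_cases hcop : IsCoprime (n : ℤ) D
      · rw [if_pos ⟨hn, hcop⟩, hact _ (hSP n hn) _ hn]
        intro p hp
        refine (hS n hn p).2 ⟨(hP p).2 fun hpD => ?_, hp⟩
        exact (Nat.prime_iff_prime_int.1 p.2).not_isUnit
          (hcop.isUnit_of_dvd' (Int.natCast_dvd_natCast.2 hp) hpD)
      -- Here `n` and `D` share a prime. It lies outside `P`, hence outside `S n`, so the partial
      -- product vanishes at `n`.
      · rw [if_neg (fun h => hcop h.2)]
        rw [Int.isCoprime_iff_gcd_eq_one] at hcop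
        obtain ⟨p, hp, hpd⟩ := Nat.exists_prime_and_dvd hcop
        have hpn : p ∣ n := Int.natCast_dvd_natCast.1
          ((Int.natCast_dvd_natCast.2 hpd).trans (Int.gcd_dvd_left ..))
        have hpD : (p : ℤ) ∣ D := (Int.natCast_dvd_natCast.2 hpd).trans (Int.gcd_dvd_right ..)
        rw [hsupp _ (hSP n hn) n ⟨p, hp⟩ (fun h => (hP ⟨p, hp⟩).1 ((hS n hn _).1 h).1 hpD) hpn]
        simp

theorem invOfUnit_recurrence (γ P : R) {g : R⟦X⟧} (hg : g = PowerSeries.invOfUnit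
      (1 - PowerSeries.C γ * PowerSeries.X + PowerSeries.C P * PowerSeries.X ^ 2) 1) :
    PowerSeries.coeff 0 g = 1 ∧ PowerSeries.coeff 1 g = γ ∧ ∀ n, PowerSeries.coeff (n + 2) g =
      γ * PowerSeries.coeff (n + 1) g - P * PowerSeries.coeff n g := by
  have h1 : (1 - PowerSeries.C γ * PowerSeries.X + PowerSeries.C P * PowerSeries.X ^ 2) * g = 1 := by
    rw [hg]
    exact PowerSeries.mul_invOfUnit _ _ (by simp)
  have h2 : g = 1 + PowerSeries.C γ * (PowerSeries.X * g) -
      PowerSeries.C P * (PowerSeries.X * (PowerSeries.X * g)) := by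
    rw [← h1]; noncomm_ring
  have h0 : PowerSeries.coeff 0 g = 1 := by
    rw [h2]; simp
  refine ⟨h0, ?_, fun n => ?_⟩
  · conv_lhs => rw [h2]
    rw [map_sub, map_add, PowerSeries.coeff_C_mul, PowerSeries.coeff_C_mul,
      PowerSeries.coeff_succ_X_mul, PowerSeries.coeff_succ_X_mul, h0]
    simp [PowerSeries.coeff_one]
  · conv_lhs => rw [h2]
    rw [map_sub, map_add, PowerSeries.coeff_C_mul, PowerSeries.coeff_C_mul,
      PowerSeries.coeff_succ_X_mul, PowerSeries.coeff_succ_X_mul, PowerSeries.coeff_succ_X_mul]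
    simp [PowerSeries.coeff_one]

/-- Writing `f = (1 - eX) g`, each coefficient `f_{n+1}` is `g_{n+1} - e g_n`. Centrality of `e`
lets the recurrence of `g` pass to `f`; the numerator only alters the initial value. -/
theorem localQuotient_recurrence (e γ P : R) (he : ∀ x, Commute e x) {f : R⟦X⟧}
    (hf : f = (1 - PowerSeries.C e * PowerSeries.X) * PowerSeries.invOfUnit
      (1 - PowerSeries.C γ * PowerSeries.X + PowerSeries.C P * PowerSeries.X ^ 2) 1) :
    PowerSeries.coeff 0 f = 1 ∧ PowerSeries.coeff 1 f = γ - e ∧ ∀ n, PowerSeries.coeff (n + 2) f =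
      γ * PowerSeries.coeff (n + 1) f - P * PowerSeries.coeff n f := by
  obtain ⟨g0, g1, g2⟩ := invOfUnit_recurrence γ P rfl
  set g := PowerSeries.invOfUnit
      (1 - PowerSeries.C γ * PowerSeries.X + PowerSeries.C P * PowerSeries.X ^ 2) 1
  have f0 : PowerSeries.coeff 0 f = 1 := by
    rw [hf, sub_mul, mul_assoc, map_sub, one_mul, g0]; simp
  have f1 : ∀ n, PowerSeries.coeff (n + 1) f =
      PowerSeries.coeff (n + 1) g - e * PowerSeries.coeff n g := fun n => by
    rw [hf, sub_mul, mul_assoc, map_sub, PowerSeries.coeff_C_mul, PowerSeries.coeff_succ_X_mul,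
      one_mul]
  refine ⟨f0, by rw [f1, g0, mul_one, ← g1], fun n => ?_⟩
  -- The case `n = 0` is separate because `f_0` is not of the form `g_{n+1} - e g_n`.
  rcases n with - | n
  · rw [f1, f1, f0, g2, g1, g0, mul_one, mul_one, mul_sub, (he γ).eq]
    abel
  · rw [f1, f1, f1, g2, mul_sub γ, mul_sub P, ← mul_assoc γ e, ← (he γ).eq, ← mul_assoc P e,
      ← (he P).eq, mul_assoc, mul_assoc, g2 n, mul_sub e]
    abel

theorem commute_coeff_of_recurrence {e γ P x : R} {f : R⟦X⟧} (hf : PowerSeries.coeff 0 f = 1 ∧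
      PowerSeries.coeff 1 f = γ - e ∧ ∀ n, PowerSeries.coeff (n + 2) f =
      γ * PowerSeries.coeff (n + 1) f - P * PowerSeries.coeff n f)
    (he : Commute e x) (hγ : Commute γ x) (hP : Commute P x) (n : ℕ) :
    Commute (PowerSeries.coeff n f) x := by
  obtain ⟨f0, f1, f2⟩ := hf
  induction n using Nat.strong_induction_on with
  | _ n ih =>
    match n with
    | 0 => rw [f0]; exact Commute.one_left x
    | 1 => rw [f1]; exact hγ.sub_left he
    | n + 2 =>
      rw [f2]
      exact (hγ.mul_left (ih (n + 1) (by omega))).sub_left (hP.mul_left (ih n (by omega)))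

/-- The hypotheses are the coefficients of `(1 - γX + PX²) ∑ u_n X^n = (1 - eX) u_0`. -/
theorem apply_coeff_of_recurrence {M : Type*} [AddCommGroup M] {e γ P : R} {f : R⟦X⟧}
    (hf : PowerSeries.coeff 0 f = 1 ∧ PowerSeries.coeff 1 f = γ - e ∧ ∀ n,
      PowerSeries.coeff (n + 2) f = γ * PowerSeries.coeff (n + 1) f - P * PowerSeries.coeff n f)
    (ρ : R →+* AddMonoid.End M) (u : ℕ → M) (h1 : ρ γ (u 0) = u 1 + ρ e (u 0))
    (h2 : ∀ n, ρ γ (u (n + 1)) = u (n + 2) + ρ P (u n)) (n : ℕ) :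
    ρ (PowerSeries.coeff n f) (u 0) = u n := by
  obtain ⟨f0, f1, f2⟩ := hf
  have hsub : ∀ x y m, ρ (x - y) m = ρ x m - ρ y m := fun x y m => by rw [map_sub]; rfl
  have hmul : ∀ x y m, ρ (x * y) m = ρ x (ρ y m) := fun x y m => by rw [map_mul]; rfl
  induction n using Nat.strong_induction_on with
  | _ n ih =>
    match n with
    | 0 => rw [f0]; simp
    | 1 => rw [f1, hsub, h1]; simp
    | n + 2 =>
      rw [f2, hsub, hmul, hmul, ih (n + 1) (by omega), ih n (by omega), h2]
      abel

end FormalProduct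

end ReprZeta

namespace ReprZeta

/-! ### Orthogonal complements in finite groups with a pairing -/

section Pairing

variable {N : ℕ} {V : Type*} [AddCommGroup V]

/-- The orthogonal complement of a subgroup with respect to a pairing. -/
def perp (β : V →+ V →+ ZMod N) (B : AddSubgroup V) : AddSubgroup V where
  carrier := {v | ∀ b ∈ B, β b v = 0}
  zero_mem' := by simp
  add_mem' := fun hx hy b hb => by simp [hx b hb, hy b hb]
  neg_mem' := fun hx b hb => by simp [hx b hb]

theorem mem_perp {β : V →+ V →+ ZMod N} {B : AddSubgroup V} {v : V} :
    v ∈ perp β B ↔ ∀ b ∈ B, β b v = 0 := Iff.rfl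

theorem perp_anti (β : V →+ V →+ ZMod N) {B C : AddSubgroup V} (h : B ≤ C) :
    perp β C ≤ perp β B := fun _ hv b hb => hv b (h hb)

open Classical in
theorem sum_stdAddChar [NeZero N] {A : Type*} [AddCommGroup A] [Fintype A] (χ : A →+ ZMod N) :
    ∑ a, ZMod.stdAddChar (χ a) = if χ = 0 then (Fintype.card A : ℂ) else 0 := by
  have h := AddChar.sum_eq_ite (ZMod.stdAddChar.compAddMonoidHom χ)
  have h2 : (ZMod.stdAddChar.compAddMonoidHom χ : AddChar A ℂ) = 0 ↔ χ = 0 := by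
    constructor
    · intro h
      ext a
      have ha : ZMod.stdAddChar (χ a) = (1 : ℂ) := DFunLike.congr_fun h a
      rw [← AddChar.map_zero_eq_one (ZMod.stdAddChar (N := N))] at ha
      exact ZMod.injective_stdAddChar ha
    · rintro rfl
      ext a
      simp
  simp only [h2] at h
  exact h

/-- Sum the character values of `β b v` over `B × V` in two ways. Summing over `v` first leaves only
`b = 0`, by nondegeneracy; summing over `b` first leaves `|B|` for each `v` in the complement. -/
theorem card_mul_card_perp [NeZero N] [Finite V] (β : V →+ V →+ ZMod N)
    (hβ : ∀ u, (∀ v, β u v = 0) → u = 0) (B : AddSubgroup V) :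
    Nat.card B * Nat.card (perp β B) = Nat.card V := by
  classical
  cases nonempty_fintype V
  have h1 : ∑ b : B, ∑ v : V, (ZMod.stdAddChar (β b v) : ℂ) = Fintype.card V := by
    rw [Finset.sum_eq_single (0 : B)]
    · simp
    · intro b _ hb
      rw [sum_stdAddChar (β b), if_neg]
      intro h
      exact hb (Subtype.ext (hβ b fun v => by rw [h]; rfl))
    · simp
  rw [Finset.sum_comm] at h1
  have h2 : ∀ v : V, ∑ b : B, (ZMod.stdAddChar (β b v) : ℂ) =
      if v ∈ perp β B then (Fintype.card B : ℂ) else 0 := by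
    intro v
    refine (sum_stdAddChar ((β.flip v).comp B.subtype)).trans ?_
    refine if_congr ⟨fun h b hb => DFunLike.congr_fun h (⟨b, hb⟩ : B), fun h => ?_⟩ rfl rfl
    ext b
    exact h b b.2
  simp only [h2] at h1
  rw [← Finset.sum_filter, Finset.sum_const, nsmul_eq_mul] at h1
  have h3 : (Finset.univ.filter fun v => v ∈ perp β B).card = Nat.card (perp β B) := by
    rw [Nat.card_eq_fintype_card, Fintype.card_subtype]
  rw [h3] at h1
  rw [Nat.card_eq_fintype_card (α := V), Nat.card_eq_fintype_card (α := B), mul_comm]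
  exact_mod_cast h1

theorem perp_perp [NeZero N] [Finite V] (β : V →+ V →+ ZMod N)
    (hβ : ∀ u, (∀ v, β u v = 0) → u = 0) (hs : ∀ u v, β u v = β v u) (B : AddSubgroup V) :
    perp β (perp β B) = B := by
  symm
  refine AddSubgroup.eq_of_le_of_card_ge (fun b hb v hv => by rw [hs]; exact hv b hb) ?_
  have h1 := card_mul_card_perp β hβ B
  have h2 := card_mul_card_perp β hβ (perp β B)
  have h3 : 0 < Nat.card (perp β B) := Nat.card_pos
  rw [← h1, mul_comm] at h2
  exact (Nat.eq_of_mul_eq_mul_right h3 h2).le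

end Pairing

/-! ### Gauss sums of quadratic forms over prime fields -/

section Gauss

variable {p : ℕ} [Fact p.Prime]

/-- The quadratic character modulo `p` with complex values. -/
noncomputable def quadChar (p : ℕ) [Fact p.Prime] : MulChar (ZMod p) ℂ :=
  (quadraticChar (ZMod p)).ringHomComp (Int.castRingHom ℂ)

theorem quadChar_apply (a : ZMod p) : quadChar p a = (quadraticChar (ZMod p) a : ℂ) := rfl

theorem quadChar_ne_one (hp : p ≠ 2) : quadChar p ≠ 1 := by
  intro h
  obtain ⟨a, ha⟩ := quadraticChar_exists_neg_one' (F := ZMod p) (by rwa [ZMod.ringChar_zmod_n])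
  have h1 := DFunLike.congr_fun h (a : ZMod p)
  rw [quadChar_apply, ha, MulChar.one_apply_coe] at h1
  norm_num at h1

theorem quadChar_isQuadratic : (quadChar p).IsQuadratic :=
  (quadraticChar_isQuadratic (ZMod p)).comp _

theorem quadChar_sq {a : ZMod p} (ha : a ≠ 0) : quadChar p a ^ 2 = 1 := by
  rw [quadChar_apply]
  exact_mod_cast quadraticChar_sq_one ha

/-- The quadratic Gauss sum. -/
noncomputable def quadGauss (p : ℕ) [Fact p.Prime] : ℂ := gaussSum (quadChar p) ZMod.stdAddChar

theorem quadGauss_sq (hp : p ≠ 2) : quadGauss p ^ 2 = quadChar p (-1) * p := by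
  have := gaussSum_sq (quadChar_ne_one hp) quadChar_isQuadratic (ZMod.isPrimitive_stdAddChar p)
  rwa [ZMod.card] at this

/-- An element `u` has `1 + χ(u)` square roots, and the part coming from `1` sums to zero. -/
theorem sum_stdAddChar_mul_sq (hp : p ≠ 2) {a : ZMod p} (ha : a ≠ 0) :
    ∑ t : ZMod p, (ZMod.stdAddChar (a * t ^ 2) : ℂ) = quadChar p a * quadGauss p := by
  have h1 : ∑ t : ZMod p, (ZMod.stdAddChar (a * t ^ 2) : ℂ) =
      ∑ u : ZMod p, (quadChar p u + 1) * ZMod.stdAddChar (u * a) := by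
    rw [← Finset.sum_fiberwise Finset.univ (fun t : ZMod p => t ^ 2)]
    refine Finset.sum_congr rfl fun u _ => ?_
    rw [Finset.sum_congr rfl (g := fun _ => (ZMod.stdAddChar (u * a) : ℂ)), Finset.sum_const,
      nsmul_eq_mul]
    · congr 1
      have := quadraticChar_card_sqrts (F := ZMod p) (by rwa [ZMod.ringChar_zmod_n]) u
      rw [quadChar_apply]
      have h2 : (Finset.univ.filter fun t : ZMod p => t ^ 2 = u) = {x | x ^ 2 = u}.toFinset := by
        ext; simp
      rw [h2]
      exact_mod_cast this
    · intro t ht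
      rw [← (Finset.mem_filter.1 ht).2, mul_comm]
  rw [h1]
  simp only [add_mul, one_mul, Finset.sum_add_distrib]
  rw [AddChar.sum_mulShift a (ZMod.isPrimitive_stdAddChar p), if_neg ha, Nat.cast_zero, add_zero]
  have h3 := gaussSum_mulShift (quadChar p) ZMod.stdAddChar (Units.mk0 a ha)
  rw [Units.val_mk0] at h3
  rw [quadGauss, ← h3, ← mul_assoc, ← sq, quadChar_sq ha, one_mul]
  refine Finset.sum_congr rfl fun u _ => ?_
  rw [AddChar.mulShift_apply, mul_comm a]

theorem two_ne_zero_of_ne_two (hp : p ≠ 2) : (2 : ZMod p) ≠ 0 := by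
  intro h
  have h1 : ((2 : ℕ) : ZMod p) = 0 := by exact_mod_cast h
  rw [ZMod.natCast_eq_zero_iff] at h1
  exact hp ((Nat.prime_dvd_prime_iff_eq Fact.out Nat.prime_two).1 h1)

theorem stdAddChar_sum {N : ℕ} [NeZero N] {ι : Type*} (s : Finset ι) (f : ι → ZMod N) :
    (ZMod.stdAddChar (∑ i ∈ s, f i) : ℂ) = ∏ i ∈ s, ZMod.stdAddChar (f i) := by
  classical
  induction s using Finset.induction_on with
  | empty => simp
  | insert i s hi ih => rw [Finset.sum_insert hi, Finset.prod_insert hi, AddChar.map_add_eq_mul, ih]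

theorem exists_transpose_mul_mul_eq_diagonal {F : Type*} [Field F] (h2 : (2 : F) ≠ 0) {n : ℕ}
    (Q : Matrix (Fin n) (Fin n) F) (hQ : Q.IsSymm) : ∃ (P : Matrix (Fin n) (Fin n) F)
    (d : Fin n → F), IsUnit P.det ∧ P.transpose * Q * P = Matrix.diagonal d := by
  have := invertibleOfNonzero h2
  have hs : LinearMap.IsSymm (Matrix.toBilin' Q) := ⟨fun x y => by
    rw [Matrix.toBilin'_apply', Matrix.toBilin'_apply', Matrix.dotProduct_mulVec,
      ← Matrix.mulVec_transpose, hQ.eq, dotProduct_comm]; rfl⟩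
  have hn : Module.finrank F (Fin n → F) = n := Module.finrank_fin_fun F
  obtain ⟨v, hv⟩ := LinearMap.BilinForm.exists_orthogonal_basis hs
  let w : Module.Basis (Fin n) F (Fin n → F) := v.reindex (finCongr hn)
  refine ⟨(Pi.basisFun F (Fin n)).toMatrix w, fun i => Matrix.toBilin' Q (w i) (w i), ?_, ?_⟩
  · have := Module.Basis.invertibleToMatrix (Pi.basisFun F (Fin n)) w
    exact Matrix.isUnit_det_of_invertible _
  · have h := LinearMap.BilinForm.toMatrix_mul_basis_toMatrix (Pi.basisFun F (Fin n)) w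
      (Matrix.toBilin' Q)
    rw [LinearMap.BilinForm.toMatrix_basisFun, LinearMap.BilinForm.toMatrix'_toBilin'] at h
    rw [h]
    ext i j
    rw [LinearMap.BilinForm.toMatrix_apply, Matrix.diagonal_apply]
    split_ifs with hij
    · rw [hij]
    · simp only [w, Module.Basis.reindex_apply]
      exact hv (fun h => hij ((finCongr hn).symm.injective h))

/-- After diagonalisation the sum is a product of one-variable Gauss sums; the base change alters
the determinant by a square, which `quadChar` ignores. -/
theorem sum_stdAddChar_quadratic (hp : p ≠ 2) {n : ℕ} (Q : Matrix (Fin n) (Fin n) (ZMod p))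
    (hQ : Q.IsSymm) (hdet : Q.det ≠ 0) {s : ZMod p} (hs : s ≠ 0) :
    ∑ x : Fin n → ZMod p, (ZMod.stdAddChar (s * (x ⬝ᵥ Q.mulVec x)) : ℂ) =
      quadChar p s ^ n * quadChar p Q.det * quadGauss p ^ n := by
  have h2 := two_ne_zero_of_ne_two hp
  obtain ⟨P, d, hP, hd⟩ := exists_transpose_mul_mul_eq_diagonal h2 Q hQ
  have hprod : ∏ i, d i = P.det ^ 2 * Q.det := by
    rw [← Matrix.det_diagonal, ← hd, Matrix.det_mul, Matrix.det_mul, Matrix.det_transpose]; ring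
  have hd0 : ∀ i, d i ≠ 0 := fun i hi => by
    rw [Finset.prod_eq_zero (Finset.mem_univ i) hi] at hprod
    exact mul_ne_zero (pow_ne_zero 2 hP.ne_zero) hdet hprod.symm
  have hbij : Function.Bijective P.mulVec := by
    rw [← Finite.injective_iff_bijective]
    exact Matrix.mulVec_injective_of_isUnit ((Matrix.isUnit_iff_isUnit_det P).2 hP)
  rw [← Function.Bijective.sum_comp hbij
    (fun x => (ZMod.stdAddChar (s * (x ⬝ᵥ Q.mulVec x)) : ℂ))]
  have h3 : ∀ y : Fin n → ZMod p, (ZMod.stdAddChar (s * (P.mulVec y ⬝ᵥ Q.mulVec (P.mulVec y))) : ℂ)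
      = ∏ i, ZMod.stdAddChar (s * d i * y i ^ 2) := by
    intro y
    have h4 : P.mulVec y ⬝ᵥ Q.mulVec (P.mulVec y) = ∑ i, d i * y i ^ 2 := by
      rw [← Matrix.vecMul_transpose P, ← Matrix.dotProduct_mulVec, Matrix.vecMul_transpose,
        Matrix.mulVec_mulVec, Matrix.mulVec_mulVec, hd, dotProduct]
      refine Finset.sum_congr rfl fun i _ => ?_
      rw [Matrix.mulVec_diagonal]; ring
    rw [h4, Finset.mul_sum, stdAddChar_sum]
    simp only [mul_assoc]
  simp only [h3]
  have h5 := Finset.prod_univ_sum (fun _ : Fin n => (Finset.univ : Finset (ZMod p)))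
    (fun i t => (ZMod.stdAddChar (s * d i * t ^ 2) : ℂ))
  rw [Fintype.piFinset_univ] at h5
  rw [← h5]
  rw [Finset.prod_congr rfl fun i _ => sum_stdAddChar_mul_sq hp (mul_ne_zero hs (hd0 i))]
  simp only [map_mul, Finset.prod_mul_distrib, Finset.prod_const, Finset.card_univ,
    Fintype.card_fin]
  rw [← map_prod, hprod, map_mul, map_pow, quadChar_sq hP.ne_zero, one_mul]

end Gauss

end ReprZeta

namespace ReprZeta

/-! ### Isotropic vectors over a prime field, counted by Gauss sums. -/

section IsotropicCount

/-- The pairing `x, y ↦ ᵗx Q y` on `(ℤ/N)ⁿ`. -/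
def matPairing {N n : ℕ} (Q : Matrix (Fin n) (Fin n) (ZMod N)) :
    (Fin n → ZMod N) →+ (Fin n → ZMod N) →+ ZMod N :=
  AddMonoidHom.mk' (fun x => AddMonoidHom.mk' (fun y => x ⬝ᵥ Q.mulVec y)
    (fun y z => by rw [Matrix.mulVec_add, dotProduct_add]))
    (fun x y => AddMonoidHom.ext fun z => add_dotProduct x y (Q.mulVec z))

theorem matPairing_apply {N n : ℕ} (Q : Matrix (Fin n) (Fin n) (ZMod N)) (x y : Fin n → ZMod N) :
    matPairing Q x y = x ⬝ᵥ Q.mulVec y := rfl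

theorem matPairing_comm {N n : ℕ} {Q : Matrix (Fin n) (Fin n) (ZMod N)} (hQ : Q.IsSymm)
    (x y : Fin n → ZMod N) : matPairing Q x y = matPairing Q y x := by
  rw [matPairing_apply, matPairing_apply, Matrix.dotProduct_mulVec, ← Matrix.mulVec_transpose,
    hQ.eq, dotProduct_comm]

theorem matPairing_nondegenerate {N n : ℕ} {Q : Matrix (Fin n) (Fin n) (ZMod N)}
    (hQ : Q.IsSymm) (hdet : IsUnit Q.det) (u : Fin n → ZMod N)
    (hu : ∀ v, matPairing Q u v = 0) : u = 0 := by
  have h1 : Q.mulVec u = 0 := by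
    ext i
    have := hu (Pi.single i 1)
    rw [matPairing_comm hQ, matPairing_apply, single_one_dotProduct] at this
    exact this
  exact Matrix.mulVec_injective_of_isUnit ((Matrix.isUnit_iff_isUnit_det Q).2 hdet)
    (by rw [h1, Matrix.mulVec_zero])

theorem pairing_smul_left {N : ℕ} {V : Type*} [AddCommGroup V] [Module (ZMod N) V]
    (β : V →+ V →+ ZMod N) (c : ZMod N) (x y : V) : β (c • x) y = c * β x y := by
  rw [← AddMonoidHom.flip_apply, ZMod.map_smul (β.flip y) c x]; rfl

theorem pairing_smul_right {N : ℕ} {V : Type*} [AddCommGroup V] [Module (ZMod N) V]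
    (β : V →+ V →+ ZMod N) (c : ZMod N) (x y : V) : β x (c • y) = c * β x y := by
  rw [ZMod.map_smul (β x) c y]; rfl

variable {p : ℕ} [Fact p.Prime]

/-- The condition `β w w = 0` is detected by averaging over `s`, and orthogonality to `f t` by
summing over `t`. The term `s = 0` gives `|V|`. For `s ≠ 0` the square is completed by `w ↦ w + s⁻¹
f t`, which separates `w` from `t`; the factor `2` in front of `β (f t) w` avoids halves. -/
theorem card_isotropic_orthogonal {V T : Type*} [AddCommGroup V] [Module (ZMod p) V]
    [Fintype V] [AddCommGroup T] [Fintype T] (hp : p ≠ 2) (β : V →+ V →+ ZMod p)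
    (hβ : ∀ u, (∀ v, β u v = 0) → u = 0) (hs : ∀ u v, β u v = β v u)
    (f : T →+ V) (hf : Function.Injective f) :
    (p : ℂ) * Nat.card T * ({w | (∀ t, β (f t) w = 0) ∧ β w w = 0} : Set V).ncard =
      Nat.card V + ∑ s ∈ Finset.univ.erase (0 : ZMod p),
        (∑ w : V, (ZMod.stdAddChar (s * β w w) : ℂ)) *
          ∑ t : T, ZMod.stdAddChar (-s⁻¹ * β (f t) (f t)) := by
  classical
  have h2 := two_ne_zero_of_ne_two hp
  have e1 : ∑ s : ZMod p, ∑ w : V, ∑ t : T,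
      (ZMod.stdAddChar (s * β w w + 2 * β (f t) w) : ℂ) =
      (p : ℂ) * Nat.card T * ({w | (∀ t, β (f t) w = 0) ∧ β w w = 0} : Set V).ncard := by
    have e2 : ∀ w : V, ∑ s : ZMod p, ∑ t : T,
        (ZMod.stdAddChar (s * β w w + 2 * β (f t) w) : ℂ) =
        if (∀ t, β (f t) w = 0) ∧ β w w = 0 then (p : ℂ) * Nat.card T else 0 := by
      intro w
      simp only [AddChar.map_add_eq_mul, ← Finset.mul_sum]
      rw [← Finset.sum_mul, AddChar.sum_mulShift _ (ZMod.isPrimitive_stdAddChar p)]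
      have e3 : ∑ t : T, (ZMod.stdAddChar (2 * β (f t) w) : ℂ) =
          if ∀ t, β (f t) w = 0 then (Nat.card T : ℂ) else 0 := by
        refine (sum_stdAddChar ((AddMonoidHom.mulLeft 2).comp ((β.flip w).comp f))).trans ?_
        rw [Nat.card_eq_fintype_card]
        refine if_congr ⟨fun h t => ?_, fun h => ?_⟩ rfl rfl
        · have := DFunLike.congr_fun h t
          exact (mul_eq_zero.1 (show 2 * β (f t) w = 0 from this)).resolve_left h2
        · ext t
          change 2 * β (f t) w = 0
          rw [h t, mul_zero]
      rw [e3, ZMod.card]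
      by_cases hA : (∀ t, β (f t) w = 0) ∧ β w w = 0
      · rw [if_pos hA.1, if_pos hA.2, if_pos hA]
      · rw [if_neg hA]
        by_cases hB : β w w = 0
        · rw [if_neg fun hC => hA ⟨hC, hB⟩, mul_zero]
        · rw [if_neg hB, Nat.cast_zero, zero_mul]
    rw [Finset.sum_comm]
    simp only [e2]
    rw [← Finset.sum_filter, Finset.sum_const, nsmul_eq_mul, mul_comm, Set.ncard_eq_toFinset_card']
    congr 3
    ext; simp
  rw [← e1, ← Finset.add_sum_erase _ _ (Finset.mem_univ (0 : ZMod p))]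
  congr 1
  · rw [Finset.sum_comm, Finset.sum_eq_single (0 : T)]
    · simp [Nat.card_eq_fintype_card]
    · intro t _ ht
      have := sum_stdAddChar (β (2 • f t))
      rw [if_neg] at this
      · rw [← this]
        refine Finset.sum_congr rfl fun w _ => ?_
        rw [two_nsmul, map_add β, AddMonoidHom.add_apply, zero_mul, zero_add, two_mul]
      · intro h
        have h3 : (2 : ZMod p) • f t = 0 := by
          refine hβ _ fun v => ?_
          rw [two_smul, ← two_nsmul, h]; rfl
        rcases smul_eq_zero.1 h3 with h4 | h4
        · exact h2 h4
        · exact ht (hf (by rw [h4, map_zero]))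
    · simp
  · refine Finset.sum_congr rfl fun s hs0 => ?_
    have hs0 : s ≠ 0 := (Finset.mem_erase.1 hs0).1
    rw [Finset.sum_comm, Finset.mul_sum]
    refine Finset.sum_congr rfl fun t _ => ?_
    rw [Finset.sum_mul, ← Equiv.sum_comp (Equiv.addRight (s⁻¹ • f t))
      (fun w => (ZMod.stdAddChar (s * β w w) : ℂ) * ZMod.stdAddChar (-s⁻¹ * β (f t) (f t)))]
    refine Finset.sum_congr rfl fun w _ => ?_
    rw [← AddChar.map_add_eq_mul]
    congr 1
    simp only [Equiv.coe_addRight, map_add, AddMonoidHom.add_apply, pairing_smul_left,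
      pairing_smul_right]
    rw [hs w (f t)]
    field_simp
    ring

variable {k : ℕ}

theorem quadChar_pow_odd {a : ZMod p} (ha : a ≠ 0) (k : ℕ) :
    quadChar p a ^ (2 * k + 1) = quadChar p a := by
  rw [pow_succ, pow_mul, quadChar_sq ha, one_pow, one_mul]

theorem sum_erase_quadChar (hp : p ≠ 2) :
    ∑ s ∈ Finset.univ.erase (0 : ZMod p), quadChar p s = 0 := by
  have h := MulChar.sum_eq_zero_of_ne_one (quadChar_ne_one hp)
  rw [← Finset.add_sum_erase _ _ (Finset.mem_univ (0 : ZMod p)), MulChar.map_zero, zero_add] at h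
  exact h

/-- On isotropic `W` the inner sum is `|W|` for every `s`, while the Gauss sum in an odd number of
variables is `χ(s)` times a constant. The terms with `s ≠ 0` therefore cancel and only `|V|`
survives. -/
theorem card_isotropic_perp (hp : p ≠ 2)
    {Q : Matrix (Fin (2 * k + 1)) (Fin (2 * k + 1)) (ZMod p)} (hQ : Q.IsSymm) (hdet : Q.det ≠ 0)
    (W : AddSubgroup (Fin (2 * k + 1) → ZMod p)) (hW : ∀ u ∈ W, matPairing Q u u = 0) :
    Nat.card W * ({w | w ∈ perp (matPairing Q) W ∧ matPairing Q w w = 0} : Set _).ncard =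
      p ^ (2 * k) := by
  classical
  have h := card_isotropic_orthogonal hp (matPairing Q)
    (matPairing_nondegenerate hQ (isUnit_iff_ne_zero.2 hdet)) (matPairing_comm hQ) W.subtype
    Subtype.val_injective
  have h1 : ∑ s ∈ Finset.univ.erase (0 : ZMod p),
        (∑ w : Fin (2 * k + 1) → ZMod p, (ZMod.stdAddChar (s * matPairing Q w w) : ℂ)) *
          ∑ t : W, ZMod.stdAddChar (-s⁻¹ * matPairing Q (W.subtype t) (W.subtype t)) = 0 := by
    rw [Finset.sum_congr rfl (g := fun s => quadChar p s *
      (quadChar p Q.det * quadGauss p ^ (2 * k + 1) * Nat.card W)), ← Finset.sum_mul,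
      sum_erase_quadChar hp, zero_mul]
    intro s hs
    have hs0 : s ≠ 0 := (Finset.mem_erase.1 hs).1
    simp only [matPairing_apply]
    rw [sum_stdAddChar_quadratic hp Q hQ hdet hs0, quadChar_pow_odd hs0]
    have : ∀ t : W, (ZMod.stdAddChar (-s⁻¹ * ((W.subtype t) ⬝ᵥ Q.mulVec (W.subtype t))) : ℂ) = 1 := by
      intro t
      have ht : (W.subtype t) ⬝ᵥ Q.mulVec (W.subtype t) = 0 := hW t t.2
      rw [ht, mul_zero, AddChar.map_zero_eq_one]
    simp only [this, Finset.sum_const, Finset.card_univ, nsmul_eq_mul, mul_one,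
      Nat.card_eq_fintype_card]
    ring
  rw [h1, add_zero] at h
  have h2 : Nat.card (Fin (2 * k + 1) → ZMod p) = p ^ (2 * k) * p := by
    rw [Nat.card_fun, Nat.card_zmod, Nat.card_eq_fintype_card, Fintype.card_fin, pow_succ]
  rw [h2] at h
  have h3 : p * (Nat.card W * ({w | (∀ t : W, matPairing Q (W.subtype t) w = 0) ∧
      matPairing Q w w = 0} : Set _).ncard) = p * p ^ (2 * k) := by
    rw [mul_comm p (p ^ (2 * k)), ← mul_assoc]; exact_mod_cast h
  rw [← Nat.eq_of_mul_eq_mul_left (Fact.out : p.Prime).pos h3]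
  congr 3
  ext w
  simp [mem_perp]

/-- Apply the general count to the line through `x`. If `x` is anisotropic, the line supplies one
more Gauss sum, so `2k + 2` of them multiply to `(χ(-1) p)^{k+1}`, and `χ(s)² = 1` makes all `p - 1`
terms equal. If `x` is isotropic, the terms cancel as before. -/
theorem card_isotropic_orthogonal_vector (hp : p ≠ 2)
    {Q : Matrix (Fin (2 * k + 1)) (Fin (2 * k + 1)) (ZMod p)} (hQ : Q.IsSymm) (hdet : Q.det ≠ 0)
    {x : Fin (2 * k + 1) → ZMod p} (hx : x ≠ 0) :
    (p : ℤ) ^ 2 * ({w | matPairing Q x w = 0 ∧ matPairing Q w w = 0} : Set _).ncard =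
      (p : ℤ) ^ (2 * k + 1) + (p - 1) * p ^ (k + 1) *
        quadraticChar (ZMod p) ((-1) ^ k * Q.det * matPairing Q x x) := by
  classical
  have hp1 := (Fact.out : p.Prime).pos
  set f : ZMod p →+ (Fin (2 * k + 1) → ZMod p) :=
    (LinearMap.toSpanSingleton (ZMod p) _ x).toAddMonoidHom with hfdef
  have hfa : ∀ t, f t = t • x := fun t => rfl
  have h := card_isotropic_orthogonal hp (matPairing Q)
    (matPairing_nondegenerate hQ (isUnit_iff_ne_zero.2 hdet)) (matPairing_comm hQ) f
    (fun a b hab => by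
      rw [hfa, hfa] at hab
      exact smul_left_injective _ hx hab)
  have hset : {w | (∀ t, matPairing Q (f t) w = 0) ∧ matPairing Q w w = 0} =
      {w | matPairing Q x w = 0 ∧ matPairing Q w w = 0} := by
    ext w
    simp only [hfa, pairing_smul_left, Set.mem_ofPred_eq, and_congr_left_iff]
    exact fun _ => ⟨fun h => by simpa using h 1, fun h t => by rw [h, mul_zero]⟩
  rw [hset] at h
  have h2 : Nat.card (Fin (2 * k + 1) → ZMod p) = p ^ (2 * k + 1) := by
    rw [Nat.card_fun, Nat.card_zmod, Nat.card_eq_fintype_card, Fintype.card_fin]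
  rw [h2, Nat.card_zmod] at h
  have h1 : ∑ s ∈ Finset.univ.erase (0 : ZMod p),
        (∑ w : Fin (2 * k + 1) → ZMod p, (ZMod.stdAddChar (s * matPairing Q w w) : ℂ)) *
          ∑ t, ZMod.stdAddChar (-s⁻¹ * matPairing Q (f t) (f t)) =
      (p - 1) * p ^ (k + 1) * quadChar p ((-1) ^ k * Q.det * matPairing Q x x) := by
    have ht : ∀ s t : ZMod p, -s⁻¹ * matPairing Q (f t) (f t) =
        (-s⁻¹ * matPairing Q x x) * t ^ 2 := by
      intro s t; rw [hfa, pairing_smul_left, pairing_smul_right]; ring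
    by_cases hxx : matPairing Q x x = 0
    · rw [Finset.sum_congr rfl (g := fun s => quadChar p s *
        (quadChar p Q.det * quadGauss p ^ (2 * k + 1) * p)), ← Finset.sum_mul,
        sum_erase_quadChar hp, zero_mul, hxx, mul_zero, MulChar.map_zero, mul_zero]
      intro s hs
      have hs0 : s ≠ 0 := (Finset.mem_erase.1 hs).1
      simp only [ht, hxx]
      simp only [matPairing_apply]
      rw [sum_stdAddChar_quadratic hp Q hQ hdet hs0, quadChar_pow_odd hs0]
      simp [ZMod.card]
      ring
    · rw [Finset.sum_congr rfl (g := fun s =>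
        p ^ (k + 1) * quadChar p ((-1) ^ k * Q.det * matPairing Q x x)), Finset.sum_const,
        Finset.card_erase_of_mem (Finset.mem_univ _), Finset.card_univ, ZMod.card, nsmul_eq_mul,
        Nat.cast_sub hp1]
      · push_cast; ring
      intro s hs
      have hs0 : s ≠ 0 := (Finset.mem_erase.1 hs).1
      have h4 : -s⁻¹ * matPairing Q x x ≠ 0 :=
        mul_ne_zero (neg_ne_zero.2 (inv_ne_zero hs0)) hxx
      simp only [ht]
      rw [sum_stdAddChar_mul_sq hp h4]
      simp only [matPairing_apply] at hxx ⊢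
      rw [sum_stdAddChar_quadratic hp Q hQ hdet hs0, quadChar_pow_odd hs0]
      have h5 : quadChar p (-s⁻¹ * (x ⬝ᵥ Q.mulVec x)) =
          quadChar p (-1) * quadChar p s * quadChar p (x ⬝ᵥ Q.mulVec x) := by
        rw [neg_mul, ← neg_one_mul, map_mul, map_mul]
        have h6 : quadChar p s⁻¹ = quadChar p s := by
          have h7 : quadChar p s⁻¹ * quadChar p s = 1 := by
            rw [← map_mul, inv_mul_cancel₀ hs0, map_one]
          calc quadChar p s⁻¹ = quadChar p s⁻¹ * quadChar p s ^ 2 := by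
                rw [quadChar_sq hs0, mul_one]
            _ = quadChar p s := by rw [sq, ← mul_assoc, h7, one_mul]
        rw [h6]; ring
      have h8 : quadGauss p ^ (2 * k + 1) * quadGauss p = quadChar p (-1) ^ (k + 1) * p ^ (k + 1) := by
        rw [← pow_succ, show 2 * k + 1 + 1 = 2 * (k + 1) by ring, pow_mul, quadGauss_sq hp, mul_pow]
      have hm1 : quadChar p (-1) ^ 2 = 1 := quadChar_sq (neg_ne_zero.2 one_ne_zero)
      rw [h5, map_mul, map_mul, map_pow]
      calc _ = quadChar p s ^ 2 * (quadChar p Q.det * quadChar p (x ⬝ᵥ Q.mulVec x)) *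
            quadChar p (-1) * (quadGauss p ^ (2 * k + 1) * quadGauss p) := by ring
        _ = _ := by
          rw [h8, quadChar_sq hs0]
          linear_combination (quadChar p Q.det * quadChar p (x ⬝ᵥ Q.mulVec x) *
            quadChar p (-1) ^ k * p ^ (k + 1)) * hm1
  rw [h1, quadChar_apply] at h
  rw [sq]
  push_cast at h ⊢
  exact_mod_cast h

end IsotropicCount

end ReprZeta

namespace ReprZeta

/-! ### Double counting, and fibres of characters. -/

section Counting

theorem ncard_mul_eq_of_double_count {α β : Type*} [Finite α] [Finite β] (A : Set α) (B : Set β)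
    (r : α → β → Prop) (P : α → Prop) {c₁ c₂ d : ℚ}
    (h₁ : ∀ a ∈ A, P a → (({b | b ∈ B ∧ r a b} : Set β).ncard : ℚ) = c₁)
    (h₂ : ∀ a ∈ A, ¬ P a → (({b | b ∈ B ∧ r a b} : Set β).ncard : ℚ) = c₂)
    (h₃ : ∀ b ∈ B, (({a | a ∈ A ∧ r a b} : Set α).ncard : ℚ) = d) :
    (({a | a ∈ A ∧ P a} : Set α).ncard : ℚ) * c₁ +
      ((A.ncard : ℚ) - ({a | a ∈ A ∧ P a} : Set α).ncard) * c₂ = B.ncard * d := by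
  classical
  cases nonempty_fintype α
  cases nonempty_fintype β
  have key := Finset.sum_card_bipartiteAbove_eq_sum_card_bipartiteBelow r
    (s := A.toFinset) (t := B.toFinset)
  have e1 : ∀ a, (Finset.bipartiteAbove r B.toFinset a).card =
      ({b | b ∈ B ∧ r a b} : Set β).ncard := fun a => by
    rw [Set.ncard_eq_toFinset_card']; congr 1; ext b; simp [Finset.bipartiteAbove]
  have e2 : ∀ b, (Finset.bipartiteBelow r A.toFinset b).card =
      ({a | a ∈ A ∧ r a b} : Set α).ncard := fun b => by
    rw [Set.ncard_eq_toFinset_card']; congr 1; ext a; simp [Finset.bipartiteBelow]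
  simp only [e1, e2] at key
  have key2 := congrArg (Nat.cast : ℕ → ℚ) key
  rw [Nat.cast_sum, Nat.cast_sum, Finset.sum_congr rfl (fun b hb => h₃ b (Set.mem_toFinset.1 hb)),
    Finset.sum_const, nsmul_eq_mul, ← Set.ncard_eq_toFinset_card',
    ← Finset.sum_filter_add_sum_filter_not _ P] at key2
  rw [← key2]
  have e3 : (A.toFinset.filter P).card = ({a | a ∈ A ∧ P a} : Set α).ncard := by
    rw [Set.ncard_eq_toFinset_card']; congr 1; ext a; simp
  have e4 : (A.ncard : ℚ) - ({a | a ∈ A ∧ P a} : Set α).ncard =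
      (A.toFinset.filter fun a => ¬ P a).card := by
    rw [← e3, Set.ncard_eq_toFinset_card' A,
      ← Finset.card_filter_add_card_filter_not (s := A.toFinset) P]
    push_cast; ring
  rw [e4, ← e3]
  congr 1
  · rw [Finset.sum_congr rfl (g := fun _ => c₁), Finset.sum_const, nsmul_eq_mul]
    intro a ha
    simp only [Finset.mem_filter, Set.mem_toFinset] at ha
    exact h₁ a ha.1 ha.2
  · rw [Finset.sum_congr rfl (g := fun _ => c₂), Finset.sum_const, nsmul_eq_mul]
    intro a ha
    simp only [Finset.mem_filter, Set.mem_toFinset] at ha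
    exact h₂ a ha.1 ha.2

theorem card_fiber_mul {p : ℕ} [Fact p.Prime] {A : Type*} [AddCommGroup A] [Finite A]
    (f : A →+ ZMod p) (hf : f ≠ 0) (e : ZMod p) :
    ({a | f a = e} : Set A).ncard * p = Nat.card A := by
  classical
  cases nonempty_fintype A
  obtain ⟨a₀, ha₀⟩ := DFunLike.ne_iff.1 hf
  have hsurj : ∀ e, e ∈ Set.range f := fun e => by
    refine ⟨(e * (f a₀)⁻¹).val • a₀, ?_⟩
    rw [map_nsmul, nsmul_eq_mul, ZMod.natCast_zmod_val, mul_assoc, inv_mul_cancel₀ ha₀, mul_one]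
  have h := Finset.card_eq_sum_card_fiberwise (f := f) (s := Finset.univ) (t := Finset.univ)
    (fun _ _ => Finset.mem_univ _)
  rw [Finset.sum_congr rfl (fun x _ =>
    AddMonoidHom.card_fiber_eq_of_mem_range f (hsurj x) (hsurj e)), Finset.sum_const,
    Finset.card_univ, Finset.card_univ, ZMod.card, smul_eq_mul] at h
  rw [Nat.card_eq_fintype_card, h, mul_comm, Set.ncard_eq_toFinset_card']
  congr 2
  ext; simp

theorem mem_of_zsmul_mem_of_not_dvd {p : ℕ} (hp : p.Prime) {V : Type*} [AddCommGroup V]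
    {W : AddSubgroup V} {s : V} (hs : p • s ∈ W) {n : ℤ} (hn : ¬ (p : ℤ) ∣ n) (h : n • s ∈ W) :
    s ∈ W := by
  have hc : IsCoprime (p : ℤ) n :=
    ((Nat.prime_iff_prime_int.1 hp).irreducible.coprime_iff_not_dvd).2 hn
  obtain ⟨u, v, huv⟩ := hc
  rw [← one_zsmul s, ← huv, add_zsmul, mul_zsmul, mul_zsmul, natCast_zsmul]
  exact W.add_mem (W.zsmul_mem hs u) (W.zsmul_mem h v)

end Counting

/-- A lattice with a symmetric pairing modulo `p²` and modulo `p`: the group `V₂` plays the role of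
`L/p²L`, and `V₁` that of `L/pL`, with reduction `red` and multiplication `up` by `p`. -/
structure TwoLevel (p m : ℕ) (V₂ V₁ : Type*) [AddCommGroup V₂] [AddCommGroup V₁] where
  /-- the pairing modulo `p²` -/
  β₂ : V₂ →+ V₂ →+ ZMod (p ^ 2)
  /-- the pairing modulo `p` -/
  β₁ : V₁ →+ V₁ →+ ZMod p
  /-- reduction modulo `p` -/
  red : V₂ →+ V₁
  /-- multiplication by `p` -/
  up : V₁ →+ V₂
  /-- multiplication by `p` on scalars -/
  ι : ZMod p →+ ZMod (p ^ 2)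
  /-- reduction modulo `p` on scalars -/
  π : ZMod (p ^ 2) →+ ZMod p
  ι_injective : Function.Injective ι
  up_injective : Function.Injective up
  red_surjective : Function.Surjective red
  up_red : ∀ x, up (red x) = p • x
  red_up : ∀ z, red (up z) = 0
  exists_up_eq : ∀ x, red x = 0 → ∃ z, up z = x
  exists_ι_eq : ∀ a, π a = 0 → ∃ c, ι c = a
  β₂_up : ∀ z y, β₂ (up z) y = ι (β₁ z (red y))
  π_β₂ : ∀ x y, π (β₂ x y) = β₁ (red x) (red y)
  β₂_comm : ∀ x y, β₂ x y = β₂ y x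
  β₁_comm : ∀ x y, β₁ x y = β₁ y x
  β₂_nondegenerate : ∀ x, (∀ y, β₂ x y = 0) → x = 0
  β₁_nondegenerate : ∀ x, (∀ y, β₁ x y = 0) → x = 0
  card_V₁ : Nat.card V₁ = p ^ m

set_option linter.unusedSectionVars false

/-! ### Orders and orthogonal complements of subgroups modulo `p²`. -/

namespace TwoLevel

variable {p m : ℕ} [hp : Fact p.Prime] {V₂ V₁ : Type*} [AddCommGroup V₂] [AddCommGroup V₁]
  [Finite V₂] [Finite V₁] (T : TwoLevel p m V₂ V₁)

theorem nsmul_eq_zero (T : TwoLevel p m V₂ V₁) (z : V₁) : p • z = 0 := by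
  obtain ⟨x, rfl⟩ := T.red_surjective z
  rw [← map_nsmul, ← T.up_red, T.red_up]

/-- The kernel of `red` on `K` is the image of `K.comap T.up`, so a subgroup modulo `p²` is measured
by two subgroups modulo `p`. -/
theorem card_eq (K : AddSubgroup V₂) :
    Nat.card K = Nat.card (K.map T.red) * Nat.card (K.comap T.up) := by
  have h1 := (T.red.comp K.subtype).ker.card_mul_index
  rw [AddSubgroup.index_ker, AddMonoidHom.range_comp, K.range_subtype] at h1
  rw [← h1, mul_comm]
  congr 1
  symm
  refine Nat.card_congr (Equiv.ofBijective (fun z => ⟨⟨T.up z, z.2⟩, T.red_up z⟩) ⟨?_, ?_⟩)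
  · intro a b hab
    exact Subtype.ext (T.up_injective (congrArg
      (fun x : (T.red.comp K.subtype).ker => ((x : K) : V₂)) hab))
  · rintro ⟨⟨x, hx⟩, hx0⟩
    obtain ⟨z, rfl⟩ := T.exists_up_eq x hx0
    exact ⟨⟨z, hx⟩, rfl⟩

theorem card_V₂ (T : TwoLevel p m V₂ V₁) : Nat.card V₂ = p ^ m * p ^ m := by
  have h := T.card_eq ⊤
  rw [← AddMonoidHom.range_eq_map, AddMonoidHom.range_eq_top_of_surjective _ T.red_surjective,
    AddSubgroup.comap_top, AddSubgroup.card_top, AddSubgroup.card_top, T.card_V₁] at h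
  exact h

/-- Modulo `p²`, the pairing of `pz` with `b` depends only on `z` and `b` modulo `p`. -/
theorem comap_perp (B : AddSubgroup V₂) :
    (perp T.β₂ B).comap T.up = perp T.β₁ (B.map T.red) := by
  ext z
  constructor
  · rintro h _ ⟨b, hb, rfl⟩
    have := h b hb
    rw [T.β₂_comm, T.β₂_up, ← map_zero T.ι] at this
    rw [T.β₁_comm]
    exact T.ι_injective this
  · intro h b hb
    rw [T.β₂_comm, T.β₂_up, T.β₁_comm, h _ (AddSubgroup.mem_map_of_mem _ hb), map_zero]

instance neZero_sq : NeZero (p ^ 2) := ⟨pow_ne_zero 2 hp.out.ne_zero⟩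

theorem card_mul_card_perp₁ (W : AddSubgroup V₁) :
    Nat.card W * Nat.card (perp T.β₁ W) = p ^ m := by
  rw [card_mul_card_perp _ T.β₁_nondegenerate, T.card_V₁]

theorem card_mul_card_perp₂ (B : AddSubgroup V₂) :
    Nat.card B * Nat.card (perp T.β₂ B) = p ^ m * p ^ m := by
  rw [card_mul_card_perp _ T.β₂_nondegenerate, T.card_V₂]

/-- By duality: the complement of `W + ⟨s⟩` is the kernel of `β₁ s` on the complement of `W`, and
this functional is nonzero because `W` is its own double complement and `s ∉ W`. -/
theorem card_sup_zmultiples (T : TwoLevel p m V₂ V₁) (W : AddSubgroup V₁) {s : V₁} (hs : s ∉ W) :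
    Nat.card (W ⊔ AddSubgroup.zmultiples s : AddSubgroup V₁) = p * Nat.card W := by
  set U := perp T.β₁ W
  set f : U →+ ZMod p := (T.β₁ s).comp U.subtype with hf
  have hf0 : f ≠ 0 := by
    intro h
    refine hs ?_
    rw [← perp_perp _ T.β₁_nondegenerate T.β₁_comm W]
    intro v hv
    rw [T.β₁_comm]
    exact DFunLike.congr_fun h ⟨v, hv⟩
  have h1 := card_fiber_mul f hf0 0
  have h2 : ({a | f a = 0} : Set U).ncard =
      Nat.card (perp T.β₁ (W ⊔ AddSubgroup.zmultiples s)) := by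
    rw [← Nat.card_coe_set_eq]
    refine Nat.card_congr (Equiv.ofBijective (fun a => ⟨a.1.1, ?_⟩) ⟨?_, ?_⟩)
    · intro b hb
      obtain ⟨w, hw, t, ht, rfl⟩ := AddSubgroup.mem_sup.1 hb
      obtain ⟨n, rfl⟩ := AddSubgroup.mem_zmultiples_iff.1 ht
      have h3 : T.β₁ s a.1.1 = 0 := a.2
      rw [map_add, AddMonoidHom.add_apply, a.1.2 w hw, map_zsmul, AddMonoidHom.zsmul_apply, h3,
        smul_zero, add_zero]
    · intro a b hab
      exact Subtype.ext (Subtype.ext (Subtype.mk.inj hab))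
    · rintro ⟨v, hv⟩
      exact ⟨⟨⟨v, perp_anti _ le_sup_left hv⟩,
        hv s (AddSubgroup.mem_sup_right (AddSubgroup.mem_zmultiples s))⟩, rfl⟩
  rw [h2] at h1
  have h3 := T.card_mul_card_perp₁ W
  have h4 := T.card_mul_card_perp₁ (W ⊔ AddSubgroup.zmultiples s)
  have h5 : 0 < Nat.card (perp T.β₁ (W ⊔ AddSubgroup.zmultiples s)) := Nat.card_pos
  rw [← h3, ← h1] at h4
  refine Nat.eq_of_mul_eq_mul_right h5 ?_
  rw [h4]; ring

/-! ### Lagrangian subgroups -/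

/-- Totally isotropic subgroups. -/
def Isotropic (B : AddSubgroup V₂) : Prop := ∀ x ∈ B, ∀ y ∈ B, T.β₂ x y = 0

/-- The self-orthogonal subgroups of order `p^m` whose reduction has order `p^d`. -/
def lagr (d : ℕ) : Set (AddSubgroup V₂) :=
  {K | T.Isotropic K ∧ Nat.card K = p ^ m ∧ Nat.card (K.map T.red) = p ^ d}

variable {T}

theorem perp_eq_self {K : AddSubgroup V₂} (hK : T.Isotropic K) (hc : Nat.card K = p ^ m) :
    perp T.β₂ K = K := by
  symm
  refine AddSubgroup.eq_of_le_of_card_ge (fun x hx y hy => hK y hy x hx) ?_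
  have h := T.card_mul_card_perp₂ K
  rw [hc] at h
  rw [hc, Nat.eq_of_mul_eq_mul_left (pow_pos hp.out.pos _) h]

theorem comap_eq_perp {K : AddSubgroup V₂} (hK : T.Isotropic K) (hc : Nat.card K = p ^ m) :
    K.comap T.up = perp T.β₁ (K.map T.red) := by
  rw [← T.comap_perp, perp_eq_self hK hc]

/-- The subgroup must be `B + p (red B)^⊥`. It is isotropic of order `p^d p^{m-d}`; conversely a
self-orthogonal `K` with the same reduction contains `p (red B)^⊥` by `comap_eq_perp`. -/
theorem exists_unique_lagr {B : AddSubgroup V₂} (hB : T.Isotropic B) {d : ℕ}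
    (hd : Nat.card (B.map T.red) = p ^ d) : ∃! K, K ∈ T.lagr d ∧ B ≤ K := by
  set U := perp T.β₁ (B.map T.red) with hU
  set K := B ⊔ U.map T.up with hK
  have hBU : ∀ b ∈ B, ∀ u ∈ U, T.β₂ (T.up u) b = 0 := fun b hb u hu => by
    rw [T.β₂_up, T.β₁_comm, hu _ (AddSubgroup.mem_map_of_mem _ hb), map_zero]
  have hUU : ∀ u v, T.β₂ (T.up u) (T.up v) = 0 := fun u v => by
    rw [T.β₂_up, T.red_up, map_zero, map_zero]
  have hred : K.map T.red = B.map T.red := by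
    rw [hK, AddSubgroup.map_sup, sup_eq_left]
    rintro _ ⟨_, ⟨u, _, rfl⟩, rfl⟩
    rw [T.red_up]
    exact zero_mem _
  have hiso : T.Isotropic K := by
    intro x hx y hy
    obtain ⟨b, hb, _, ⟨u, hu, rfl⟩, rfl⟩ := AddSubgroup.mem_sup.1 hx
    obtain ⟨b', hb', _, ⟨u', hu', rfl⟩, rfl⟩ := AddSubgroup.mem_sup.1 hy
    simp only [map_add, AddMonoidHom.add_apply, hB b hb b' hb', hBU b' hb' u hu, hUU,
      T.β₂_comm b (T.up u'), hBU b hb u' hu', add_zero]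
  have hcom : K.comap T.up = U := by
    refine le_antisymm (fun z hz b hb => ?_) fun z hz =>
      AddSubgroup.mem_sup_right (AddSubgroup.mem_map_of_mem _ hz)
    obtain ⟨b, hb, rfl⟩ := hb
    have h := hiso _ hz b (AddSubgroup.mem_sup_left hb)
    rw [T.β₂_up, ← map_zero T.ι] at h
    rw [T.β₁_comm]
    exact T.ι_injective h
  have hcard : Nat.card K = p ^ m := by
    rw [T.card_eq, hcom, hred, T.card_mul_card_perp₁]
  refine ⟨K, ⟨⟨hiso, hcard, by rw [hred, hd]⟩, le_sup_left⟩, ?_⟩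
  rintro K' ⟨⟨hi', hc', hd'⟩, hBK'⟩
  have hr' : B.map T.red = K'.map T.red :=
    AddSubgroup.eq_of_le_of_card_ge (AddSubgroup.map_mono hBK') (by rw [hd, hd'])
  have hc2 := comap_eq_perp hi' hc'
  rw [← hr'] at hc2
  symm
  refine AddSubgroup.eq_of_le_of_card_ge (sup_le hBK' ?_) (by rw [hc', hcard])
  rw [AddSubgroup.map_le_iff_le_comap, hc2]

/-! ### Extending isotropic subgroups -/

variable (T)

/-- Isotropic subgroups that are free of rank `j` over `ℤ/p²`. -/
def Split (j : ℕ) (B : AddSubgroup V₂) : Prop :=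
  T.Isotropic B ∧ Nat.card (B.map T.red) = p ^ j ∧ B.comap T.up ≤ B.map T.red

/-- The isotropic vectors orthogonal to `B` with reduction in `S`. -/
def isoOver (B : AddSubgroup V₂) (S : Set V₁) : Set V₂ :=
  {y | y ∈ perp T.β₂ B ∧ T.β₂ y y = 0 ∧ T.red y ∈ S}

variable {T}

theorem split_bot : T.Split 0 ⊥ := by
  refine ⟨?_, ?_, ?_⟩
  · intro x hx y hy
    rw [AddSubgroup.mem_bot.1 hx]; simp
  · simp
  · intro z hz
    have : T.up z = 0 := hz
    rw [← map_zero T.up] at this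
    rw [T.up_injective this]
    exact zero_mem _

theorem Split.isotropic_map {j : ℕ} {B : AddSubgroup V₂} (hB : T.Split j B) {u v : V₁}
    (hu : u ∈ B.map T.red) (hv : v ∈ B.map T.red) : T.β₁ u v = 0 := by
  obtain ⟨x, hx, rfl⟩ := hu
  obtain ⟨y, hy, rfl⟩ := hv
  rw [← T.π_β₂, hB.1 x hx y hy, map_zero]

/-- Every vector orthogonal to `red B` lifts to one orthogonal to `B`. One inclusion is clear and
the orders agree, because for split `B` the groups `B.comap T.up` and `B.map T.red` coincide. -/
theorem Split.map_perp {j : ℕ} {B : AddSubgroup V₂} (hB : T.Split j B) :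
    (perp T.β₂ B).map T.red = perp T.β₁ (B.map T.red) := by
  refine AddSubgroup.eq_of_le_of_card_ge ?_ ?_
  · rintro _ ⟨y, hy, rfl⟩ _ ⟨b, hb, rfl⟩
    rw [← T.π_β₂, hy b hb, map_zero]
  · have hcom : B.comap T.up = B.map T.red := by
      refine le_antisymm hB.2.2 ?_
      rintro _ ⟨b, hb, rfl⟩
      rw [AddSubgroup.mem_comap, T.up_red]
      exact B.nsmul_mem hb p
    have h1 := T.card_mul_card_perp₂ B
    rw [T.card_eq, T.card_eq (perp T.β₂ B), T.comap_perp, hcom] at h1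
    have h2 := T.card_mul_card_perp₁ (B.map T.red)
    set a := Nat.card (B.map T.red)
    set b := Nat.card (perp T.β₁ (B.map T.red))
    have ha : 0 < a := Nat.card_pos
    have hb : 0 < b := Nat.card_pos
    have h3 : (a * a * b) * Nat.card ((perp T.β₂ B).map T.red) = (a * a * b) * b := by
      calc _ = a * a * (Nat.card ((perp T.β₂ B).map T.red) * b) := by ring
        _ = _ := by rw [h1, ← h2]; ring
    exact (Nat.eq_of_mul_eq_mul_left (by positivity) h3).ge

/-- A Hensel argument: the lifts of `s` orthogonal to `B` are `y + pz` with `z ∈ (red B)^⊥`, and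
their norm is `p (c + 2 β₁ s z)`. Vanishing is an affine condition on `z`, nontrivial because `s ∉
red B`, so it keeps one lift in `p`. -/
theorem Split.card_fiber (hp2 : p ≠ 2) {j : ℕ} {B : AddSubgroup V₂} (hB : T.Split j B) {s : V₁}
    (hs : s ∈ perp T.β₁ (B.map T.red)) (hsB : s ∉ B.map T.red) (hss : T.β₁ s s = 0) :
    (T.isoOver B {s}).ncard * p ^ (j + 1) = p ^ m := by
  set U := perp T.β₁ (B.map T.red) with hU
  obtain ⟨y, hy, hys⟩ : s ∈ (perp T.β₂ B).map T.red := by rw [hB.map_perp]; exact hs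
  obtain ⟨c, hc⟩ := T.exists_ι_eq (T.β₂ y y) (by rw [T.π_β₂, hys, hss])
  set f : U →+ ZMod p := (T.β₁ s).comp U.subtype with hf
  have hf0 : f ≠ 0 := by
    intro h
    refine hsB ?_
    rw [← perp_perp _ T.β₁_nondegenerate T.β₁_comm (B.map T.red)]
    intro v hv
    rw [T.β₁_comm]
    exact DFunLike.congr_fun h ⟨v, hv⟩
  have h2 := two_ne_zero_of_ne_two hp2
  have h1 := card_fiber_mul f hf0 (-c / 2)
  have hexp : ∀ z, T.β₂ (y + T.up z) (y + T.up z) = T.ι (c + 2 * T.β₁ s z) := by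
    intro z
    simp only [map_add, AddMonoidHom.add_apply, T.β₂_up, T.β₂_comm y (T.up z), T.red_up, map_zero,
      hys, ← hc, two_mul, T.β₁_comm z s]
    abel
  have h3 : ({a | f a = -c / 2} : Set U).ncard = (T.isoOver B {s}).ncard := by
    rw [← Nat.card_coe_set_eq, ← Nat.card_coe_set_eq]
    refine Nat.card_congr (Equiv.ofBijective (fun a => ⟨y + T.up a.1.1, ?_, ?_, ?_⟩) ⟨?_, ?_⟩)
    · refine add_mem hy ?_
      have : a.1.1 ∈ (perp T.β₂ B).comap T.up := by rw [T.comap_perp]; exact a.1.2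
      exact this
    · have ha : T.β₁ s a.1.1 = -c / 2 := a.2
      rw [hexp, ha, mul_div_cancel₀ _ h2, add_neg_cancel, map_zero]
    · rw [map_add, T.red_up, add_zero, hys]; rfl
    · intro a b hab
      exact Subtype.ext (Subtype.ext (T.up_injective (add_left_cancel (Subtype.mk.inj hab))))
    · rintro ⟨v, hv, hvv, hvs⟩
      obtain ⟨z, hz⟩ := T.exists_up_eq (v - y) (by
        rw [map_sub, hys, sub_eq_zero]; exact hvs)
      have hv' : v = y + T.up z := by rw [hz]; abel
      have hzU : z ∈ U := by
        rw [hU, ← T.comap_perp, AddSubgroup.mem_comap, hz]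
        exact sub_mem hv hy
      refine ⟨⟨⟨z, hzU⟩, ?_⟩, Subtype.ext hv'.symm⟩
      rw [hv', hexp, ← map_zero T.ι] at hvv
      have := T.ι_injective hvv
      change T.β₁ s z = -c / 2
      rw [eq_div_iff h2]
      linear_combination this
  have h4 := T.card_mul_card_perp₁ (B.map T.red)
  rw [hB.2.1] at h4
  rw [← h4, ← h1, h3]; ring

theorem Split.card_isoOver (hp2 : p ≠ 2) {j : ℕ} {B : AddSubgroup V₂} (hB : T.Split j B)
    {S : Set V₁} (hS : ∀ s ∈ S, s ∈ perp T.β₁ (B.map T.red) ∧ s ∉ B.map T.red ∧ T.β₁ s s = 0) :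
    (T.isoOver B S).ncard * p ^ (j + 1) = S.ncard * p ^ m := by
  classical
  cases nonempty_fintype V₂
  cases nonempty_fintype V₁
  rw [Set.ncard_eq_toFinset_card' (T.isoOver B S), Set.ncard_eq_toFinset_card' S,
    Finset.card_eq_sum_card_fiberwise (f := T.red) (t := S.toFinset), Finset.sum_mul,
    Finset.sum_congr rfl (g := fun _ => p ^ m), Finset.sum_const, smul_eq_mul]
  · intro s hs
    obtain ⟨h1, h2, h3⟩ := hS s (Set.mem_toFinset.1 hs)
    rw [← hB.card_fiber hp2 h1 h2 h3, Set.ncard_eq_toFinset_card']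
    congr 2
    ext y
    rw [Finset.mem_filter, Set.mem_toFinset, Set.mem_toFinset]
    constructor
    · rintro ⟨⟨a, b, -⟩, c⟩; exact ⟨a, b, c⟩
    · rintro ⟨a, b, c⟩
      have c' : T.red y = s := c
      exact ⟨⟨a, b, c' ▸ Set.mem_toFinset.1 hs⟩, c'⟩
  · intro y hy
    simp only [Set.coe_toFinset] at hy ⊢
    exact hy.2.2

theorem Split.sup_zmultiples {j : ℕ} {B : AddSubgroup V₂} (hB : T.Split j B) {y : V₂}
    (hy : y ∈ T.isoOver B (B.map T.red : Set V₁)ᶜ) :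
    T.Split (j + 1) (B ⊔ AddSubgroup.zmultiples y) := by
  obtain ⟨hyB, hyy, hyr⟩ := hy
  have hmap : (B ⊔ AddSubgroup.zmultiples y).map T.red =
      B.map T.red ⊔ AddSubgroup.zmultiples (T.red y) := by
    rw [AddSubgroup.map_sup, AddMonoidHom.map_zmultiples]
  refine ⟨?_, ?_, ?_⟩
  · intro u hu v hv
    obtain ⟨b, hb, t, ht, rfl⟩ := AddSubgroup.mem_sup.1 hu
    obtain ⟨b', hb', t', ht', rfl⟩ := AddSubgroup.mem_sup.1 hv
    obtain ⟨n, rfl⟩ := AddSubgroup.mem_zmultiples_iff.1 ht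
    obtain ⟨n', rfl⟩ := AddSubgroup.mem_zmultiples_iff.1 ht'
    simp only [map_add, AddMonoidHom.add_apply, map_zsmul, AddMonoidHom.zsmul_apply,
      hB.1 b hb b' hb', hyB b hb, T.β₂_comm y b', hyB b' hb', hyy, smul_zero, add_zero]
  · rw [hmap, T.card_sup_zmultiples _ hyr, hB.2.1, pow_succ, mul_comm]
  · intro z hz
    obtain ⟨b, hb, t, ht, hbt⟩ := AddSubgroup.mem_sup.1 (AddSubgroup.mem_comap.1 hz)
    obtain ⟨n, rfl⟩ := AddSubgroup.mem_zmultiples_iff.1 ht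
    have h0 : T.red b + n • T.red y = 0 := by
      rw [← map_zsmul, ← map_add, hbt, T.red_up]
    rw [hmap]
    -- If `p ∣ n`, the multiple of `y` can be moved into `z`; otherwise the relation `red b + n •
    -- red y = 0` would place `red y` in `red B`.
    by_cases hn : (p : ℤ) ∣ n
    · obtain ⟨n', rfl⟩ := hn
      have h1 : T.up (z - n' • T.red y) = b := by
        rw [map_sub, ← hbt, map_zsmul, T.up_red, mul_comm, mul_zsmul, natCast_zsmul]
        abel
      have h2 : z - n' • T.red y ∈ B.map T.red := hB.2.2 (by
        rw [AddSubgroup.mem_comap, h1]; exact hb)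
      exact AddSubgroup.mem_sup.2 ⟨_, h2, _, AddSubgroup.zsmul_mem _
        (AddSubgroup.mem_zmultiples _) n', sub_add_cancel _ _⟩
    · exfalso
      refine hyr (mem_of_zsmul_mem_of_not_dvd hp.out ?_ hn ?_)
      · rw [T.nsmul_eq_zero]; exact zero_mem _
      · rw [← neg_eq_of_add_eq_zero_right h0]
        exact neg_mem (AddSubgroup.mem_map_of_mem _ hb)

end TwoLevel

end ReprZeta

namespace ReprZeta

set_option linter.unusedSectionVars false

/-! ### Counting Lagrangian subgroups by flags of isotropic vectors. -/

namespace TwoLevel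

variable {p k : ℕ} [hp : Fact p.Prime] {V₂ V₁ : Type*} [AddCommGroup V₂] [AddCommGroup V₁]
  [Finite V₂] [Finite V₁] {T : TwoLevel p (2 * k + 1) V₂ V₁}

/-- The number of isotropic vectors in the orthogonal complement of an isotropic subgroup is that
of a nondegenerate form in an odd number of variables. -/
def IsoCount (T : TwoLevel p (2 * k + 1) V₂ V₁) : Prop :=
  ∀ W : AddSubgroup V₁, (∀ u ∈ W, T.β₁ u u = 0) →
    Nat.card W * ({w | w ∈ perp T.β₁ W ∧ T.β₁ w w = 0} : Set V₁).ncard = p ^ (2 * k)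

/-- A totally isotropic `W` consists of isotropic vectors of its own complement, so `|W|² ≤ p^{2k}`.
-/
theorem IsoCount.le (hT : T.IsoCount) {W : AddSubgroup V₁} (hW : ∀ u ∈ W, ∀ v ∈ W, T.β₁ u v = 0)
    {j : ℕ} (hj : Nat.card W = p ^ j) : j ≤ k := by
  have h1 := hT W fun u hu => hW u hu u hu
  have h2 : Nat.card W ≤ ({w | w ∈ perp T.β₁ W ∧ T.β₁ w w = 0} : Set V₁).ncard := by
    rw [← SetLike.coe_sort_coe, Nat.card_coe_set_eq]
    exact Set.ncard_le_ncard (fun w hw => ⟨fun b hb => hW b hb w hw, hW w hw w hw⟩)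
  have h3 : p ^ (2 * j) ≤ p ^ (2 * k) := by
    rw [← h1, two_mul, pow_add, hj]
    exact Nat.mul_le_mul_left _ (hj ▸ h2)
  have := (Nat.pow_le_pow_iff_right hp.out.one_lt).1 h3
  omega

variable (p k) in
/-- The number of vectors that extend an isotropic subgroup of rank `i`. -/
def extCount (i : ℕ) : ℚ := (p : ℚ) ^ (2 * k) * ((p : ℚ) ^ (2 * (k - i)) - 1)

/-- Modulo `p` there are `p^{2k-j} - p^j` isotropic vectors in the complement of `red B` outside
`red B`, and each has `p^{2k-j}` isotropic lifts orthogonal to `B`. -/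
theorem Split.ncard_isoOver_compl (hp2 : p ≠ 2) (hT : T.IsoCount) {j : ℕ} {B : AddSubgroup V₂}
    (hB : T.Split j B) :
    ((T.isoOver B (B.map T.red : Set V₁)ᶜ).ncard : ℚ) = extCount p k j := by
  have hp0 : (p : ℚ) ≠ 0 := Nat.cast_ne_zero.2 hp.out.ne_zero
  set W := B.map T.red with hWdef
  have hW : ∀ u ∈ W, ∀ v ∈ W, T.β₁ u v = 0 := fun u hu v hv => hB.isotropic_map hu hv
  have hjk := hT.le hW hB.2.1
  set I : Set V₁ := {w | w ∈ perp T.β₁ W ∧ T.β₁ w w = 0} with hI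
  have hWI : (W : Set V₁) ⊆ I := fun w hw => ⟨fun b hb => hW b hb w hw, hW w hw w hw⟩
  have e1 : T.isoOver B (W : Set V₁)ᶜ = T.isoOver B (I \ W) := by
    ext y
    refine ⟨fun h => ⟨h.1, h.2.1, ⟨?_, ?_⟩, h.2.2⟩, fun h => ⟨h.1, h.2.1, h.2.2.2⟩⟩
    · rw [← hB.map_perp]
      exact AddSubgroup.mem_map_of_mem _ h.1
    · rw [← T.π_β₂, h.2.1, map_zero]
  have e2 := hB.card_isoOver hp2 (S := I \ W) fun s hs => ⟨hs.1.1, hs.2, hs.1.2⟩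
  have e3 := hT W fun u hu => hW u hu u hu
  have e4 : (W : Set V₁).ncard = p ^ j := by
    rw [← Nat.card_coe_set_eq]; exact hB.2.1
  have e5 := Set.ncard_sdiff_add_ncard_of_subset hWI
  rw [hB.2.1] at e3
  rw [e4] at e5
  rw [e1]
  have e2' : ((T.isoOver B (I \ W)).ncard : ℚ) * p ^ (j + 1) = (I \ W : Set V₁).ncard * p ^ (2 * k + 1) := by
    exact_mod_cast e2
  have e3' : (p : ℚ) ^ j * I.ncard = p ^ (2 * k) := by exact_mod_cast e3
  have e5' : ((I \ W : Set V₁).ncard : ℚ) + p ^ j = I.ncard := by exact_mod_cast e5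
  have e6 : (p : ℚ) ^ (2 * k) = p ^ j * p ^ j * p ^ (2 * (k - j)) := by
    rw [← pow_add, ← pow_add]; congr 1; omega
  have e7 : (I.ncard : ℚ) = p ^ j * p ^ (2 * (k - j)) := by
    rw [e6, mul_assoc] at e3'
    exact mul_left_cancel₀ (pow_ne_zero j hp0) e3'
  refine mul_right_cancel₀ (pow_ne_zero (j + 1) hp0) ?_
  rw [e2', extCount, eq_sub_of_add_eq e5', e7]
  ring

variable (p k) in
/-- The number of Lagrangian subgroups of level `d` containing a given isotropic subgroup of
rank `j`. -/
def chainCount (d j : ℕ) : ℚ :=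
  ∏ i ∈ Finset.Ico j d, extCount p k i / ((p : ℚ) ^ (2 * k + 1) - (p : ℚ) ^ (i + (2 * k + 1 - d)))

theorem card_comap_of_mem_lagr {d : ℕ} (hd : d ≤ 2 * k + 1) {K : AddSubgroup V₂}
    (hK : K ∈ T.lagr d) : Nat.card (K.comap T.up) = p ^ (2 * k + 1 - d) := by
  have h := T.card_eq K
  rw [hK.2.1, hK.2.2] at h
  refine Nat.eq_of_mul_eq_mul_left (pow_pos hp.out.pos d) ?_
  rw [← h, ← pow_add]
  congr 1; omega

/-- The elements of `K` reducing into `W` form a subgroup of order `|W|` times `|K.comap T.up| =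
p^{m-d}`. -/
theorem ncard_mem_red_not_mem {d : ℕ} (hd : d ≤ 2 * k + 1) {K : AddSubgroup V₂}
    (hK : K ∈ T.lagr d) {W : AddSubgroup V₁} {j : ℕ} (hj : Nat.card W = p ^ j)
    (hW : W ≤ K.map T.red) :
    (({y | y ∈ K ∧ T.red y ∉ W} : Set V₂).ncard : ℚ) =
      (p : ℚ) ^ (2 * k + 1) - (p : ℚ) ^ (j + (2 * k + 1 - d)) := by
  have h1 : ({y | y ∈ K ∧ T.red y ∉ W} : Set V₂) = (K : Set V₂) \ (K ⊓ W.comap T.red : AddSubgroup V₂) := by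
    ext y
    simp only [Set.mem_ofPred_eq, Set.mem_sdiff, SetLike.mem_coe, AddSubgroup.mem_inf,
      AddSubgroup.mem_comap, not_and]
    exact and_congr_right fun h => ⟨fun h' _ => h', fun h' => h' h⟩
  have h2 : (K ⊓ W.comap T.red).map T.red = W := by
    refine le_antisymm ?_ ?_
    · rintro _ ⟨y, hy, rfl⟩; exact hy.2
    · intro w hw
      obtain ⟨y, hy, rfl⟩ := hW hw
      exact ⟨y, ⟨hy, hw⟩, rfl⟩
  have h3 : (K ⊓ W.comap T.red).comap T.up = K.comap T.up := by
    ext z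
    simp only [AddSubgroup.mem_comap, AddSubgroup.mem_inf, T.red_up, zero_mem, and_true]
  have h4 := T.card_eq (K ⊓ W.comap T.red)
  rw [h2, h3, hj, card_comap_of_mem_lagr hd hK, ← pow_add] at h4
  have h5 := Set.ncard_sdiff_add_ncard_of_subset
    (show ((K ⊓ W.comap T.red : AddSubgroup V₂) : Set V₂) ⊆ K from fun y hy => hy.1)
  have h6 : ((K ⊓ W.comap T.red : AddSubgroup V₂) : Set V₂).ncard = p ^ (j + (2 * k + 1 - d)) := by
    rw [← h4, ← Nat.card_coe_set_eq]; rfl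
  have h7 : (K : Set V₂).ncard = p ^ (2 * k + 1) := by
    rw [← hK.2.1, ← Nat.card_coe_set_eq]; rfl
  rw [h6, h7, ← h1] at h5
  rw [eq_sub_iff_add_eq]
  exact_mod_cast h5

/-- Induction on `d - j`, double counting pairs `(K, y)` with `y ∈ K` extending `B` by one rank.
Each `K` has the same number of such `y`, and each `y` reduces to rank `j + 1`. At `j = d` the
subgroup is unique by `exists_unique_lagr`. -/
theorem Split.ncard_lagr (hp2 : p ≠ 2) (hT : T.IsoCount) {d j : ℕ} {B : AddSubgroup V₂}
    (hB : T.Split j B) (hjd : j ≤ d) (hd : d ≤ k) :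
    (({K | K ∈ T.lagr d ∧ B ≤ K} : Set (AddSubgroup V₂)).ncard : ℚ) = chainCount p k d j := by
  have hp1 : (1 : ℚ) < p := by exact_mod_cast hp.out.one_lt
  induction hr : d - j generalizing j B with
  | zero =>
    obtain rfl : j = d := by omega
    obtain ⟨K, hK, huniq⟩ := exists_unique_lagr hB.1 hB.2.1
    have : ({K | K ∈ T.lagr j ∧ B ≤ K} : Set (AddSubgroup V₂)) = {K} := by
      ext K'
      exact ⟨fun h => huniq K' h, fun h => by rw [Set.mem_singleton_iff.1 h]; exact hK⟩
    rw [this, Set.ncard_singleton, chainCount, Finset.Ico_self, Finset.prod_empty, Nat.cast_one]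
  | succ r ih =>
    have key := ncard_mul_eq_of_double_count {K | K ∈ T.lagr d ∧ B ≤ K}
      (T.isoOver B (B.map T.red : Set V₁)ᶜ) (fun K y => y ∈ K) (fun _ => True)
      (c₁ := (p : ℚ) ^ (2 * k + 1) - (p : ℚ) ^ (j + (2 * k + 1 - d))) (c₂ := 0)
      (d := chainCount p k d (j + 1)) ?_ (fun _ _ h => (h trivial).elim) ?_
    · simp only [and_true, mul_zero, add_zero] at key
      rw [hB.ncard_isoOver_compl hp2 hT] at key
      have hne : (p : ℚ) ^ (2 * k + 1) - (p : ℚ) ^ (j + (2 * k + 1 - d)) ≠ 0 := by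
        rw [sub_ne_zero]
        exact (pow_lt_pow_right₀ hp1 (by omega)).ne'
      rw [chainCount, Finset.prod_eq_prod_Ico_succ_bot (by omega), ← chainCount, div_mul_eq_mul_div,
        eq_div_iff hne, ← key]
      rfl
    · rintro K ⟨hK, hBK⟩ -
      rw [← ncard_mem_red_not_mem (by omega) hK hB.2.1 (AddSubgroup.map_mono hBK)]
      congr 2
      ext y
      refine ⟨fun h => ⟨h.2, h.1.2.2⟩, fun h => ⟨⟨?_, hK.1 y h.1 y h.1, h.2⟩, h.1⟩⟩
      exact fun b hb => hK.1 b (hBK hb) y h.1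
    · intro y hy
      rw [← ih (hB.sup_zmultiples hy) (by omega) (by omega)]
      congr 2
      ext K
      simp only [Set.mem_ofPred_eq, sup_le_iff, AddSubgroup.zmultiples_le]
      tauto

theorem split_one_zmultiples {y : V₂} (hy : T.red y ≠ 0) (hyy : T.β₂ y y = 0) :
    T.Split 1 (AddSubgroup.zmultiples y) := by
  have h := (split_bot (T := T)).sup_zmultiples (y := y) ⟨fun b hb => by
    rw [AddSubgroup.mem_bot.1 hb]; simp, hyy, by
      rw [AddSubgroup.map_bot]; exact hy⟩
  rwa [bot_sup_eq, zero_add] at h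

theorem ncard_lagr_mem (hp2 : p ≠ 2) (hT : T.IsoCount) {d : ℕ} (hd1 : 1 ≤ d) (hd : d ≤ k) {y : V₂}
    (hy : T.red y ≠ 0) (hyy : T.β₂ y y = 0) :
    (({K | K ∈ T.lagr d ∧ y ∈ K} : Set (AddSubgroup V₂)).ncard : ℚ) = chainCount p k d 1 := by
  rw [← (split_one_zmultiples hy hyy).ncard_lagr hp2 hT hd1 hd]
  simp only [AddSubgroup.zmultiples_le]

/-- Double count pairs `(K, y)` with `y ∈ K`, `red y ≠ 0` and `x ⊥ red y`. If `up x ∈ K`, the last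
condition is automatic; otherwise it cuts out a subgroup of index `p` in `K`. Each such `y` lies in
`chainCount p k d 1` groups, so the unknown number solves a linear equation. -/
theorem ncard_lagr_mem_up (hp2 : p ≠ 2) (hT : T.IsoCount) {d : ℕ} (hd1 : 1 ≤ d) (hd : d ≤ k)
    {x : V₁} {E : ℚ} (hE : (({w | T.β₁ x w = 0 ∧ T.β₁ w w = 0} : Set V₁).ncard : ℚ) =
      (p : ℚ) ^ (2 * k - 1) + (p - 1) * E) :
    (({K | K ∈ T.lagr d ∧ T.up x ∈ K} : Set (AddSubgroup V₂)).ncard : ℚ) =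
      chainCount p k d 1 * (E + ((p : ℚ) ^ (2 * k - 1) - (p : ℚ) ^ (d - 1)) / ((p : ℚ) ^ d - 1)) := by
  have hp1 : (1 : ℚ) < p := by exact_mod_cast hp.out.one_lt
  have hp0 : (p : ℚ) ≠ 0 := by positivity
  set I : Set V₁ := {w | T.β₁ x w = 0 ∧ T.β₁ w w = 0} with hI
  set S : Set V₁ := I \ {0} with hS
  have hred0 : ∀ K : AddSubgroup V₂, ({y | y ∈ K ∧ T.red y ∉ (⊥ : AddSubgroup V₁)} : Set V₂) =
      {y | y ∈ K ∧ T.red y ≠ 0} := fun K => rfl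
  have key := ncard_mul_eq_of_double_count (T.lagr d) (T.isoOver ⊥ S) (fun K y => y ∈ K)
    (fun K => T.up x ∈ K)
    (c₁ := (p : ℚ) ^ (2 * k + 1) - (p : ℚ) ^ (0 + (2 * k + 1 - d)))
    (c₂ := (p : ℚ) ^ (2 * k) - (p : ℚ) ^ (0 + (2 * k + 1 - d)))
    (d := chainCount p k d 1) ?_ ?_ ?_
  · have hJ : ((T.isoOver ⊥ S).ncard : ℚ) = ((p : ℚ) ^ (2 * k - 1) + (p - 1) * E - 1) * p ^ (2 * k) := by
      have h1 := (split_bot (T := T)).card_isoOver hp2 (S := S) (fun s hs => ⟨fun b hb => by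
        obtain ⟨c, hc, rfl⟩ := hb
        have hc0 : c = 0 := AddSubgroup.mem_bot.1 hc
        rw [hc0]; simp, by rw [AddSubgroup.map_bot]; exact hs.2, hs.1.2⟩)
      have h2 : ({0} : Set V₁) ⊆ I := by
        rintro _ rfl
        exact ⟨map_zero _, map_zero _⟩
      have h3 := Set.ncard_sdiff_add_ncard_of_subset h2
      rw [Set.ncard_singleton] at h3
      have h3' : (S.ncard : ℚ) + 1 = I.ncard := by exact_mod_cast h3
      have h1' : ((T.isoOver ⊥ S).ncard : ℚ) * p ^ (0 + 1) = S.ncard * p ^ (2 * k + 1) := by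
        exact_mod_cast h1
      refine mul_right_cancel₀ hp0 ?_
      rw [zero_add, pow_one] at h1'
      rw [h1', eq_sub_of_add_eq h3', hE, pow_succ]
      ring
    have hn : ((T.lagr d).ncard : ℚ) = chainCount p k d 0 := by
      rw [← (split_bot (T := T)).ncard_lagr hp2 hT (Nat.zero_le _) hd]
      simp
    have hchain : chainCount p k d 0 = extCount p k 0 /
        ((p : ℚ) ^ (2 * k + 1) - (p : ℚ) ^ (0 + (2 * k + 1 - d))) * chainCount p k d 1 := by
      rw [chainCount, Finset.prod_eq_prod_Ico_succ_bot (by omega), ← chainCount]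
    rw [hJ, hn, hchain, extCount, Nat.sub_zero, zero_add] at key
    set N : ℚ := (({K | K ∈ T.lagr d ∧ T.up x ∈ K} : Set (AddSubgroup V₂)).ncard : ℚ)
    set c := chainCount p k d 1
    obtain ⟨k, rfl⟩ : ∃ k', k = k' + 1 := ⟨k - 1, by omega⟩
    obtain ⟨e, rfl⟩ : ∃ e, d = e + 1 := ⟨d - 1, by omega⟩
    -- Here `f` is `m - d`, the exponent of the order of `K.comap T.up`.
    obtain ⟨f, hf⟩ : ∃ f, 2 * (k + 1) = e + f := ⟨2 * (k + 1) - e, by omega⟩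
    have i1 : 2 * (k + 1) + 1 - (e + 1) = f := by omega
    have i2 : 2 * (k + 1) - 1 = 2 * k + 1 := by omega
    have i3 : (p : ℚ) ^ (2 * (k + 1)) = p ^ e * p ^ f := by rw [hf, pow_add]
    have i4 : (p : ℚ) * p ^ (2 * k + 1) = p ^ e * p ^ f := by rw [← i3]; ring
    rw [i1, i2, pow_succ (p : ℚ) (2 * (k + 1)), i3] at key
    rw [i2, Nat.add_sub_cancel, pow_succ (p : ℚ) e]
    set P := (p : ℚ) ^ e with hP
    set R := (p : ℚ) ^ f with hR
    set Y := (p : ℚ) ^ (2 * k + 1) with hY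
    have hR0 : R ≠ 0 := pow_ne_zero _ hp0
    have hP0 : P ≠ 0 := pow_ne_zero _ hp0
    have hP1 : P * p - 1 ≠ 0 := by
      rw [hP, ← pow_succ, sub_ne_zero]
      exact (one_lt_pow₀ hp1 (Nat.succ_ne_zero _)).ne'
    have hd1 : P * R * p - R = R * (P * p - 1) := by ring
    have hpm : (p : ℚ) - 1 ≠ 0 := sub_ne_zero.2 hp1.ne'
    rw [hd1] at key
    have hY' : Y = P * R / p := by rw [← i4]; field_simp
    have key2 : N * (P * R * (p - 1)) = (Y + (p - 1) * E - 1) * (P * R) * c -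
        P * R * (P * R - 1) / (R * (P * p - 1)) * c * (P * R - R) := by
      linear_combination key
    have hM : P * R * (p - 1) ≠ 0 := mul_ne_zero (mul_ne_zero hP0 hR0) hpm
    refine mul_right_cancel₀ hM ?_
    rw [key2, hY']
    field_simp
    ring
  · intro K hK hx
    rw [← ncard_mem_red_not_mem (by omega) hK (W := ⊥) (by simp) bot_le, hred0]
    congr 2
    ext y
    refine ⟨fun h => ⟨h.2, fun h0 => h.1.2.2.2 h0⟩, fun h => ⟨⟨fun b hb => ?_, hK.1 y h.1 y h.1,
      ⟨?_, ?_⟩, h.2⟩, h.1⟩⟩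
    · rw [AddSubgroup.mem_bot.1 hb]; simp
    · have := hK.1 _ hx y h.1
      rw [T.β₂_up, ← map_zero T.ι] at this
      exact T.ι_injective this
    · rw [← T.π_β₂, hK.1 y h.1 y h.1, map_zero]
  · intro K hK hx
    set f : K →+ ZMod p := (T.β₁ x).comp (T.red.comp K.subtype) with hf
    -- If the functional vanished, `x` would lie in `(red K)^⊥`, which is `K.comap T.up` for
    -- self-orthogonal `K`.
    have hf0 : f ≠ 0 := by
      intro h
      refine hx ?_
      have h1 : x ∈ K.comap T.up := by
        rw [comap_eq_perp hK.1 hK.2.1]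
        rintro _ ⟨y, hy, rfl⟩
        rw [T.β₁_comm]
        exact DFunLike.congr_fun h ⟨y, hy⟩
      exact h1
    have h1 := card_fiber_mul f hf0 0
    rw [hK.2.1, pow_succ] at h1
    have h1 := Nat.eq_of_mul_eq_mul_right hp.out.pos h1
    have h2 : ({y | y ∈ K ∧ T.β₁ x (T.red y) = 0} : Set V₂).ncard = p ^ (2 * k) := by
      rw [← h1, ← Set.ncard_image_of_injective _ K.subtype_injective]
      congr 1
      ext y
      exact ⟨fun h => ⟨⟨y, h.1⟩, h.2, rfl⟩, by rintro ⟨y, hy, rfl⟩; exact ⟨y.2, hy⟩⟩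
    have h3 : ({y | y ∈ K ∧ T.red y = 0} : Set V₂).ncard = p ^ (0 + (2 * k + 1 - d)) := by
      rw [zero_add, ← card_comap_of_mem_lagr (by omega) hK, ← SetLike.coe_sort_coe,
        Nat.card_coe_set_eq, ← Set.ncard_image_of_injective _ T.up_injective]
      congr 1
      ext y
      refine ⟨fun h => ?_, ?_⟩
      · obtain ⟨z, rfl⟩ := T.exists_up_eq y h.2
        exact ⟨z, h.1, rfl⟩
      · rintro ⟨z, hz, rfl⟩
        exact ⟨hz, T.red_up z⟩
    have h4 := Set.ncard_sdiff_add_ncard_of_subset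
      (show ({y | y ∈ K ∧ T.red y = 0} : Set V₂) ⊆ {y | y ∈ K ∧ T.β₁ x (T.red y) = 0} from
        fun y hy => ⟨hy.1, by rw [hy.2, map_zero]⟩)
    rw [h2, h3] at h4
    rw [eq_sub_iff_add_eq]
    have h5 : {y | y ∈ T.isoOver ⊥ S ∧ y ∈ K} = ({y | y ∈ K ∧ T.β₁ x (T.red y) = 0} : Set V₂) \
        {y | y ∈ K ∧ T.red y = 0} := by
      ext y
      refine ⟨fun h => ⟨⟨h.2, h.1.2.2.1.1⟩, fun h0 => h.1.2.2.2 h0.2⟩, fun h => ⟨⟨fun b hb => ?_,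
        hK.1 y h.1.1 y h.1.1, ⟨h.1.2, ?_⟩, fun h0 => h.2 ⟨h.1.1, h0⟩⟩, h.1.1⟩⟩
      · rw [AddSubgroup.mem_bot.1 hb]; simp
      · rw [← T.π_β₂, hK.1 y h.1.1 y h.1.1, map_zero]
    rw [h5]
    exact_mod_cast h4
  · intro y hy
    exact ncard_lagr_mem hp2 hT hd1 hd (fun h0 => hy.2.2.2 h0) hy.2.1

/-- Each factor equals `p⁻¹ (p^{2(k-i)} - 1) / (1 - p^{-(d-i)})`; the reflection `i ↦ d - i` in the
denominators alone gives the stated product. -/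
theorem chainCount_one {d : ℕ} (hd1 : 1 ≤ d) (hd : d ≤ k) :
    chainCount p k d 1 = localProd k p d * ((p : ℚ) ^ (d - 1))⁻¹ := by
  have hp1 : (1 : ℚ) < p := by exact_mod_cast hp.out.one_lt
  have hp0 : (p : ℚ) ≠ 0 := by positivity
  have h1 : ((p : ℚ) ^ (d - 1))⁻¹ = ∏ _i ∈ Finset.Ico 1 d, (p : ℚ)⁻¹ := by
    rw [Finset.prod_const, Nat.card_Ico, inv_pow]
  have h2 : ∏ i ∈ Finset.Ico 1 d, (1 - ((p : ℚ) ^ i)⁻¹) =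
      ∏ i ∈ Finset.Ico 1 d, (1 - ((p : ℚ) ^ (d - i))⁻¹) := by
    have := Finset.prod_Ico_reflect (fun i => (1 - ((p : ℚ) ^ i)⁻¹)) 1 (m := d) (n := d) (by omega)
    rw [Nat.add_sub_cancel_left] at this
    exact this.symm
  rw [h1, localProd, chainCount, Finset.prod_div_distrib, Finset.prod_div_distrib, h2,
    ← Finset.prod_div_distrib, ← Finset.prod_div_distrib, ← Finset.prod_mul_distrib]
  refine Finset.prod_congr rfl fun i hi => ?_
  rw [Finset.mem_Ico] at hi
  obtain ⟨e, rfl⟩ : ∃ e, d = i + e := ⟨d - i, by omega⟩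
  obtain ⟨f, hf⟩ : ∃ f, 2 * k = i + e + f := ⟨2 * k - (i + e), by omega⟩
  have i1 : i + (2 * k + 1 - (i + e)) = i + f + 1 := by omega
  have hP1 : (p : ℚ) ^ e - 1 ≠ 0 := by
    rw [sub_ne_zero]
    exact (one_lt_pow₀ hp1 (by omega)).ne'
  rw [i1, extCount, Nat.add_sub_cancel_left, pow_succ, hf]
  have h3 : (p : ℚ) ^ (i + e + f) * p - p ^ (i + f + 1) = p ^ i * p ^ f * p * (p ^ e - 1) := by ring
  have h4 : 1 - ((p : ℚ) ^ e)⁻¹ = (p ^ e - 1) / p ^ e := by field_simp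
  rw [h3, h4, pow_add, pow_add]
  field_simp

/-! ### The number of neighbours containing a vector -/

/-- The Lagrangian subgroups other than the multiples of `p`, i.e. the neighbours. -/
def nbr (T : TwoLevel p (2 * k + 1) V₂ V₁) : Set (AddSubgroup V₂) :=
  {K | T.Isotropic K ∧ Nat.card K = p ^ (2 * k + 1) ∧ K ≠ T.up.range}

/-- Rank `0` would force `K` to be the image of `up`, and the isotropic reduction has rank at most
`k`. -/
theorem exists_mem_lagr (hT : T.IsoCount) {K : AddSubgroup V₂} (hK : K ∈ T.nbr) :
    ∃ d ∈ Finset.Icc 1 k, K ∈ T.lagr d := by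
  obtain ⟨hi, hc, hne⟩ := hK
  have h1 := T.card_eq K
  obtain ⟨d, -, hd⟩ := (Nat.dvd_prime_pow hp.out).1 (Dvd.intro _ (h1.symm.trans hc))
  refine ⟨d, Finset.mem_Icc.2 ⟨?_, ?_⟩, hi, hc, hd⟩
  · rcases Nat.eq_zero_or_pos d with rfl | h
    · exfalso
      rw [pow_zero, AddSubgroup.card_eq_one] at hd
      refine hne (AddSubgroup.eq_of_le_of_card_ge ?_ ?_)
      · intro x hx
        obtain ⟨z, rfl⟩ := T.exists_up_eq x (AddSubgroup.mem_bot.1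
          (hd ▸ AddSubgroup.mem_map_of_mem T.red hx))
        exact ⟨z, rfl⟩
      · rw [hc, ← T.card_V₁]
        exact (Nat.card_congr (T.up.ofInjective T.up_injective).toEquiv).symm.le
    · exact h
  · refine hT.le ?_ hd
    rintro _ ⟨x, hx, rfl⟩ _ ⟨y, hy, rfl⟩
    rw [← T.π_β₂, hi x hx y hy, map_zero]

theorem mem_nbr_of_mem_lagr {d : ℕ} (hd : 1 ≤ d) {K : AddSubgroup V₂} (hK : K ∈ T.lagr d) :
    K ∈ T.nbr := by
  refine ⟨hK.1, hK.2.1, ?_⟩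
  rintro rfl
  have h := hK.2.2
  have h1 : T.up.range.map T.red = ⊥ := by
    rw [AddSubgroup.eq_bot_iff_forall]
    rintro _ ⟨_, ⟨z, rfl⟩, rfl⟩
    exact T.red_up z
  rw [h1, AddSubgroup.card_bot] at h
  exact (one_lt_pow₀ hp.out.one_lt (by omega : d ≠ 0)).ne h

theorem ncard_nbr_mem (hT : T.IsoCount) (v : V₂) :
    ({K | K ∈ T.nbr ∧ v ∈ K} : Set (AddSubgroup V₂)).ncard =
      ∑ d ∈ Finset.Icc 1 k, ({K | K ∈ T.lagr d ∧ v ∈ K} : Set (AddSubgroup V₂)).ncard := by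
  classical
  cases nonempty_fintype (AddSubgroup V₂)
  have hlog : ∀ {K d}, K ∈ T.lagr d → Nat.log p (Nat.card (K.map T.red)) = d := fun h => by
    rw [h.2.2, Nat.log_pow hp.out.one_lt]
  rw [Set.ncard_eq_toFinset_card', Finset.card_eq_sum_card_fiberwise
    (f := fun K => Nat.log p (Nat.card (K.map T.red))) (t := Finset.Icc 1 k)]
  · refine Finset.sum_congr rfl fun d hd => ?_
    rw [Set.ncard_eq_toFinset_card']
    congr 1
    ext K
    rw [Finset.mem_filter, Set.mem_toFinset, Set.mem_toFinset]
    constructor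
    · rintro ⟨⟨hK, hv⟩, hl⟩
      obtain ⟨d', hd', h⟩ := exists_mem_lagr hT hK
      rw [hlog h] at hl
      exact ⟨hl ▸ h, hv⟩
    · rintro ⟨hK, hv⟩
      exact ⟨⟨mem_nbr_of_mem_lagr (Finset.mem_Icc.1 hd).1 hK, hv⟩, hlog hK⟩
  · intro K hK
    rw [Set.coe_toFinset] at hK
    obtain ⟨d, hd, h⟩ := exists_mem_lagr hT hK.1
    change Nat.log p (Nat.card (K.map T.red)) ∈ _
    rw [hlog h]
    exact hd

theorem ncard_nbr_mem_primitive (hp2 : p ≠ 2) (hT : T.IsoCount) {y : V₂} (hy : T.red y ≠ 0)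
    (hyy : T.β₂ y y = 0) :
    (({K | K ∈ T.nbr ∧ y ∈ K} : Set (AddSubgroup V₂)).ncard : ℚ) = cConst k p := by
  rw [ncard_nbr_mem hT, Nat.cast_sum, cConst]
  refine Finset.sum_congr rfl fun d hd => ?_
  rw [Finset.mem_Icc] at hd
  rw [ncard_lagr_mem hp2 hT hd.1 hd.2 hy hyy, chainCount_one hd.1 hd.2]

/-- Splitting `(p^{2k-1} - p^{d-1}) / (p^d - 1)` as `1 + (p^{2k-1} - p^{d-1}(p+1) + 1) / (p^d - 1)`
separates the summands of `c_p` from those of `β_p`. -/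
theorem ncard_nbr_mem_up (hp2 : p ≠ 2) (hT : T.IsoCount) {x : V₁} {E : ℚ}
    (hE : (({w | T.β₁ x w = 0 ∧ T.β₁ w w = 0} : Set V₁).ncard : ℚ) =
      (p : ℚ) ^ (2 * k - 1) + (p - 1) * E) :
    (({K | K ∈ T.nbr ∧ T.up x ∈ K} : Set (AddSubgroup V₂)).ncard : ℚ) =
      cConst k p * (1 + E) + betaConst k p := by
  have hp1 : (1 : ℚ) < p := by exact_mod_cast hp.out.one_lt
  have hp0 : (p : ℚ) ≠ 0 := by positivity
  rw [ncard_nbr_mem hT, Nat.cast_sum, cConst, betaConst, Finset.sum_mul, ← Finset.sum_add_distrib]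
  refine Finset.sum_congr rfl fun d hd => ?_
  rw [Finset.mem_Icc] at hd
  rw [ncard_lagr_mem_up hp2 hT hd.1 hd.2 hE, chainCount_one hd.1 hd.2]
  obtain ⟨e, rfl⟩ : ∃ e, d = e + 1 := ⟨d - 1, by omega⟩
  have hP1 : (p : ℚ) ^ (e + 1) - 1 ≠ 0 := by
    rw [sub_ne_zero]
    exact (one_lt_pow₀ hp1 (by omega)).ne'
  rw [Nat.add_sub_cancel]
  field_simp
  ring

end TwoLevel

end ReprZeta

namespace ReprZeta

/-! ### Reduction of integral lattices -/

section Reduction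

variable {n : ℕ}

/-- Reduction of integral vectors modulo `N`. -/
def intVec (N : ℕ) : (Fin n → ℤ) →+ (Fin n → ZMod N) := (Int.castAddHom (ZMod N)).compLeft (Fin n)

theorem intVec_apply (N : ℕ) (x : Fin n → ℤ) (i : Fin n) : intVec N x i = (x i : ZMod N) := rfl

theorem intVec_surjective (N : ℕ) : Function.Surjective (intVec (n := n) N) := fun x => by
  choose y hy using fun i => ZMod.intCast_surjective (x i)
  exact ⟨y, funext hy⟩

theorem intVec_eq_zero_iff {N : ℕ} {x : Fin n → ℤ} : intVec N x = 0 ↔ ∀ i, (N : ℤ) ∣ x i := by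
  simp only [funext_iff, intVec_apply, Pi.zero_apply, ZMod.intCast_zmod_eq_zero_iff_dvd]

theorem intVec_eq_zero_iff_exists {N : ℕ} {x : Fin n → ℤ} :
    intVec N x = 0 ↔ ∃ z, x = (N : ℤ) • z := by
  rw [intVec_eq_zero_iff]
  constructor
  · intro h
    choose z hz using h
    exact ⟨z, funext fun i => by rw [hz i]; rfl⟩
  · rintro ⟨z, rfl⟩ i
    exact ⟨z i, rfl⟩

theorem matPairing_intVec (N : ℕ) (Q : Matrix (Fin n) (Fin n) ℤ) (x y : Fin n → ℤ) :
    matPairing (Q.map (Int.cast : ℤ → ZMod N)) (intVec N x) (intVec N y) =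
      ((x ⬝ᵥ Q.mulVec y : ℤ) : ZMod N) := by
  have h1 := RingHom.map_dotProduct (Int.castRingHom (ZMod N)) x (Q.mulVec y)
  have h2 : (Int.castRingHom (ZMod N)) ∘ (Q.mulVec y) =
      (Q.map (Int.castRingHom (ZMod N))).mulVec ((Int.castRingHom (ZMod N)) ∘ y) :=
    funext fun i => RingHom.map_mulVec (Int.castRingHom (ZMod N)) Q y i
  rw [h2] at h1
  exact h1.symm

theorem det_map_intCast (N : ℕ) (Q : Matrix (Fin n) (Fin n) ℤ) :
    (Q.map (Int.cast : ℤ → ZMod N)).det = (Q.det : ZMod N) :=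
  (RingHom.map_det (Int.castRingHom (ZMod N)) Q).symm

theorem isSymm_map_intCast (N : ℕ) {Q : Matrix (Fin n) (Fin n) ℤ} (hQ : Q.IsSymm) :
    (Q.map (Int.cast : ℤ → ZMod N)).IsSymm := hQ.map _

/-- Multiplication by `p`, as a map from `ℤ/p` to `ℤ/p²`. -/
def mulLift (p : ℕ) : ZMod p →+ ZMod (p ^ 2) :=
  ZMod.lift p ⟨(AddMonoidHom.mulLeft (p : ZMod (p ^ 2))).comp (Int.castAddHom _), by
    have : ((p ^ 2 : ℕ) : ZMod (p ^ 2)) = 0 := ZMod.natCast_self _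
    simpa [sq] using this⟩

theorem mulLift_intCast (p : ℕ) (z : ℤ) : mulLift p (z : ZMod p) = ((p * z : ℤ) : ZMod (p ^ 2)) := by
  rw [mulLift, ZMod.lift_coe]
  simp

theorem mulLift_intVec (p : ℕ) (z : Fin n → ℤ) :
    (mulLift p).compLeft (Fin n) (intVec p z) = intVec (p ^ 2) ((p : ℤ) • z) :=
  funext fun i => mulLift_intCast p (z i)

theorem castHom_intVec (p : ℕ) (z : Fin n → ℤ) :
    ((ZMod.castHom (dvd_pow_self p two_ne_zero) (ZMod p)).toAddMonoidHom).compLeft (Fin n)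
      (intVec (p ^ 2) z) = intVec p z :=
  funext fun i => map_intCast (ZMod.castHom (dvd_pow_self p two_ne_zero) (ZMod p)) (z i)

variable {p : ℕ} [hp : Fact p.Prime]

theorem mulLift_injective : Function.Injective (mulLift p) := by
  rw [injective_iff_map_eq_zero]
  intro a ha
  obtain ⟨z, rfl⟩ := ZMod.intCast_surjective a
  rw [mulLift_intCast, ZMod.intCast_zmod_eq_zero_iff_dvd, Nat.cast_pow, sq] at ha
  rw [ZMod.intCast_zmod_eq_zero_iff_dvd]
  exact Int.dvd_of_mul_dvd_mul_left (Nat.cast_ne_zero.2 hp.out.ne_zero) ha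

/-- The reductions of an integral lattice with symmetric Gram matrix of determinant prime to `p`. -/
def latticeTwoLevel (p : ℕ) [hp : Fact p.Prime] (Q : Matrix (Fin n) (Fin n) ℤ) (hQ : Q.IsSymm)
    (hdet : ¬ (p : ℤ) ∣ Q.det) : TwoLevel p n (Fin n → ZMod (p ^ 2)) (Fin n → ZMod p) where
  β₂ := matPairing (Q.map (Int.cast : ℤ → ZMod (p ^ 2)))
  β₁ := matPairing (Q.map (Int.cast : ℤ → ZMod p))
  red := ((ZMod.castHom (dvd_pow_self p two_ne_zero) (ZMod p)).toAddMonoidHom).compLeft (Fin n)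
  up := (mulLift p).compLeft (Fin n)
  ι := mulLift p
  π := (ZMod.castHom (dvd_pow_self p two_ne_zero) (ZMod p)).toAddMonoidHom
  ι_injective := mulLift_injective
  up_injective := fun x y h => funext fun i => mulLift_injective (congrFun h i)
  red_surjective := fun x => by
    obtain ⟨z, rfl⟩ := intVec_surjective p x
    exact ⟨intVec (p ^ 2) z, castHom_intVec p z⟩
  up_red := fun x => by
    obtain ⟨z, rfl⟩ := intVec_surjective _ x
    rw [castHom_intVec, mulLift_intVec, map_zsmul, natCast_zsmul]
  red_up := fun x => by
    obtain ⟨z, rfl⟩ := intVec_surjective _ x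
    rw [mulLift_intVec, castHom_intVec, intVec_eq_zero_iff_exists]
    exact ⟨z, rfl⟩
  exists_up_eq := fun x hx => by
    obtain ⟨z, rfl⟩ := intVec_surjective _ x
    rw [castHom_intVec, intVec_eq_zero_iff_exists] at hx
    obtain ⟨w, rfl⟩ := hx
    exact ⟨intVec p w, mulLift_intVec p w⟩
  exists_ι_eq := fun a ha => by
    obtain ⟨z, rfl⟩ := ZMod.intCast_surjective a
    have h1 : ((z : ℤ) : ZMod p) = 0 := by
      rw [← map_intCast (ZMod.castHom (dvd_pow_self p two_ne_zero) (ZMod p)) z]; exact ha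
    rw [ZMod.intCast_zmod_eq_zero_iff_dvd] at h1
    obtain ⟨w, rfl⟩ := h1
    exact ⟨w, mulLift_intCast p w⟩
  β₂_up := fun z y => by
    obtain ⟨z, rfl⟩ := intVec_surjective _ z
    obtain ⟨y, rfl⟩ := intVec_surjective _ y
    rw [mulLift_intVec, castHom_intVec, matPairing_intVec, matPairing_intVec, mulLift_intCast,
      smul_dotProduct, smul_eq_mul]
  π_β₂ := fun x y => by
    obtain ⟨x, rfl⟩ := intVec_surjective _ x
    obtain ⟨y, rfl⟩ := intVec_surjective _ y
    rw [castHom_intVec, castHom_intVec, matPairing_intVec, matPairing_intVec]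
    exact map_intCast (ZMod.castHom (dvd_pow_self p two_ne_zero) (ZMod p)) _
  β₂_comm := matPairing_comm (isSymm_map_intCast _ hQ)
  β₁_comm := matPairing_comm (isSymm_map_intCast _ hQ)
  β₂_nondegenerate := matPairing_nondegenerate (isSymm_map_intCast _ hQ) (by
    rw [det_map_intCast, ZMod.coe_int_isUnit_iff_isCoprime, Nat.cast_pow]
    exact (((Nat.prime_iff_prime_int.1 hp.out).irreducible.coprime_iff_not_dvd).2 hdet).pow_left)
  β₁_nondegenerate := matPairing_nondegenerate (isSymm_map_intCast _ hQ) (by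
    rw [det_map_intCast, ZMod.coe_int_isUnit_iff_isCoprime]
    exact ((Nat.prime_iff_prime_int.1 hp.out).irreducible.coprime_iff_not_dvd).2 hdet)
  card_V₁ := by
    rw [Nat.card_fun, Nat.card_zmod, Nat.card_eq_fintype_card, Fintype.card_fin]

end Reduction

/-! ### Neighbours of an integral form -/

section Neighbours

variable {m : ℕ}

theorem polar_eq_dotProduct (q : Form m) (x y : Fin m → ℤ) :
    QuadraticMap.polar q x y = x ⬝ᵥ (formMatrix q).mulVec y := by
  have h : formMatrix q = LinearMap.toMatrix₂' ℤ (QuadraticMap.polarBilin q) := by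
    ext i j
    rw [LinearMap.toMatrix₂'_apply]; rfl
  rw [h, ← Matrix.toLinearMap₂'_apply', Matrix.toLinearMap₂'_toMatrix']
  rfl

theorem two_mul_eq_dotProduct (q : Form m) (x : Fin m → ℤ) :
    2 * q x = x ⬝ᵥ (formMatrix q).mulVec x := by
  rw [← polar_eq_dotProduct, QuadraticMap.polar_self, nsmul_eq_mul, Nat.cast_ofNat]

theorem isSymm_formMatrix (q : Form m) : (formMatrix q).IsSymm := by
  ext i j
  exact QuadraticMap.polar_comm _ _ _

/-- The sublattices of `ℤ^m` of index `c^m` on which `q` is divisible by `c²`, apart from those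
contained in `cℤ^m`. -/
def nbrs (q : Form m) (c : ℕ) : Set (AddSubgroup (Fin m → ℤ)) :=
  {K | K.index = c ^ m ∧ (∀ x ∈ K, (c : ℤ) ^ 2 ∣ q x) ∧ ∃ x ∈ K, ∃ i, ¬ (c : ℤ) ∣ x i}

theorem dvd_polar_of_mem {q : Form m} {K : AddSubgroup (Fin m → ℤ)} {c : ℤ}
    (hK : ∀ x ∈ K, c ∣ q x) {x y : Fin m → ℤ} (hx : x ∈ K) (hy : y ∈ K) :
    c ∣ x ⬝ᵥ (formMatrix q).mulVec y := by
  rw [← polar_eq_dotProduct]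
  exact dvd_sub (dvd_sub (hK _ (K.add_mem hx hy)) (hK _ hx)) (hK _ hy)

variable {p : ℕ} [hp : Fact p.Prime]

/-- The reductions of the lattice of an integral form. -/
abbrev formTwoLevel (p : ℕ) [Fact p.Prime] (q : Form m) (hq : ¬ (p : ℤ) ∣ formDet q) :
    TwoLevel p m (Fin m → ZMod (p ^ 2)) (Fin m → ZMod p) :=
  latticeTwoLevel p (formMatrix q) (isSymm_formMatrix q) hq

theorem isotropic_map_of_dvd {q : Form m} (hq : ¬ (p : ℤ) ∣ formDet q)
    {K : AddSubgroup (Fin m → ℤ)} (hK : ∀ x ∈ K, (p : ℤ) ^ 2 ∣ q x) :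
    (formTwoLevel p q hq).Isotropic (K.map (intVec (p ^ 2))) := by
  rintro _ ⟨x, hx, rfl⟩ _ ⟨y, hy, rfl⟩
  refine (matPairing_intVec _ _ x y).trans ?_
  rw [ZMod.intCast_zmod_eq_zero_iff_dvd, Nat.cast_pow]
  exact dvd_polar_of_mem hK hx hy

/-- That `K` contains `p²ℤ^m` is not assumed but forced. Its image modulo `p²` is isotropic, hence
of order at most `p^m`, while the index of the image divides `p^m`; the product being `p^{2m}`, both
are equalities and `K` is the full preimage. -/
theorem comap_map_intVec {q : Form m} (hq : ¬ (p : ℤ) ∣ formDet q) {K : AddSubgroup (Fin m → ℤ)}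
    (hK : ∀ x ∈ K, (p : ℤ) ^ 2 ∣ q x) (hi : K.index = p ^ m) :
    (K.map (intVec (p ^ 2))).comap (intVec (p ^ 2)) = K ∧
      Nat.card (K.map (intVec (p ^ 2))) = p ^ m := by
  have := TwoLevel.neZero_sq (p := p)
  set T := formTwoLevel p q hq
  set K₂ := K.map (intVec (p ^ 2)) with hK₂
  have hiso : T.Isotropic K₂ := isotropic_map_of_dvd hq hK
  have hp0 : 0 < p ^ m := pow_pos hp.out.pos _
  have h1 := T.card_mul_card_perp₂ K₂
  have h2 : Nat.card K₂ ≤ Nat.card (perp T.β₂ K₂) :=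
    Nat.card_mono (Set.toFinite _) fun x hx y hy => hiso y hy x hx
  have h3 : Nat.card K₂ ≤ p ^ m := by
    by_contra! h
    have := Nat.mul_lt_mul'' h (h.trans_le h2)
    omega
  have h4 : (K₂.comap (intVec (p ^ 2))).index = K₂.index :=
    AddSubgroup.index_comap_of_surjective _ (intVec_surjective _)
  have h5 := K₂.card_mul_index
  rw [T.card_V₂] at h5
  have hle : K ≤ K₂.comap (intVec (p ^ 2)) := AddSubgroup.le_comap_map _ _
  have h6 := AddSubgroup.index_dvd_of_le hle
  rw [hi, h4] at h6
  have h7 : K₂.index = p ^ m := by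
    refine le_antisymm (Nat.le_of_dvd hp0 h6) ?_
    by_contra! h
    have : Nat.card K₂ * K₂.index < p ^ m * p ^ m :=
      lt_of_le_of_lt (Nat.mul_le_mul_right _ h3) (Nat.mul_lt_mul_of_pos_left h hp0)
    omega
  refine ⟨le_antisymm ?_ hle, ?_⟩
  · have h8 := AddSubgroup.relIndex_mul_index hle
    rw [h4, h7, hi] at h8
    exact AddSubgroup.relIndex_eq_one.1 (Nat.eq_of_mul_eq_mul_right hp0 (by rw [h8, one_mul]))
  · rw [h7] at h5
    exact Nat.eq_of_mul_eq_mul_right hp0 h5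

/-- Reduction modulo `p²` is a bijection on neighbours. Oddness of `p` is needed to return from `p²
∣ 2 q x` to `p² ∣ q x`. -/
theorem ncard_nbrs_mem {k : ℕ} (hp2 : p ≠ 2) {q : Form (2 * k + 1)} (hq : ¬ (p : ℤ) ∣ formDet q)
    (y : Fin (2 * k + 1) → ℤ) : ({K | K ∈ nbrs q p ∧ y ∈ K} : Set (AddSubgroup _)).ncard =
      ({K | K ∈ (formTwoLevel p q hq).nbr ∧ intVec (p ^ 2) y ∈ K} : Set (AddSubgroup _)).ncard := by
  have := TwoLevel.neZero_sq (p := p)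
  set T := formTwoLevel p q hq
  have hsurj : Function.Surjective (intVec (n := 2 * k + 1) (p ^ 2)) := intVec_surjective _
  refine Set.ncard_congr (fun K _ => K.map (intVec (p ^ 2))) ?_ ?_ ?_
  · rintro K ⟨⟨hi, hd, x, hx, i, hxi⟩, hy⟩
    refine ⟨⟨isotropic_map_of_dvd hq hd, (comap_map_intVec hq hd hi).2, fun h => hxi ?_⟩,
      AddSubgroup.mem_map_of_mem _ hy⟩
    have h1 : intVec (p ^ 2) x ∈ T.up.range := h ▸ AddSubgroup.mem_map_of_mem _ hx
    obtain ⟨z, hz⟩ := h1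
    have h2 : T.red (intVec (p ^ 2) x) = 0 := by rw [← hz, T.red_up]
    have h3 : intVec p x = 0 := by rw [← h2]; exact (castHom_intVec p x).symm
    exact intVec_eq_zero_iff.1 h3 i
  · rintro K K' ⟨⟨hi, hd, -⟩, -⟩ ⟨⟨hi', hd', -⟩, -⟩ h
    rw [← (comap_map_intVec hq hd hi).1, ← (comap_map_intVec hq hd' hi').1, h]
  · rintro K ⟨⟨hiso, hc, hne⟩, hy⟩
    refine ⟨K.comap (intVec (p ^ 2)), ⟨⟨?_, ?_, ?_⟩, AddSubgroup.mem_comap.2 hy⟩,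
      AddSubgroup.map_comap_eq_self_of_surjective hsurj K⟩
    · rw [AddSubgroup.index_comap_of_surjective _ hsurj]
      have h5 := K.card_mul_index
      rw [T.card_V₂, hc] at h5
      exact Nat.eq_of_mul_eq_mul_left (pow_pos hp.out.pos _) h5
    · intro x hx
      have h1 := hiso _ hx _ hx
      have h2 := (matPairing_intVec (p ^ 2) (formMatrix q) x x).symm.trans h1
      rw [← two_mul_eq_dotProduct, ZMod.intCast_zmod_eq_zero_iff_dvd, Nat.cast_pow] at h2
      refine IsCoprime.dvd_of_dvd_mul_left ?_ h2
      refine IsCoprime.pow_left ?_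
      exact_mod_cast Nat.isCoprime_iff_coprime.2 ((Nat.coprime_primes hp.out Nat.prime_two).2 hp2)
    · by_contra! h
      refine hne (AddSubgroup.eq_of_le_of_card_ge ?_ ?_)
      · intro x hx
        obtain ⟨z, rfl⟩ := hsurj x
        have hz := intVec_eq_zero_iff.2 (h z hx)
        obtain ⟨w, hw⟩ := T.exists_up_eq (intVec (p ^ 2) z) ((castHom_intVec p z).trans hz)
        exact ⟨w, hw⟩
      · rw [hc, ← T.card_V₁]
        exact (Nat.card_congr (T.up.ofInjective T.up_injective).toEquiv).symm.le

variable {k : ℕ} {q : Form (2 * k + 1)}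

theorem isoCount_formTwoLevel (hp2 : p ≠ 2) (hq : ¬ (p : ℤ) ∣ formDet q) :
    (formTwoLevel p q hq).IsoCount := fun W hW =>
  card_isotropic_perp hp2 (isSymm_map_intCast p (isSymm_formMatrix q)) (by
    rw [det_map_intCast, Ne, ZMod.intCast_zmod_eq_zero_iff_dvd]
    exact hq) W hW

theorem ncard_nbrs_mem_primitive (hp2 : p ≠ 2) (hq : ¬ (p : ℤ) ∣ formDet q)
    {y : Fin (2 * k + 1) → ℤ} (hy : ∃ i, ¬ (p : ℤ) ∣ y i) (hqy : (p : ℤ) ^ 2 ∣ q y) :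
    (({K | K ∈ nbrs q p ∧ y ∈ K} : Set (AddSubgroup _)).ncard : ℚ) = cConst k p := by
  have := TwoLevel.neZero_sq (p := p)
  rw [ncard_nbrs_mem hp2 hq]
  refine TwoLevel.ncard_nbr_mem_primitive hp2 (isoCount_formTwoLevel hp2 hq) ?_ ?_
  · rw [show (formTwoLevel p q hq).red (intVec (p ^ 2) y) = intVec p y from castHom_intVec p y, Ne,
      intVec_eq_zero_iff, not_forall]
    exact hy
  · refine (matPairing_intVec (p ^ 2) (formMatrix q) y y).trans ?_
    rw [← two_mul_eq_dotProduct, ZMod.intCast_zmod_eq_zero_iff_dvd, Nat.cast_pow]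
    exact hqy.mul_left 2

/-- The Gauss sum count of isotropic vectors orthogonal to `x` modulo `p` is `p^{2k-1} + (p-1) E`
with `E = χ_p(q) (2q(x)/p) p^{k-1}`. -/
theorem ncard_nbrs_mem_smul (hp2 : p ≠ 2) (hk : 1 ≤ k) (hq : ¬ (p : ℤ) ∣ formDet q)
    {x : Fin (2 * k + 1) → ℤ} (hx : ∃ i, ¬ (p : ℤ) ∣ x i) :
    (({K | K ∈ nbrs q p ∧ (p : ℤ) • x ∈ K} : Set (AddSubgroup _)).ncard : ℚ) =
      cConst k p * (1 + legendreSym p ((-1) ^ k * formDet q) * legendreSym p (2 * q x) *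
        (p : ℚ) ^ (k - 1)) + betaConst k p := by
  have := TwoLevel.neZero_sq (p := p)
  rw [ncard_nbrs_mem hp2 hq, show intVec (p ^ 2) ((p : ℤ) • x) =
    (formTwoLevel p q hq).up (intVec p x) from (mulLift_intVec p x).symm]
  refine TwoLevel.ncard_nbr_mem_up hp2 (isoCount_formTwoLevel hp2 hq) ?_
  have hp0 : (p : ℚ) ≠ 0 := Nat.cast_ne_zero.2 hp.out.ne_zero
  have h := card_isotropic_orthogonal_vector hp2 (isSymm_map_intCast p (isSymm_formMatrix q)) (by
    rw [det_map_intCast, Ne, ZMod.intCast_zmod_eq_zero_iff_dvd]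
    exact hq) (x := intVec p x) (by
    rw [Ne, intVec_eq_zero_iff, not_forall]
    exact hx)
  have h2 : quadraticChar (ZMod p) ((-1) ^ k * ((formMatrix q).map (Int.cast : ℤ → ZMod p)).det *
      matPairing ((formMatrix q).map (Int.cast : ℤ → ZMod p)) (intVec p x) (intVec p x)) =
      legendreSym p ((-1) ^ k * formDet q) * legendreSym p (2 * q x) := by
    rw [matPairing_intVec, det_map_intCast, ← two_mul_eq_dotProduct, ← legendreSym.mul, legendreSym]
    congr 1
    simp only [formDet]
    push_cast
    ring
  rw [h2] at h
  have h3 : (p : ℚ) ^ 2 * ({w | matPairing ((formMatrix q).map (Int.cast : ℤ → ZMod p)) (intVec p x) w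
      = 0 ∧ matPairing ((formMatrix q).map (Int.cast : ℤ → ZMod p)) w w = 0} : Set _).ncard =
      (p : ℚ) ^ (2 * k + 1) + (p - 1) * p ^ (k + 1) *
        (legendreSym p ((-1) ^ k * formDet q) * legendreSym p (2 * q x)) := by
    exact_mod_cast h
  refine mul_left_cancel₀ (pow_ne_zero 2 hp0) (h3.trans ?_)
  obtain ⟨k, rfl⟩ : ∃ k', k = k' + 1 := ⟨k - 1, by omega⟩
  rw [Nat.add_sub_cancel, show 2 * (k + 1) - 1 = 2 * k + 1 by omega]
  ring

/-- Now `x` vanishes modulo `p`, so all `p^{2k} = p^{2k-1} + (p-1) p^{2k-1}` isotropic vectors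
qualify and `E = p^{2k-1}`. With `x = 0` this counts all neighbours. -/
theorem ncard_nbrs_mem_sq_smul (hp2 : p ≠ 2) (hk : 1 ≤ k) (hq : ¬ (p : ℤ) ∣ formDet q)
    {x : Fin (2 * k + 1) → ℤ} (hx : ∀ i, (p : ℤ) ∣ x i) :
    (({K | K ∈ nbrs q p ∧ (p : ℤ) • x ∈ K} : Set (AddSubgroup _)).ncard : ℚ) =
      cConst k p * (1 + (p : ℚ) ^ (2 * k - 1)) + betaConst k p := by
  have := TwoLevel.neZero_sq (p := p)
  rw [ncard_nbrs_mem hp2 hq, show intVec (p ^ 2) ((p : ℤ) • x) =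
    (formTwoLevel p q hq).up (intVec p x) from (mulLift_intVec p x).symm]
  refine TwoLevel.ncard_nbr_mem_up hp2 (isoCount_formTwoLevel hp2 hq) ?_
  have h := isoCount_formTwoLevel hp2 hq ⊥ (fun u hu => by rw [AddSubgroup.mem_bot.1 hu]; simp)
  rw [AddSubgroup.card_bot, one_mul] at h
  have h2 : ({w | (formTwoLevel p q hq).β₁ (intVec p x) w = 0 ∧ (formTwoLevel p q hq).β₁ w w = 0}
      : Set (Fin (2 * k + 1) → ZMod p)) = {w | w ∈ perp (formTwoLevel p q hq).β₁ ⊥ ∧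
        (formTwoLevel p q hq).β₁ w w = 0} := by
    ext w
    refine and_congr_left fun _ => ⟨fun _ b hb => ?_, fun _ => ?_⟩
    · rw [AddSubgroup.mem_bot.1 hb]; simp
    · rw [intVec_eq_zero_iff.2 hx]; simp
  rw [h2, h, Nat.cast_pow]
  obtain ⟨k, rfl⟩ : ∃ k', k = k' + 1 := ⟨k - 1, by omega⟩
  rw [show 2 * (k + 1) - 1 = 2 * k + 1 by omega]
  ring

theorem finite_nbrs (hq : ¬ (p : ℤ) ∣ formDet q) : (nbrs q p).Finite := by
  have := TwoLevel.neZero_sq (p := p)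
  refine Set.Finite.of_injOn (f := fun K => K.map (intVec (p ^ 2))) (t := Set.univ)
    (fun _ _ => Set.mem_univ _) ?_ Set.finite_univ
  rintro K ⟨hi, hd, -⟩ K' ⟨hi', hd', -⟩ h
  rw [← (comap_map_intVec hq hd hi).1, ← (comap_map_intVec hq hd' hi').1]
  exact congrArg _ h

end Neighbours

end ReprZeta

namespace ReprZeta

/-! ### Representations of forms by forms -/

section Forms

variable {m : ℕ}

theorem mem_rep_iff {n : ℕ} {q : Form m} {q' : Form n} {A : Matrix (Fin m) (Fin n) ℤ} :
    A ∈ Rep q q' ↔ ∀ x, q (A.mulVec x) = q' x :=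
  ⟨fun h x => by rw [← (show subst q A = q' from h)]; rfl, fun h => QuadraticMap.ext h⟩

theorem mem_rep_smul_iff {q q' : Form m} {c : ℤ} {A : Matrix (Fin m) (Fin m) ℤ} :
    A ∈ Rep q (c • q') ↔ ∀ x, q (A.mulVec x) = c * q' x := mem_rep_iff

theorem formMatrix_of_mem_rep {q q' : Form m} {c : ℤ} {A : Matrix (Fin m) (Fin m) ℤ}
    (hA : A ∈ Rep q (c • q')) : A.transpose * formMatrix q * A = c • formMatrix q' := by
  rw [mem_rep_smul_iff] at hA
  have h : ∀ x y, x ⬝ᵥ (A.transpose * formMatrix q * A).mulVec y =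
      x ⬝ᵥ (c • formMatrix q').mulVec y := by
    intro x y
    rw [← Matrix.mulVec_mulVec, ← Matrix.mulVec_mulVec, Matrix.dotProduct_mulVec,
      Matrix.vecMul_transpose, ← polar_eq_dotProduct, Matrix.smul_mulVec, dotProduct_smul,
      ← polar_eq_dotProduct, QuadraticMap.polar, QuadraticMap.polar, ← Matrix.mulVec_add, hA, hA,
      hA, smul_eq_mul]
    ring
  ext i j
  have := h (Pi.single i 1) (Pi.single j 1)
  rwa [single_one_dotProduct, single_one_dotProduct, Matrix.mulVec_single_one,
    Matrix.mulVec_single_one] at this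

theorem det_sq_mul_formDet {q q' : Form m} {c : ℤ} {A : Matrix (Fin m) (Fin m) ℤ}
    (hA : A ∈ Rep q (c • q')) : A.det ^ 2 * formDet q = c ^ m * formDet q' := by
  have h := congrArg Matrix.det (formMatrix_of_mem_rep hA)
  rw [Matrix.det_mul, Matrix.det_mul, Matrix.det_transpose, Matrix.det_smul, Fintype.card_fin] at h
  rw [formDet, formDet, ← h]; ring

theorem formDet_ne_zero {q : Form m} (hq : q.PosDef) : formDet q ≠ 0 := by
  intro h
  obtain ⟨v, hv, hv0⟩ := Matrix.exists_mulVec_eq_zero_iff.2 h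
  have h1 := two_mul_eq_dotProduct q v
  rw [hv0, dotProduct_zero] at h1
  have := hq v hv
  omega

theorem natAbs_det_of_mem_rep {q q' : Form m} {c : ℕ} (hq : formDet q ≠ 0)
    (hd : formDet q' = formDet q) {A : Matrix (Fin m) (Fin m) ℤ}
    (hA : A ∈ Rep q (((c : ℤ) ^ 2) • q')) : A.det.natAbs = c ^ m := by
  have h := det_sq_mul_formDet hA
  rw [hd] at h
  have h2 := mul_right_cancel₀ hq h
  have h3 : A.det ^ 2 = ((c : ℤ) ^ m) ^ 2 := by rw [h2, ← pow_mul, ← pow_mul, mul_comm]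
  rw [← Int.natAbs_eq_iff_sq_eq] at h3
  rw [h3, Int.natAbs_pow, Int.natAbs_natCast]

/-- The diagonal of the matrix is even, so modulo `2` it agrees with a skew-symmetric integral
matrix of odd size, whose determinant is zero. -/
theorem two_dvd_formDet {k : ℕ} (q : Form (2 * k + 1)) : 2 ∣ formDet q := by
  set Q := formMatrix q with hQ
  set S : Matrix (Fin (2 * k + 1)) (Fin (2 * k + 1)) ℤ := Matrix.of fun i j =>
    if i < j then Q i j else if j < i then - Q i j else 0 with hS
  have hsymm : ∀ i j, Q i j = Q j i := fun i j => (isSymm_formMatrix q).apply j i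
  have hST : S.transpose = -S := by
    ext i j
    simp only [hS, Matrix.transpose_apply, Matrix.of_apply, Matrix.neg_apply]
    rcases lt_trichotomy i j with h | h | h
    · rw [if_neg h.not_gt, if_pos h, if_pos h, hsymm]
    · subst h; simp
    · rw [if_pos h, if_neg h.not_gt, if_pos h, hsymm, neg_neg]
  have hdet : S.det = 0 := by
    have h1 := congrArg Matrix.det hST
    rw [Matrix.det_transpose, Matrix.det_neg, Fintype.card_fin, pow_succ, pow_mul] at h1
    norm_num at h1
    omega
  have hmod : Q.map (Int.cast : ℤ → ZMod 2) = S.map (Int.cast : ℤ → ZMod 2) := by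
    ext i j
    simp only [Matrix.map_apply, hS, Matrix.of_apply]
    split_ifs with h h'
    · rfl
    · rw [Int.cast_neg, ZMod.neg_eq_self_mod_two]
    · obtain rfl : i = j := le_antisymm (not_lt.1 h') (not_lt.1 h)
      have : Q i i = 2 * q (Pi.single i 1) := by
        rw [two_mul_eq_dotProduct, single_one_dotProduct, Matrix.mulVec_single_one]; rfl
      rw [this, Int.cast_zero, ZMod.intCast_zmod_eq_zero_iff_dvd]
      exact dvd_mul_right _ _
  have h2 := congrArg Matrix.det hmod
  rw [det_map_intCast, det_map_intCast, hdet, Int.cast_zero, ZMod.intCast_zmod_eq_zero_iff_dvd] at h2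
  exact_mod_cast h2

/-- From `det A² = b^m` with `m` odd follows `b ≥ 0`, and `b = 0` is not prime to the even number
`det q`; so `q'` is a positive multiple away from `q[A]` with `A` nonsingular. -/
theorem posDef_of_similar {k : ℕ} {q q' : Form (2 * k + 1)} (hq : q.PosDef) (h : Similar q q') :
    q'.PosDef := by
  obtain ⟨hd, b, hb, A, hA⟩ := h
  have hD := formDet_ne_zero hq
  have h1 := det_sq_mul_formDet hA
  rw [hd] at h1
  have h2 : A.det ^ 2 = b ^ (2 * k + 1) := mul_right_cancel₀ hD h1
  have h3 : 0 ≤ b := by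
    by_contra! hneg
    have := (Odd.pow_neg_iff (⟨k, rfl⟩ : Odd (2 * k + 1))).2 hneg
    nlinarith [sq_nonneg A.det]
  intro x hx
  have h4 := mem_rep_smul_iff.1 hA x
  rcases h3.eq_or_lt with h0 | h0
  · exfalso
    rw [← h0, isCoprime_zero_left] at hb
    exact Int.prime_two.not_isUnit (isUnit_of_dvd_unit (two_dvd_formDet q) hb)
  · have hA0 : A.det ≠ 0 := fun h => by
      rw [h, zero_pow two_ne_zero] at h2
      exact pow_ne_zero _ h0.ne' h2.symm
    have h5 : A.mulVec x ≠ 0 := fun h => hA0 (Matrix.exists_mulVec_eq_zero_iff.1 ⟨x, hx, h⟩)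
    have h6 := hq _ h5
    rw [h4] at h6
    exact pos_of_mul_pos_right h6 h0.le

theorem ne_two_of_not_dvd_formDet {k p : ℕ} {q : Form (2 * k + 1)} (hp : ¬ (p : ℤ) ∣ formDet q) :
    p ≠ 2 := by
  rintro rfl
  exact hp (by exact_mod_cast two_dvd_formDet q)

/-- For `u_i = adj(Q) e_i` one has `B x (u_i) = det Q · x_i`, so Cauchy–Schwarz bounds each
coordinate. -/
theorem finite_repNum {q : Form m} (hq : q.PosDef) (n : ℤ) : (RepNum q n).Finite := by
  set Q := formMatrix q with hQ
  have hD := formDet_ne_zero hq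
  set B := QuadraticMap.polarBilin q
  have hB : ∀ x y, B x y = x ⬝ᵥ Q.mulVec y := fun x y => polar_eq_dotProduct q x y
  have hBpos : ∀ x, 0 ≤ B x x := fun x => by
    rw [hB, ← two_mul_eq_dotProduct]
    have := hq.nonneg x
    omega
  set u : Fin m → Fin m → ℤ := fun i => Q.adjugate.mulVec (Pi.single i 1)
  have hu : ∀ i x, B x (u i) = Q.det * x i := fun i x => by
    rw [hB, Matrix.mulVec_mulVec, Matrix.mul_adjugate, Matrix.smul_mulVec, Matrix.one_mulVec,
      dotProduct_smul, dotProduct_single, mul_one, smul_eq_mul]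
  have hsymm : ∀ x y, B x y = B y x := fun x y => QuadraticMap.polar_comm _ _ _
  set M : Fin m → ℤ := fun i => 2 * n * B (u i) (u i)
  have hbound : ∀ x ∈ RepNum q n, ∀ i, x i ∈ Set.Icc (-|M i|) |M i| := by
    intro x hx i
    have h1 := LinearMap.BilinForm.apply_mul_apply_le_of_forall_zero_le B hBpos x (u i)
    have h2 : B x x = 2 * n := by
      rw [hB, ← two_mul_eq_dotProduct, show q x = n from hx]
    rw [hsymm (u i) x, hu, h2] at h1
    have h3 : (x i) ^ 2 ≤ |M i| := by
      have h4 : 1 ≤ Q.det ^ 2 := by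
        have : 0 < Q.det ^ 2 := by positivity
        omega
      calc (x i) ^ 2 ≤ Q.det ^ 2 * (x i) ^ 2 := le_mul_of_one_le_left (sq_nonneg _) h4
        _ = Q.det * x i * (Q.det * x i) := by ring
        _ ≤ M i := h1
        _ ≤ |M i| := le_abs_self _
    have h5 : |x i| ≤ (x i) ^ 2 := by
      rw [← sq_abs]
      rcases (abs_nonneg (x i)).eq_or_lt with h | h
      · rw [← h]; simp
      · nlinarith
    exact abs_le.1 (h5.trans h3)
  refine (Set.Finite.pi (t := fun i => Set.Icc (-|M i|) |M i|) fun i => Set.finite_Icc _ _).subset ?_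
  exact fun x hx i _ => hbound x hx i

theorem finite_rep {q : Form m} (hq : q.PosDef) (q' : Form m) : (Rep q q').Finite := by
  refine Set.Finite.of_injOn (f := fun A : Matrix (Fin m) (Fin m) ℤ => fun j => A.mulVec (Pi.single j 1))
    (t := Set.univ.pi fun j => RepNum q (q' (Pi.single j 1))) ?_ ?_
    (Set.Finite.pi fun j => finite_repNum hq _)
  · intro A hA j _
    exact mem_rep_iff.1 hA _
  · intro A _ A' _ h
    ext i j
    have := congrFun (congrFun h j) i
    simpa using this

theorem finite_primRep {q : Form m} (hq : q.PosDef) (q' : Form m) : (PrimRep q q').Finite :=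
  (finite_rep hq q').subset fun _ h => h.1

theorem formUnits_ncard_pos {q : Form m} (hq : q.PosDef) : 0 < (formUnits q).ncard := by
  rw [Set.ncard_pos ((finite_rep hq q).subset fun _ h => h.1)]
  exact ⟨1, mem_rep_iff.2 fun x => by rw [Matrix.one_mulVec], by simp⟩

theorem exists_eq_smul_of_dvd {c : ℤ} (hc : c ≠ 0) (f : Form m) (h : ∀ x, c ∣ f x) :
    ∃ g : Form m, f = c • g := by
  choose g hg using h
  have hpol : ∀ x y, QuadraticMap.polar f x y = c * QuadraticMap.polar g x y := fun x y => by
    simp only [QuadraticMap.polar, hg]; ring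
  refine ⟨QuadraticMap.ofPolar g (fun a x => mul_left_cancel₀ hc ?_)
    (fun x x' y => mul_left_cancel₀ hc ?_) (fun a x y => mul_left_cancel₀ hc ?_),
    QuadraticMap.ext hg⟩
  · rw [← hg, QuadraticMap.map_smul, hg, smul_eq_mul, smul_eq_mul]; ring
  · rw [← hpol, QuadraticMap.polar_add_left, mul_add, ← hpol, ← hpol]
  · rw [← hpol, QuadraticMap.polar_smul_left, smul_eq_mul, smul_eq_mul, hpol]; ring

end Forms

/-! ### Lattices spanned by the columns of a matrix -/

section Matrices

variable {m : ℕ}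

/-- The lattice spanned by the columns of a matrix. -/
def colLattice (A : Matrix (Fin m) (Fin m) ℤ) : AddSubgroup (Fin m → ℤ) :=
  A.mulVecLin.toAddMonoidHom.range

theorem mem_colLattice {A : Matrix (Fin m) (Fin m) ℤ} {y : Fin m → ℤ} :
    y ∈ colLattice A ↔ ∃ x, A.mulVec x = y := Iff.rfl

theorem mulVec_injective_of_det_ne_zero {A : Matrix (Fin m) (Fin m) ℤ} (hA : A.det ≠ 0) :
    Function.Injective A.mulVec := fun x y h => by
  by_contra hne
  exact hA (Matrix.exists_mulVec_eq_zero_iff.1 ⟨x - y, sub_ne_zero.2 hne, by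
    rw [Matrix.mulVec_sub, h, sub_self]⟩)

theorem mul_left_cancel_of_det_ne_zero {A : Matrix (Fin m) (Fin m) ℤ} (hA : A.det ≠ 0)
    {B C : Matrix (Fin m) (Fin m) ℤ} (h : A * B = A * C) : B = C := by
  have h1 := congrArg (A.adjugate * ·) h
  simp only [← Matrix.mul_assoc, Matrix.adjugate_mul, Matrix.smul_mul, Matrix.one_mul] at h1
  exact smul_right_injective _ hA h1

theorem mul_right_cancel_of_det_ne_zero {A : Matrix (Fin m) (Fin m) ℤ} (hA : A.det ≠ 0)
    {B C : Matrix (Fin m) (Fin m) ℤ} (h : B * A = C * A) : B = C := by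
  have h1 := congrArg (· * A.adjugate) h
  simp only [Matrix.mul_assoc, Matrix.mul_adjugate, Matrix.mul_smul, Matrix.mul_one] at h1
  exact smul_right_injective _ hA h1

theorem index_colLattice {A : Matrix (Fin m) (Fin m) ℤ} (hA : A.det ≠ 0) :
    (colLattice A).index = A.det.natAbs := by
  let e := (A.mulVecLin.toAddMonoidHom.ofInjective (mulVec_injective_of_det_ne_zero hA))
  have h := AddSubgroup.index_eq_natAbs_det (Pi.basisFun ℤ (Fin m)) (colLattice A)
    ((Pi.basisFun ℤ (Fin m)).map e.toIntLinearEquiv)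
  rw [h, Pi.basisFun_det_apply, ← Matrix.det_transpose]
  congr 2
  ext i j
  change A.mulVec (Pi.basisFun ℤ (Fin m) j) i = A i j
  simp

theorem exists_colLattice_eq {K : AddSubgroup (Fin m → ℤ)} (hK : K.index ≠ 0) :
    ∃ A : Matrix (Fin m) (Fin m) ℤ, colLattice A = K ∧ A.det.natAbs = K.index := by
  obtain ⟨e⟩ := Int.addSubgroup_index_ne_zero_iff.1 hK
  set f : (Fin m → ℤ) →ₗ[ℤ] (Fin m → ℤ) := (K.subtype.comp e.symm.toAddMonoidHom).toIntLinearMap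
  have hf : ∀ x, f.toMatrix'.mulVec x = e.symm x := fun x => by
    rw [LinearMap.toMatrix'_mulVec]; rfl
  have h1 : colLattice f.toMatrix' = K := by
    ext y
    rw [mem_colLattice]
    constructor
    · rintro ⟨x, rfl⟩
      rw [hf]
      exact (e.symm x).2
    · intro hy
      exact ⟨e ⟨y, hy⟩, by rw [hf, e.symm_apply_apply]⟩
  refine ⟨f.toMatrix', h1, ?_⟩
  rw [← index_colLattice, h1]
  intro h0
  obtain ⟨v, hv, hv0⟩ := Matrix.exists_mulVec_eq_zero_iff.2 h0
  rw [hf] at hv0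
  refine hv (e.symm.injective (Subtype.ext ?_))
  rw [hv0, map_zero]; rfl

theorem colLattice_le_iff {A B : Matrix (Fin m) (Fin m) ℤ} :
    colLattice B ≤ colLattice A ↔ ∃ C, B = A * C := by
  constructor
  · intro h
    choose c hc using fun j => mem_colLattice.1 (h (mem_colLattice.2 ⟨Pi.single j 1, rfl⟩))
    refine ⟨Matrix.of fun i j => c j i, ?_⟩
    ext i j
    have := congrFun (hc j) i
    rw [Matrix.mulVec_single_one] at this
    exact this.symm
  · rintro ⟨C, rfl⟩ _ ⟨x, rfl⟩
    exact ⟨C.mulVec x, Matrix.mulVec_mulVec x A C⟩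

theorem exists_eq_mul_of_colLattice_eq {A B : Matrix (Fin m) (Fin m) ℤ} (hA : A.det ≠ 0)
    (h : colLattice A = colLattice B) : ∃ U, IsUnit U.det ∧ B = A * U := by
  obtain ⟨U, hU⟩ := colLattice_le_iff.1 h.ge
  obtain ⟨V, hV⟩ := colLattice_le_iff.1 h.le
  refine ⟨U, ?_, hU⟩
  have h1 : U * V = 1 := mul_left_cancel_of_det_ne_zero hA (by
    rw [← Matrix.mul_assoc, ← hU, ← hV, Matrix.mul_one])
  exact IsUnit.of_mul_eq_one V.det (by rw [← Matrix.det_mul, h1, Matrix.det_one])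

theorem colLattice_mul_of_isUnit {A U : Matrix (Fin m) (Fin m) ℤ} (hU : IsUnit U.det) :
    colLattice (A * U) = colLattice A := by
  refine le_antisymm (colLattice_le_iff.2 ⟨U, rfl⟩) (colLattice_le_iff.2 ⟨U⁻¹, ?_⟩)
  rw [Matrix.mul_assoc, Matrix.mul_nonsing_inv U hU, Matrix.mul_one]

/-- A prime dividing all entries divides the determinant `± c^m`, provided there is at least one
row. -/
theorem isPrimitive_iff (hm : m ≠ 0) {c : ℕ} {A : Matrix (Fin m) (Fin m) ℤ}
    (hA : A.det.natAbs = c ^ m) : (∀ d : ℤ, (∀ i j, d ∣ A i j) → IsUnit d) ↔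
      ∀ l : ℕ, l.Prime → l ∣ c → ∃ i j, ¬ (l : ℤ) ∣ A i j := by
  constructor
  · intro h l hl _
    by_contra! hd
    exact (Nat.prime_iff_prime_int.1 hl).not_isUnit (h l hd)
  · intro h d hd
    by_contra hu
    obtain ⟨l, hl, hld⟩ := Nat.exists_prime_and_dvd (fun h1 => hu (Int.isUnit_iff_natAbs_eq.2 h1))
    have hl' : (l : ℤ) ∣ d := Int.natCast_dvd.2 hld
    have hdet : (l : ℤ) ∣ A.det := by
      obtain ⟨i₀⟩ : Nonempty (Fin m) := ⟨⟨0, Nat.pos_of_ne_zero hm⟩⟩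
      rw [Matrix.det_apply]
      refine Finset.dvd_sum fun σ _ => ?_
      rw [Units.smul_def, smul_eq_mul]
      exact ((hl'.trans (hd _ i₀)).trans
      (Finset.dvd_prod_of_mem (fun i => A (σ i) i) (Finset.mem_univ i₀))).mul_left _
    have h1 : l ∣ c ^ m := by rw [← hA]; exact Int.natCast_dvd.1 hdet
    obtain ⟨i, j, hij⟩ := h l hl (hl.dvd_of_dvd_pow h1)
    exact hij (hl'.trans (hd i j))

theorem exists_mem_colLattice_not_dvd_iff {A : Matrix (Fin m) (Fin m) ℤ} {l : ℤ} :
    (∃ x ∈ colLattice A, ∃ i, ¬ l ∣ x i) ↔ ∃ i j, ¬ l ∣ A i j := by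
  constructor
  · rintro ⟨_, ⟨x, rfl⟩, i, hi⟩
    by_contra! h
    exact hi (show l ∣ ∑ j, A i j * x j from Finset.dvd_sum fun j _ => (h i j).mul_right _)
  · rintro ⟨i, j, hij⟩
    refine ⟨A.mulVec (Pi.single j 1), ⟨_, rfl⟩, i, ?_⟩
    rw [Matrix.mulVec_single_one]
    exact hij

end Matrices

end ReprZeta

namespace ReprZeta

/-! ### Neighbours and primitive representations -/

section Neighbours

variable {m : ℕ}

theorem det_ne_zero_of_natAbs_eq {A : Matrix (Fin m) (Fin m) ℤ} {c : ℕ} (hc : c ≠ 0)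
    (h : A.det.natAbs = c ^ m) : A.det ≠ 0 := by
  intro h0
  rw [h0, Int.natAbs_zero] at h
  exact pow_ne_zero _ hc h.symm

theorem mem_primRep_mul_of_isUnit {q g : Form m} {B U : Matrix (Fin m) (Fin m) ℤ}
    (hB : B ∈ PrimRep q g) (hU : IsUnit U.det) : B * U ∈ PrimRep q (subst g U) := by
  refine ⟨mem_rep_iff.2 fun x => ?_, fun d hd => hB.2 d fun i j => ?_⟩
  · rw [← Matrix.mulVec_mulVec, mem_rep_iff.1 hB.1]; rfl
  · have : B = B * U * U⁻¹ := by rw [Matrix.mul_assoc, Matrix.mul_nonsing_inv U hU, Matrix.mul_one]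
    rw [this, Matrix.mul_apply]
    exact Finset.dvd_sum fun l _ => (hd i l).mul_right _

/-- Matrices with the same column lattice differ on the right by a unimodular matrix, which here
must preserve `g`. -/
theorem ncard_primRep_colLattice_eq {q g : Form m} {c : ℤ} (hc : c ≠ 0)
    {B₀ : Matrix (Fin m) (Fin m) ℤ} (hdet : B₀.det ≠ 0) (hB₀ : B₀ ∈ PrimRep q (c • g)) :
    {B | B ∈ PrimRep q (c • g) ∧ colLattice B = colLattice B₀}.ncard = (formUnits g).ncard := by
  have himg : {B | B ∈ PrimRep q (c • g) ∧ colLattice B = colLattice B₀} =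
      (B₀ * ·) '' formUnits g := by
    ext B
    constructor
    · rintro ⟨hB, h⟩
      obtain ⟨U, hU, rfl⟩ := exists_eq_mul_of_colLattice_eq hdet h.symm
      refine ⟨U, ⟨mem_rep_iff.2 fun x => mul_left_cancel₀ hc ?_, hU⟩, rfl⟩
      rw [← mem_rep_smul_iff.1 hB.1 x, ← Matrix.mulVec_mulVec, mem_rep_smul_iff.1 hB₀.1]
    · rintro ⟨U, ⟨hU, hu⟩, rfl⟩
      refine ⟨?_, colLattice_mul_of_isUnit hu⟩
      have h := mem_primRep_mul_of_isUnit hB₀ hu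
      have h2 : subst (c • g) U = c • g := by
        refine QuadraticMap.ext fun x => ?_
        change c • g (U.mulVec x) = c • g x
        rw [mem_rep_iff.1 hU]
      rwa [h2] at h
  rw [himg, Set.ncard_image_of_injective _ fun U V h => mul_left_cancel_of_det_ne_zero hdet h]

theorem equivalent_of_colLattice_eq {q g g' : Form m} {c : ℤ} (hc : c ≠ 0)
    {A B : Matrix (Fin m) (Fin m) ℤ} (hdet : A.det ≠ 0) (hA : A ∈ Rep q (c • g))
    (hB : B ∈ Rep q (c • g')) (h : colLattice A = colLattice B) : Equivalent g g' := by
  obtain ⟨U, hU, rfl⟩ := exists_eq_mul_of_colLattice_eq hdet h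
  refine ⟨U, hU, QuadraticMap.ext fun x => mul_left_cancel₀ hc ?_⟩
  change c * g' x = c * g (U.mulVec x)
  rw [← mem_rep_smul_iff.1 hB, ← Matrix.mulVec_mulVec, mem_rep_smul_iff.1 hA]

variable {p : ℕ} [hp : Fact p.Prime]

theorem primRep_iff_mem_nbrs (hm : m ≠ 0) {q g : Form m} {A : Matrix (Fin m) (Fin m) ℤ}
    (hA : A ∈ Rep q (((p : ℤ) ^ 2) • g)) (hdet : A.det.natAbs = p ^ m) :
    A ∈ PrimRep q (((p : ℤ) ^ 2) • g) ↔ colLattice A ∈ nbrs q p := by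
  have hpp := hp.out
  have hiff : (∀ d : ℤ, (∀ i j, d ∣ A i j) → IsUnit d) ↔
      ∃ x ∈ colLattice A, ∃ i, ¬ (p : ℤ) ∣ x i := by
    rw [isPrimitive_iff hm hdet, exists_mem_colLattice_not_dvd_iff]
    constructor
    · exact fun h => h p hpp dvd_rfl
    · intro h l hl hlp
      rwa [(Nat.prime_dvd_prime_iff_eq hl hpp).1 hlp]
  constructor
  · rintro ⟨-, h⟩
    refine ⟨by rw [index_colLattice (det_ne_zero_of_natAbs_eq hpp.ne_zero hdet), hdet], ?_,
      hiff.1 h⟩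
    rintro _ ⟨x, rfl⟩
    exact ⟨g x, mem_rep_smul_iff.1 hA x⟩
  · rintro ⟨-, -, h⟩
    exact ⟨hA, hiff.2 h⟩

theorem similar_refl (q : Form m) : Similar q q :=
  ⟨rfl, 1, isCoprime_one_left, 1, mem_rep_smul_iff.2 fun x => by
    rw [Matrix.one_mulVec, one_mul]⟩

/-- Let the columns of `A` be a basis of `K` and divide `q₀[A]` by `p²`. The index `p^m` keeps the
determinant unchanged, and the similarity multiplier becomes `b p²`, still prime to `det q`. -/
theorem exists_rep_of_mem_nbrs {q q₀ : Form m} (h₀ : Similar q q₀)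
    (hpq : ¬ (p : ℤ) ∣ formDet q) {K : AddSubgroup (Fin m → ℤ)} (hK : K ∈ nbrs q₀ p) :
    ∃ (g : Form m) (A : Matrix (Fin m) (Fin m) ℤ), Similar q g ∧ A ∈ Rep q₀ (((p : ℤ) ^ 2) • g) ∧
      colLattice A = K ∧ A.det.natAbs = p ^ m := by
  have hpp := hp.out
  have hp0 : ((p : ℤ) ^ 2) ≠ 0 := pow_ne_zero _ (by exact_mod_cast hpp.ne_zero)
  obtain ⟨hi, hd, -⟩ := hK
  obtain ⟨A, hA, hdet⟩ := exists_colLattice_eq (K := K) (by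
    rw [hi]; exact pow_ne_zero _ hpp.ne_zero)
  obtain ⟨g, hg⟩ := exists_eq_smul_of_dvd hp0 (subst q₀ A) fun x =>
    hd _ (hA ▸ mem_colLattice.2 ⟨x, rfl⟩)
  have hAg : A ∈ Rep q₀ (((p : ℤ) ^ 2) • g) := hg
  rw [hi] at hdet
  refine ⟨g, A, ⟨?_, ?_⟩, hAg, hA, hdet⟩
  · have h1 := det_sq_mul_formDet hAg
    have h2 : A.det ^ 2 = ((p : ℤ) ^ 2) ^ m := by
      rw [← Int.natAbs_sq, hdet, Nat.cast_pow, ← pow_mul, ← pow_mul, mul_comm]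
    rw [h2] at h1
    rw [← mul_left_cancel₀ (pow_ne_zero _ hp0) h1, h₀.1]
  · obtain ⟨-, b, hb, B, hB⟩ := h₀
    refine ⟨b * (p : ℤ) ^ 2, hb.mul_left (IsCoprime.pow_left ?_), B * A, mem_rep_smul_iff.2 fun x => ?_⟩
    · exact (Nat.prime_iff_prime_int.1 hpp).irreducible.coprime_iff_not_dvd.2 hpq
    · rw [← Matrix.mulVec_mulVec, mem_rep_smul_iff.1 hB, mem_rep_smul_iff.1 hAg, mul_assoc]

end Neighbours

/-! ### The classes of the neighbours of a form -/

section Classes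

variable {k : ℕ} {q q₀ : Form (2 * k + 1)} {h : ℕ} {qs : Fin h → Form (2 * k + 1)}
  {p : ℕ} [hp : Fact p.Prime]

/-- A neighbour carries a form in exactly one class `l`, and its bases adapted to `q_l` number
`e(q_l)`: every neighbour has total weight `1`. -/
theorem sum_ncard_primRep_colLattice_eq (hq : q.PosDef) (h₀ : Similar q q₀)
    (hqs : IsCompleteSystem q qs) (hpq : ¬ (p : ℤ) ∣ formDet q)
    {K : AddSubgroup (Fin (2 * k + 1) → ℤ)} (hK : K ∈ nbrs q₀ p) :
    ∑ l, ({B | B ∈ PrimRep q₀ (((p : ℤ) ^ 2) • qs l) ∧ colLattice B = K}.ncard : ℚ) /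
      (formUnits (qs l)).ncard = 1 := by
  have hp0 : ((p : ℤ) ^ 2) ≠ 0 := pow_ne_zero _ (by exact_mod_cast hp.out.ne_zero)
  obtain ⟨g, A, hg, hA, rfl, hdet⟩ := exists_rep_of_mem_nbrs h₀ hpq hK
  have hdet0 := det_ne_zero_of_natAbs_eq hp.out.ne_zero hdet
  obtain ⟨l, ⟨U, hU, hUg⟩, huniq⟩ := hqs.2 g hg
  have hAU : A * U⁻¹ ∈ PrimRep q₀ (((p : ℤ) ^ 2) • qs l) := by
    have h1 := mem_primRep_mul_of_isUnit ((primRep_iff_mem_nbrs (by omega) hA hdet).2 hK)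
      (U := U⁻¹) (Matrix.isUnit_nonsing_inv_det U hU)
    have h2 : subst (((p : ℤ) ^ 2) • g) U⁻¹ = ((p : ℤ) ^ 2) • qs l := by
      refine QuadraticMap.ext fun x => ?_
      rw [hUg]
      change ((p : ℤ) ^ 2) • qs l (U.mulVec (U⁻¹.mulVec x)) = ((p : ℤ) ^ 2) • qs l x
      rw [Matrix.mulVec_mulVec, Matrix.mul_nonsing_inv U hU, Matrix.one_mulVec]
    rwa [h2] at h1
  have hcol : colLattice (A * U⁻¹) = colLattice A :=
    colLattice_mul_of_isUnit (Matrix.isUnit_nonsing_inv_det U hU)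
  have hdet' : (A * U⁻¹).det ≠ 0 := by
    rw [Matrix.det_mul]
    exact mul_ne_zero hdet0 (Matrix.isUnit_nonsing_inv_det U hU).ne_zero
  rw [Finset.sum_eq_single l]
  · rw [← hcol, ncard_primRep_colLattice_eq hp0 hdet' hAU, div_self]
    exact_mod_cast (formUnits_ncard_pos (posDef_of_similar hq (hqs.1 l))).ne'
  · intro j _ hj
    rw [(_ : {B | B ∈ PrimRep q₀ (((p : ℤ) ^ 2) • qs j) ∧ colLattice B = colLattice A} = ∅),
      Set.ncard_empty, Nat.cast_zero, zero_div]
    refine Set.eq_empty_of_forall_notMem fun B hB => hj (huniq j ?_)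
    refine equivalent_of_colLattice_eq hp0 ?_ hB.1.1 hA hB.2
    refine det_ne_zero_of_natAbs_eq hp.out.ne_zero (natAbs_det_of_mem_rep ?_ ?_ hB.1.1)
    · rw [h₀.1]; exact formDet_ne_zero hq
    · rw [(hqs.1 j).1, h₀.1]
  · simp

theorem sum_primRep_eq_sum_nbrs (hq : q.PosDef) (h₀ : Similar q q₀)
    (hqs : IsCompleteSystem q qs) (hpq : ¬ (p : ℤ) ∣ formDet q) (F : Fin h → ℚ)
    (F' : AddSubgroup (Fin (2 * k + 1) → ℤ) → ℚ)
    (hF : ∀ l, ∀ B ∈ PrimRep q₀ (((p : ℤ) ^ 2) • qs l), F l = F' (colLattice B)) :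
    ∑ l, ((PrimRep q₀ (((p : ℤ) ^ 2) • qs l)).ncard : ℚ) / (formUnits (qs l)).ncard * F l =
      ∑ᶠ K ∈ nbrs q₀ p, F' K := by
  classical
  have hpq₀ : ¬ (p : ℤ) ∣ formDet q₀ := by rwa [h₀.1]
  have hfin := finite_nbrs hpq₀
  have hPR := fun l => finite_primRep (posDef_of_similar hq h₀) (((p : ℤ) ^ 2) • qs l)
  rw [finsum_mem_eq_finite_toFinset_sum _ hfin]
  have h1 : ∀ l, ((PrimRep q₀ (((p : ℤ) ^ 2) • qs l)).ncard : ℚ) * F l =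
      ∑ K ∈ hfin.toFinset,
        ({B | B ∈ PrimRep q₀ (((p : ℤ) ^ 2) • qs l) ∧ colLattice B = K}.ncard : ℚ) * F' K := by
    intro l
    rw [Set.ncard_eq_toFinset_card _ (hPR l), ← nsmul_eq_mul, ← Finset.sum_const,
      ← Finset.sum_fiberwise_of_maps_to (t := hfin.toFinset) (g := colLattice)]
    · refine Finset.sum_congr rfl fun K _ => ?_
      rw [Finset.sum_congr rfl (g := fun _ => F' K), Finset.sum_const, nsmul_eq_mul,
        ← Set.ncard_coe_finset]
      · congr 3
        ext B
        simp
      · intro B hB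
        rw [Finset.mem_filter, Set.Finite.mem_toFinset] at hB
        rw [hF l B hB.1, hB.2]
    · intro B hB
      rw [Set.Finite.mem_toFinset] at hB ⊢
      refine (primRep_iff_mem_nbrs (by omega) hB.1 (natAbs_det_of_mem_rep ?_ ?_ hB.1)).1 hB
      · rw [h₀.1]; exact formDet_ne_zero hq
      · rw [(hqs.1 l).1, h₀.1]
  calc _ = ∑ l, ∑ K ∈ hfin.toFinset,
        ({B | B ∈ PrimRep q₀ (((p : ℤ) ^ 2) • qs l) ∧ colLattice B = K}.ncard : ℚ) /
          (formUnits (qs l)).ncard * F' K := by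
        refine Finset.sum_congr rfl fun l _ => ?_
        rw [div_mul_eq_mul_div, h1, Finset.sum_div]
        exact Finset.sum_congr rfl fun K _ => by ring
    _ = _ := by
        rw [Finset.sum_comm]
        refine Finset.sum_congr rfl fun K hK => ?_
        rw [← Finset.sum_mul, sum_ncard_primRep_colLattice_eq hq h₀ hqs hpq
          ((Set.Finite.mem_toFinset _).1 hK), one_mul]

end Classes

end ReprZeta

namespace ReprZeta

/-! ### Vectors in neighbours -/

section Counting

variable {m : ℕ} {p : ℕ} [hp : Fact p.Prime]

/-- `G` takes its generic value `a` except possibly at multiples `px`, and there `q x = n`; only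
these contribute a correction. -/
theorem sum_repNum_sq_mul {q : Form m} (hq : q.PosDef) (n : ℤ) (G : (Fin m → ℤ) → ℚ) (a : ℚ)
    (hG : ∀ y ∈ RepNum q ((p : ℤ) ^ 2 * n), (∃ i, ¬ (p : ℤ) ∣ y i) → G y = a) :
    ∑ᶠ y ∈ RepNum q ((p : ℤ) ^ 2 * n), G y =
      a * (RepNum q ((p : ℤ) ^ 2 * n)).ncard + ∑ᶠ x ∈ RepNum q n, (G ((p : ℤ) • x) - a) := by
  classical
  have hp0 : (p : ℤ) ≠ 0 := by exact_mod_cast hp.out.ne_zero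
  rw [finsum_mem_eq_finite_toFinset_sum _ (finite_repNum hq _),
    finsum_mem_eq_finite_toFinset_sum _ (finite_repNum hq n),
    Set.ncard_eq_toFinset_card _ (finite_repNum hq _), mul_comm a _, ← nsmul_eq_mul,
    ← Finset.sum_const, ← sub_eq_iff_eq_add', ← Finset.sum_sub_distrib,
    ← Finset.sum_image (f := fun y => G y - a) (g := fun x : Fin m → ℤ => (p : ℤ) • x)
      fun x _ y _ h => smul_right_injective _ hp0 h]
  refine (Finset.sum_subset ?_ ?_).symm
  · intro y hy
    obtain ⟨x, hx, rfl⟩ := Finset.mem_image.1 hy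
    rw [Set.Finite.mem_toFinset] at hx ⊢
    change q _ = _
    rw [QuadraticMap.map_smul, show q x = n from hx, smul_eq_mul, sq]
  · intro y hy hy'
    rw [Set.Finite.mem_toFinset] at hy
    refine sub_eq_zero.2 (hG y hy ?_)
    by_contra! h
    choose x hx using h
    have hxy : y = (p : ℤ) • x := funext hx
    refine hy' (Finset.mem_image.2 ⟨x, (Set.Finite.mem_toFinset _).2 ?_, hxy.symm⟩)
    have h1 : q y = _ := hy
    rw [hxy, QuadraticMap.map_smul, smul_eq_mul, ← sq] at h1
    exact mul_left_cancel₀ (pow_ne_zero 2 hp0) h1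

theorem finsum_repNum_const {q : Form m} (hq : q.PosDef) (n : ℤ) (G : (Fin m → ℤ) → ℚ) (a : ℚ)
    (hG : ∀ x ∈ RepNum q n, G x = a) : ∑ᶠ x ∈ RepNum q n, G x = a * (RepNum q n).ncard := by
  rw [finsum_mem_congr rfl hG, finsum_mem_eq_finite_toFinset_sum _ (finite_repNum hq n),
    Finset.sum_const, nsmul_eq_mul, mul_comm, Set.ncard_eq_toFinset_card _ (finite_repNum hq n)]

/-- The number of vectors `x` with `q₀ x = n` in a lattice, summed over the neighbours of `q₀`. -/
theorem sum_nbrs_ncard_eq {k : ℕ} {q₀ : Form (2 * k + 1)} (hq₀ : q₀.PosDef) (hpq : ¬ (p : ℤ) ∣ formDet q₀) (n : ℤ) :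
    ∑ᶠ K ∈ nbrs q₀ p, ({y | y ∈ RepNum q₀ n ∧ y ∈ K}.ncard : ℚ) =
      ∑ᶠ y ∈ RepNum q₀ n, ({K : AddSubgroup (Fin (2 * k + 1) → ℤ) | K ∈ nbrs q₀ p ∧ y ∈ K}.ncard : ℚ) := by
  classical
  have hfin := finite_nbrs hpq
  have hY := finite_repNum hq₀ n
  rw [finsum_mem_eq_finite_toFinset_sum _ hfin, finsum_mem_eq_finite_toFinset_sum _ hY]
  have h := Finset.sum_card_bipartiteAbove_eq_sum_card_bipartiteBelow
    (s := hfin.toFinset) (t := hY.toFinset)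
    (fun (K : AddSubgroup (Fin (2 * k + 1) → ℤ)) (y : Fin (2 * k + 1) → ℤ) => y ∈ K)
  have h1 : ∀ K, ({y | y ∈ RepNum q₀ n ∧ y ∈ K} : Set _).ncard =
      (hY.toFinset.bipartiteAbove (fun (K : AddSubgroup (Fin (2 * k + 1) → ℤ)) (y : Fin (2 * k + 1) → ℤ) => y ∈ K) K).card := fun K => by
    rw [← Set.ncard_coe_finset]
    congr 1
    ext y
    simp [Finset.bipartiteAbove]
  have h2 : ∀ y, ({K | K ∈ nbrs q₀ p ∧ y ∈ K} : Set _).ncard =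
      (hfin.toFinset.bipartiteBelow (fun (K : AddSubgroup (Fin (2 * k + 1) → ℤ)) (y : Fin (2 * k + 1) → ℤ) => y ∈ K) y).card := fun y => by
    rw [← Set.ncard_coe_finset]
    congr 1
    ext K
    simp [Finset.bipartiteBelow]
  simp only [h1, h2]
  exact_mod_cast h

end Counting

/-! ### The action of Eichler matrices on representation numbers -/

section Recurrences

variable {k : ℕ} {q q₀ : Form (2 * k + 1)} {h : ℕ} {qs : Fin h → Form (2 * k + 1)}
  {p : ℕ} [hp : Fact p.Prime]

/-- Multiplication by `B` identifies vectors with `q_l x = n` with vectors of `colLattice B` of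
`q₀`-value `p² n`; the sum over neighbours is then exchanged with the sum over vectors. -/
theorem sum_primRep_mul_repNum (hq : q.PosDef) (h₀ : Similar q q₀)
    (hqs : IsCompleteSystem q qs) (hpq : ¬ (p : ℤ) ∣ formDet q) (n : ℤ) :
    ∑ l, ((PrimRep q₀ (((p : ℤ) ^ 2) • qs l)).ncard : ℚ) * normRep (qs l) n =
      cConst k p * (RepNum q₀ ((p : ℤ) ^ 2 * n)).ncard +
        ∑ᶠ x ∈ RepNum q₀ n,
          (({K : AddSubgroup (Fin (2 * k + 1) → ℤ) | K ∈ nbrs q₀ p ∧ (p : ℤ) • x ∈ K}.ncard : ℚ) - cConst k p) := by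
  have hq₀ := posDef_of_similar hq h₀
  have hp0 : ((p : ℤ) ^ 2) ≠ 0 := pow_ne_zero _ (by exact_mod_cast hp.out.ne_zero)
  have hpq₀ : ¬ (p : ℤ) ∣ formDet q₀ := by rwa [h₀.1]
  have h1 := sum_primRep_eq_sum_nbrs hq h₀ hqs hpq (fun l => ((RepNum (qs l) n).ncard : ℚ))
    (fun K => ({y | y ∈ RepNum q₀ ((p : ℤ) ^ 2 * n) ∧ y ∈ K}.ncard : ℚ)) (by
      intro l B hB
      have hdet := natAbs_det_of_mem_rep (by rw [h₀.1]; exact formDet_ne_zero hq)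
        (by rw [(hqs.1 l).1, h₀.1]) hB.1
      rw [← Set.ncard_image_of_injective _ (mulVec_injective_of_det_ne_zero
        (det_ne_zero_of_natAbs_eq hp.out.ne_zero hdet))]
      congr 2
      ext y
      constructor
      · rintro ⟨x, hx, rfl⟩
        refine ⟨?_, x, rfl⟩
        change q₀ (B.mulVec x) = _
        rw [mem_rep_smul_iff.1 hB.1, show qs l x = n from hx]
      · rintro ⟨hy, x, rfl⟩
        refine ⟨x, mul_left_cancel₀ hp0 ?_, rfl⟩
        rw [← mem_rep_smul_iff.1 hB.1]
        exact hy)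
  rw [sum_nbrs_ncard_eq hq₀ hpq₀, sum_repNum_sq_mul hq₀ n _ (cConst k p)] at h1
  · rw [← h1]
    exact Finset.sum_congr rfl fun l _ => by rw [normRep]; ring
  · intro y hy hy'
    refine ncard_nbrs_mem_primitive (ne_two_of_not_dvd_formDet hpq) hpq₀ hy' ?_
    rw [show q₀ y = _ from hy]
    exact dvd_mul_right _ _

theorem eichlerMatrix_mulVec_repVec_apply (p : ℕ) (i : Fin h) (n : ℤ) :
    (eichlerMatrix qs p).mulVec (repVec qs n) i =
      (∑ l, ((PrimRep (qs i) (((p : ℤ) ^ 2) • qs l)).ncard : ℚ) * normRep (qs l) n) /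
        (formUnits (qs i)).ncard := by
  rw [Finset.sum_div, Matrix.mulVec, dotProduct]
  refine Finset.sum_congr rfl fun l _ => ?_
  rw [eichlerMatrix, Matrix.of_apply, normPrimRep, repVec]
  ring

theorem eichlerMatrix_mulVec_repVec_of_not_sq_dvd (hk : 1 ≤ k) (hq : q.PosDef)
    (hqs : IsCompleteSystem q qs) (hpq : ¬ (p : ℤ) ∣ formDet q) {n : ℤ} (hn : ¬ (p : ℤ) ^ 2 ∣ n) :
    (eichlerMatrix qs p).mulVec (repVec qs n) = cConst k p • repVec qs ((p : ℤ) ^ 2 * n) +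
      (betaConst k p + cConst k p * (legendreSym p ((-1) ^ k * formDet q) *
        legendreSym p (2 * n) * (p : ℚ) ^ (k - 1))) • repVec qs n := by
  ext i
  have hi := hqs.1 i
  have hpi : ¬ (p : ℤ) ∣ formDet (qs i) := by rwa [hi.1]
  rw [eichlerMatrix_mulVec_repVec_apply, sum_primRep_mul_repNum hq hi hqs hpq,
    finsum_repNum_const (posDef_of_similar hq hi) n _ (betaConst k p + cConst k p *
      (legendreSym p ((-1) ^ k * formDet q) * legendreSym p (2 * n) * (p : ℚ) ^ (k - 1)))]
  · simp only [Pi.add_apply, Pi.smul_apply, smul_eq_mul, repVec, normRep]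
    ring
  · intro x hx
    rw [ncard_nbrs_mem_smul (ne_two_of_not_dvd_formDet hpq) hk hpi, show qs i x = n from hx, hi.1]
    · ring
    -- A vector divisible by `p` has value divisible by `p²`, which `hn` excludes.
    · by_contra! hd
      choose y hy using hd
      have hxy : x = (p : ℤ) • y := funext hy
      apply hn
      rw [← show qs i x = n from hx, hxy, QuadraticMap.map_smul, smul_eq_mul, ← sq]
      exact dvd_mul_right _ _

/-- The vectors `x` of value `p² n` are split once more. If `p ∤ x` the Legendre symbol is zero, as
`p ∣ q x`, and the correction is `β_p`; if `x = px'` a further `c_p p^{2k-1}` appears. -/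
theorem eichlerMatrix_mulVec_repVec_sq_mul (hk : 1 ≤ k) (hq : q.PosDef)
    (hqs : IsCompleteSystem q qs) (hpq : ¬ (p : ℤ) ∣ formDet q) (n : ℤ) :
    (eichlerMatrix qs p).mulVec (repVec qs ((p : ℤ) ^ 2 * n)) =
      cConst k p • repVec qs ((p : ℤ) ^ 2 * ((p : ℤ) ^ 2 * n)) +
      betaConst k p • repVec qs ((p : ℤ) ^ 2 * n) +
      (cConst k p * (p : ℚ) ^ (2 * k - 1)) • repVec qs n := by
  ext i
  have hi := hqs.1 i
  have hpi : ¬ (p : ℤ) ∣ formDet (qs i) := by rwa [hi.1]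
  have hp2 := ne_two_of_not_dvd_formDet hpq
  rw [eichlerMatrix_mulVec_repVec_apply, sum_primRep_mul_repNum hq hi hqs hpq,
    sum_repNum_sq_mul (posDef_of_similar hq hi) n _ (betaConst k p),
    finsum_repNum_const (posDef_of_similar hq hi) n _ (cConst k p * (p : ℚ) ^ (2 * k - 1))]
  · simp only [Pi.add_apply, Pi.smul_apply, smul_eq_mul, repVec, normRep]
    ring
  · intro x _
    rw [ncard_nbrs_mem_sq_smul hp2 hk hpi]
    · ring
    · exact fun i => dvd_mul_right _ _
  · intro x hx hx'
    have h0 : legendreSym p (2 * qs i x) = 0 := by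
      rw [legendreSym.eq_zero_iff, ZMod.intCast_zmod_eq_zero_iff_dvd, show qs i x = _ from hx]
      exact (Dvd.intro _ (by ring : (p : ℤ) * (p * (2 * n)) = _))
    rw [ncard_nbrs_mem_smul hp2 hk hpi hx', h0]
    push_cast
    ring

end Recurrences

/-! ### Column sums of Eichler matrices -/

section Mean

variable {m : ℕ} {p : ℕ} [hp : Fact p.Prime]

theorem exists_mul_eq_smul_one {q₁ q₂ : Form m} (hp₁ : ¬ (p : ℤ) ∣ formDet q₁)
    (hd : formDet q₂ = formDet q₁) {D : Matrix (Fin m) (Fin m) ℤ}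
    (hD : D ∈ Rep q₁ (((p : ℤ) ^ 2) • q₂)) :
    ∃ E, D * E = ((p : ℤ) ^ 2) • (1 : Matrix (Fin m) (Fin m) ℤ) := by
  have h0 : formDet q₁ ≠ 0 := fun h => hp₁ (h ▸ dvd_zero _)
  have hdet := natAbs_det_of_mem_rep h0 hd hD
  have hdet0 := det_ne_zero_of_natAbs_eq hp.out.ne_zero hdet
  set M := (formMatrix q₂).adjugate * D.transpose * formMatrix q₁
  have hM : M * D = ((p : ℤ) ^ 2 * formDet q₂) • (1 : Matrix (Fin m) (Fin m) ℤ) := by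
    have h1 := formMatrix_of_mem_rep hD
    simp only [M, Matrix.mul_assoc] at h1 ⊢
    rw [h1, Matrix.mul_smul, Matrix.adjugate_mul, smul_smul]
    rfl
  have hM' : D * M = ((p : ℤ) ^ 2 * formDet q₂) • (1 : Matrix (Fin m) (Fin m) ℤ) := by
    refine mul_right_cancel_of_det_ne_zero hdet0 ?_
    rw [Matrix.mul_assoc, hM, Matrix.mul_smul, Matrix.smul_mul, Matrix.mul_one, Matrix.one_mul]
  have hcop : IsCoprime (formDet q₂) D.det := by
    rw [hd, ← IsCoprime.abs_right_iff, Int.abs_eq_natAbs, hdet, Nat.cast_pow]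
    exact (((Nat.prime_iff_prime_int.1 hp.out).irreducible.coprime_iff_not_dvd.2 hp₁).symm).pow_right
  obtain ⟨u, v, huv⟩ := hcop
  -- `D` divides `p² det q₂` through `M` and `det D = ± p^m` through its adjugate; since `det q₂`
  -- and `det D` are coprime, a Bézout combination gives exactly `p²`.
  refine ⟨u • M + (v * (p : ℤ) ^ 2) • D.adjugate, ?_⟩
  rw [Matrix.mul_add, Matrix.mul_smul, Matrix.mul_smul, hM', Matrix.mul_adjugate, smul_smul,
    smul_smul, ← add_smul]
  congr 1
  linear_combination (p : ℤ) ^ 2 * huv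

/-- The dual is `E = p² D⁻¹`. If `E = pF`, then `det E = ± p^m` makes `F` unimodular and `D = p
F⁻¹`, contradicting primitivity of `D`. -/
theorem exists_dual_mem_primRep (hm : m ≠ 0) {q₁ q₂ : Form m} (hp₁ : ¬ (p : ℤ) ∣ formDet q₁)
    (hd : formDet q₂ = formDet q₁) {D : Matrix (Fin m) (Fin m) ℤ}
    (hD : D ∈ PrimRep q₁ (((p : ℤ) ^ 2) • q₂)) :
    ∃ E ∈ PrimRep q₂ (((p : ℤ) ^ 2) • q₁),
      E * D = ((p : ℤ) ^ 2) • (1 : Matrix (Fin m) (Fin m) ℤ) := by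
  have hpp := hp.out
  have hpz : (p : ℤ) ≠ 0 := by exact_mod_cast hpp.ne_zero
  have hp0 : (p : ℤ) ^ 2 ≠ 0 := pow_ne_zero _ hpz
  have h0 : formDet q₁ ≠ 0 := fun h => hp₁ (h ▸ dvd_zero _)
  have hdet := natAbs_det_of_mem_rep h0 hd hD.1
  have hdet0 := det_ne_zero_of_natAbs_eq hpp.ne_zero hdet
  obtain ⟨E, hE⟩ := exists_mul_eq_smul_one hp₁ hd hD.1
  have hrep : E ∈ Rep q₂ (((p : ℤ) ^ 2) • q₁) := mem_rep_smul_iff.2 fun x => by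
    refine mul_left_cancel₀ hp0 ?_
    rw [← mem_rep_smul_iff.1 hD.1, Matrix.mulVec_mulVec, hE, Matrix.smul_mulVec, Matrix.one_mulVec,
      QuadraticMap.map_smul, smul_eq_mul, mul_assoc]
  have hdetE := natAbs_det_of_mem_rep (hd ▸ h0) hd.symm hrep
  refine ⟨E, ⟨hrep, (isPrimitive_iff hm hdetE).2 ?_⟩, ?_⟩
  · intro l hl hlp
    obtain rfl := (Nat.prime_dvd_prime_iff_eq hl hpp).1 hlp
    by_contra! hdvd
    choose F hF using hdvd
    obtain rfl : E = (l : ℤ) • Matrix.of F := by ext i j; exact hF i j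
    rw [Matrix.mul_smul, sq, mul_smul] at hE
    have h1 := smul_right_injective _ hpz hE
    rw [Matrix.det_smul, Fintype.card_fin, Int.natAbs_mul, Int.natAbs_pow, Int.natAbs_natCast,
      Nat.mul_eq_left (pow_ne_zero _ hpp.ne_zero), ← Int.isUnit_iff_natAbs_eq] at hdetE
    have h2 : D = (l : ℤ) • (Matrix.of F)⁻¹ := by
      rw [← Matrix.mul_nonsing_inv_cancel_right (Matrix.of F) D hdetE]
      change D * Matrix.of F * _ = _
      rw [h1, Matrix.smul_mul, Matrix.one_mul]
    refine (Nat.prime_iff_prime_int.1 hpp).not_isUnit (hD.2 l fun i j => ?_)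
    rw [h2]
    exact dvd_mul_right _ _
  · refine mul_left_cancel_of_det_ne_zero hdet0 ?_
    rw [← Matrix.mul_assoc, hE, Matrix.mul_smul, Matrix.smul_mul, Matrix.mul_one, Matrix.one_mul]

theorem ncard_primRep_le_swap (hm : m ≠ 0) {q₁ q₂ : Form m} (hp₁ : ¬ (p : ℤ) ∣ formDet q₁)
    (hq₂ : q₂.PosDef) (hd : formDet q₂ = formDet q₁) :
    (PrimRep q₁ (((p : ℤ) ^ 2) • q₂)).ncard ≤ (PrimRep q₂ (((p : ℤ) ^ 2) • q₁)).ncard := by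
  choose! f hf hfD using fun D hD => exists_dual_mem_primRep (p := p) hm hp₁ hd (D := D) hD
  refine Set.ncard_le_ncard_of_injOn f hf ?_ (finite_primRep hq₂ _)
  intro D hD D' hD' hDD'
  have h0 : formDet q₁ ≠ 0 := fun h => hp₁ (h ▸ dvd_zero _)
  have hdet := natAbs_det_of_mem_rep (hd ▸ h0) hd.symm (hf D hD).1
  refine mul_left_cancel_of_det_ne_zero (det_ne_zero_of_natAbs_eq hp.out.ne_zero hdet) ?_
  rw [hfD D hD, hDD', hfD D' hD']

theorem ncard_primRep_swap (hm : m ≠ 0) {q₁ q₂ : Form m} (hp₁ : ¬ (p : ℤ) ∣ formDet q₁)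
    (hq₁ : q₁.PosDef) (hq₂ : q₂.PosDef) (hd : formDet q₂ = formDet q₁) :
    (PrimRep q₁ (((p : ℤ) ^ 2) • q₂)).ncard = (PrimRep q₂ (((p : ℤ) ^ 2) • q₁)).ncard :=
  (ncard_primRep_le_swap hm hp₁ hq₂ hd).antisymm
    (ncard_primRep_le_swap hm (by rwa [hd]) hq₁ hd.symm)

/-- Duality exchanges the arguments of `r^*`, after which the sum is the weighted count of all
neighbours of `q₀`. These are counted as the neighbours containing `p • 0`. -/
theorem eichlerMean_eq {k : ℕ} (hk : 1 ≤ k) {q q₀ : Form (2 * k + 1)} {h : ℕ}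
    {qs : Fin h → Form (2 * k + 1)} (hq : q.PosDef) (h₀ : Similar q q₀)
    (hqs : IsCompleteSystem q qs) (hpq : ¬ (p : ℤ) ∣ formDet q) :
    eichlerMean q₀ qs p = cConst k p * (1 + (p : ℚ) ^ (2 * k - 1)) + betaConst k p := by
  have hpq₀ : ¬ (p : ℤ) ∣ formDet q₀ := by rwa [h₀.1]
  have h1 := sum_primRep_eq_sum_nbrs hq h₀ hqs hpq (fun _ => 1) (fun _ => 1) fun _ _ _ => rfl
  rw [← ncard_nbrs_mem_sq_smul (ne_two_of_not_dvd_formDet hpq) hk hpq₀ (x := 0)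
    fun _ => dvd_zero _, smul_zero, Set.ncard_eq_toFinset_card _ ((finite_nbrs hpq₀).subset
      fun _ h => h.1)]
  rw [finsum_mem_eq_finite_toFinset_sum _ (finite_nbrs hpq₀), Finset.sum_const, nsmul_eq_mul,
    mul_one] at h1
  convert h1 using 1
  · refine Finset.sum_congr rfl fun l _ => ?_
    rw [normPrimRep, mul_one, ncard_primRep_swap (by omega) (by rwa [(hqs.1 l).1])
      (posDef_of_similar hq (hqs.1 l)) (posDef_of_similar hq h₀) (by rw [(hqs.1 l).1, h₀.1])]
  · congr 2
    ext K
    simp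

/-- All column sums are equal, so the row vector of ones is a left eigenvector of the Eichler
matrix. -/
theorem eichlerMean_mul_repMean {k : ℕ} (hk : 1 ≤ k) {q : Form (2 * k + 1)} {h : ℕ}
    {qs : Fin h → Form (2 * k + 1)} (hq : q.PosDef)
    (hqs : IsCompleteSystem q qs) (hpq : ¬ (p : ℤ) ∣ formDet q) (n : ℤ) :
    eichlerMean q qs p * repMean qs n = ∑ i, (eichlerMatrix qs p).mulVec (repVec qs n) i := by
  simp only [Matrix.mulVec, dotProduct]
  rw [Finset.sum_comm, repMean, Finset.mul_sum]
  refine Finset.sum_congr rfl fun j _ => ?_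
  rw [← Finset.sum_mul, eichlerMean_eq hk hq (similar_refl q) hqs hpq,
    ← eichlerMean_eq hk hq (hqs.1 j) hqs hpq]
  rfl

end Mean

end ReprZeta

namespace ReprZeta

/-! ### Products of Eichler matrices -/

section Commutation

variable {m : ℕ} {p p' : ℕ} [hp : Fact p.Prime] [hp' : Fact p'.Prime]

/-- If `p` divided `B C`, multiplying by the adjugate of `C`, whose determinant is prime to `p`,
would make `p` divide `B`; symmetrically for `p'`. -/
theorem mul_mem_primRep (hm : m ≠ 0) {q₁ q₂ q₃ : Form m} {B C : Matrix (Fin m) (Fin m) ℤ}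
    (hB : B ∈ PrimRep q₁ (((p : ℤ) ^ 2) • q₂)) (hC : C ∈ PrimRep q₂ (((p' : ℤ) ^ 2) • q₃))
    (hpp' : p ≠ p') (hdB : B.det.natAbs = p ^ m) (hdC : C.det.natAbs = p' ^ m) :
    B * C ∈ PrimRep q₁ ((((p * p' : ℕ) : ℤ) ^ 2) • q₃) := by
  have hdisj : ∀ {r s : ℕ} (A : Matrix (Fin m) (Fin m) ℤ), r.Prime → s.Prime → r ≠ s →
      A.det.natAbs = s ^ m → IsCoprime (r : ℤ) A.det := by
    intro r s A hr hs hrs hA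
    rw [← IsCoprime.abs_right_iff, Int.abs_eq_natAbs, hA, Nat.isCoprime_iff_coprime]
    exact ((Nat.coprime_primes hr hs).2 hrs).pow_right _
  have hdet : (B * C).det.natAbs = (p * p') ^ m := by
    rw [Matrix.det_mul, Int.natAbs_mul, hdB, hdC, mul_pow]
  refine ⟨mem_rep_smul_iff.2 fun x => ?_, (isPrimitive_iff hm hdet).2 fun l hl hlp => ?_⟩
  · rw [← Matrix.mulVec_mulVec, mem_rep_smul_iff.1 hB.1, mem_rep_smul_iff.1 hC.1]
    push_cast
    ring
  · by_contra! hd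
    have hdvd : ∀ {r : ℕ} {M N : Matrix (Fin m) (Fin m) ℤ} {d : ℤ}, (∀ i j, (r : ℤ) ∣ M i j) →
        (M * N = d • B ∨ N * M = d • C) → IsCoprime (r : ℤ) d → r.Prime →
        (∀ i j, (r : ℤ) ∣ B i j) ∨ ∀ i j, (r : ℤ) ∣ C i j := by
      intro r M N d hM h hrd hr
      refine h.imp (fun h i j => hrd.dvd_of_dvd_mul_left ?_) fun h i j => hrd.dvd_of_dvd_mul_left ?_
      · rw [show d * B i j = (M * N) i j by rw [h]; rfl, Matrix.mul_apply]
        exact Finset.dvd_sum fun l _ => (hM i l).mul_right _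
      · rw [show d * C i j = (N * M) i j by rw [h]; rfl, Matrix.mul_apply]
        exact Finset.dvd_sum fun l _ => (hM l j).mul_left _
    have hcase : (∀ i j, (l : ℤ) ∣ B i j) ∨ ∀ i j, (l : ℤ) ∣ C i j := by
      rcases (Nat.Prime.dvd_mul hl).1 hlp with h | h
      · rw [Nat.prime_dvd_prime_iff_eq hl hp.out] at h
        refine hdvd (N := C.adjugate) (d := C.det) hd (Or.inl ?_) ?_ hl
        · rw [Matrix.mul_assoc, Matrix.mul_adjugate, Matrix.mul_smul, Matrix.mul_one]
        · exact hdisj C hl hp'.out (h ▸ hpp') hdC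
      · rw [Nat.prime_dvd_prime_iff_eq hl hp'.out] at h
        refine hdvd (N := B.adjugate) (d := B.det) hd (Or.inr ?_) ?_ hl
        · rw [← Matrix.mul_assoc, Matrix.adjugate_mul, Matrix.smul_mul, Matrix.one_mul]
        · exact hdisj B hl hp.out (h ▸ hpp'.symm) hdB
    rcases hcase with h | h
    · exact (Nat.prime_iff_prime_int.1 hl).not_isUnit (hB.2 _ h)
    · exact (Nat.prime_iff_prime_int.1 hl).not_isUnit (hC.2 _ h)

theorem image_mul_primRep (hm : m ≠ 0) {q₁ q₂ q₃ : Form m} (h₁ : formDet q₁ ≠ 0)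
    (h₂ : formDet q₂ = formDet q₁) (h₃ : formDet q₃ = formDet q₁)
    {B : Matrix (Fin m) (Fin m) ℤ} (hB : B ∈ PrimRep q₁ (((p : ℤ) ^ 2) • q₂)) (hpp' : p ≠ p') :
    (B * ·) '' PrimRep q₂ (((p' : ℤ) ^ 2) • q₃) =
      {D | D ∈ PrimRep q₁ ((((p * p' : ℕ) : ℤ) ^ 2) • q₃) ∧ colLattice D ≤ colLattice B} := by
  have hp0 : ((p : ℤ) ^ 2) ≠ 0 := pow_ne_zero _ (by exact_mod_cast hp.out.ne_zero)
  ext D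
  constructor
  · rintro ⟨C, hC, rfl⟩
    refine ⟨mul_mem_primRep hm hB hC hpp' (natAbs_det_of_mem_rep h₁ h₂ hB.1)
      (natAbs_det_of_mem_rep (h₂ ▸ h₁) (h₃.trans h₂.symm) hC.1), colLattice_le_iff.2 ⟨C, rfl⟩⟩
  · rintro ⟨hD, hle⟩
    obtain ⟨C, rfl⟩ := colLattice_le_iff.1 hle
    refine ⟨C, ⟨mem_rep_smul_iff.2 fun x => mul_left_cancel₀ hp0 ?_, fun d hd => hD.2 d ?_⟩, rfl⟩
    · rw [← mem_rep_smul_iff.1 hB.1, Matrix.mulVec_mulVec, mem_rep_smul_iff.1 hD.1]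
      push_cast
      ring
    · intro i j
      rw [Matrix.mul_apply]
      exact Finset.dvd_sum fun l _ => (hd l j).mul_left _

/-- The neighbour is the `p`-part `colLattice D + p^m ℤ^m`. Its index divides `p^m`, the index of
the `p'`-part divides `p'^m`, and the two parts meet inside `colLattice D`, of index `(pp')^m`;
hence equality. It is unique because any subgroup of index `p^m` contains `p^m ℤ^m`. -/
theorem existsUnique_nbrs_ge (hm : m ≠ 0) {q₁ q₃ : Form m} (h₁ : formDet q₁ ≠ 0)
    (h₃ : formDet q₃ = formDet q₁) (hpp' : p ≠ p') {D : Matrix (Fin m) (Fin m) ℤ}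
    (hD : D ∈ PrimRep q₁ ((((p * p' : ℕ) : ℤ) ^ 2) • q₃)) :
    ∃! K, K ∈ nbrs q₁ p ∧ colLattice D ≤ K := by
  have hpp := hp.out
  have hpp1 := hp'.out
  have hcop : Nat.Coprime p p' := (Nat.coprime_primes hpp hpp1).2 hpp'
  have hdet := natAbs_det_of_mem_rep h₁ h₃ hD.1
  have hc0 : p * p' ≠ 0 := mul_ne_zero hpp.ne_zero hpp1.ne_zero
  have hiD : (colLattice D).index = (p * p') ^ m := by
    rw [index_colLattice (det_ne_zero_of_natAbs_eq hc0 hdet), hdet]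
  set S : ℕ → AddSubgroup (Fin m → ℤ) := fun r => colLattice ((r : ℤ) ^ m • 1) with hS
  have hmemS : ∀ r x, x ∈ S r ↔ ∃ y, x = (r : ℤ) ^ m • y := fun r x => by
    rw [hS]
    refine exists_congr fun y => ?_
    change ((r : ℤ) ^ m • 1 : Matrix (Fin m) (Fin m) ℤ).mulVec y = x ↔ _
    rw [Matrix.smul_mulVec, Matrix.one_mulVec, eq_comm]
  have hiS : ∀ r : ℕ, r ≠ 0 → (S r).index = (r ^ m) ^ m := fun r hr => by
    have hd : ((r : ℤ) ^ m • 1 : Matrix (Fin m) (Fin m) ℤ).det.natAbs = (r ^ m) ^ m := by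
      rw [Matrix.det_smul, Matrix.det_one, mul_one, Fintype.card_fin, Int.natAbs_pow,
        Int.natAbs_pow, Int.natAbs_natCast]
    rw [hS]
    change (colLattice _).index = _
    rw [index_colLattice (det_ne_zero_of_natAbs_eq (pow_ne_zero _ hr) hd), hd]
  have hkill : ∀ x, ((p * p' : ℕ) : ℤ) ^ m • x ∈ colLattice D := fun x => by
    have h := AddSubgroup.nsmul_index_mem (colLattice D) x
    rw [hiD, ← natCast_zsmul] at h
    exact_mod_cast h
  have hmem : ∀ {r s : ℕ}, r * s = p * p' → ∀ x ∈ colLattice D ⊔ S r,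
      (s : ℤ) ^ m • x ∈ colLattice D := by
    intro r s hrs x hx
    obtain ⟨y, hy, z, hz, rfl⟩ := AddSubgroup.mem_sup.1 hx
    obtain ⟨w, rfl⟩ := (hmemS _ _).1 hz
    rw [smul_add, smul_smul, ← mul_pow]
    refine add_mem (AddSubgroup.zsmul_mem _ hy _) ?_
    have h := hkill w
    rwa [← hrs, Nat.cast_mul, mul_comm] at h
  have hidx : ∀ {r s : ℕ}, r.Prime → r.Coprime s → r * s = p * p' →
      (colLattice D ⊔ S r).index ∣ r ^ m := by
    intro r s hr hcop hrs
    have h1 : (colLattice D ⊔ S r).index ∣ r ^ m * s ^ m := by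
      rw [← mul_pow, hrs, ← hiD]
      exact AddSubgroup.index_dvd_of_le le_sup_left
    have h2 : (colLattice D ⊔ S r).index ∣ (r ^ m) ^ m := by
      rw [← hiS r hr.ne_zero]
      exact AddSubgroup.index_dvd_of_le le_sup_right
    refine Nat.Coprime.dvd_of_dvd_mul_right ?_ h1
    exact Nat.Coprime.coprime_dvd_left h2 (((hcop.pow_left m).pow_left m).pow_right m)
  set K := colLattice D ⊔ S p
  have hiK : K.index = p ^ m := by
    have h1 := hidx hpp hcop rfl
    have h2 := hidx hpp1 hcop.symm (mul_comm p' p)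
    have h3 : K ⊓ (colLattice D ⊔ S p') ≤ colLattice D := by
      rintro x ⟨hx, hx'⟩
      have h4 := hmem rfl x hx
      have h5 := hmem (mul_comm p' p) x hx'
      obtain ⟨u, v, huv⟩ := ((Nat.isCoprime_iff_coprime.2 hcop).pow_left (m := m)).pow_right (n := m)
      rw [← one_smul ℤ x, ← huv, add_smul, mul_smul, mul_smul]
      exact add_mem (AddSubgroup.zsmul_mem _ h5 _) (AddSubgroup.zsmul_mem _ h4 _)
    have h6 : p ^ m * p' ^ m ≤ K.index * (colLattice D ⊔ S p').index := by
      rw [← mul_pow, ← hiD]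
      refine (Nat.le_of_dvd ?_ (AddSubgroup.index_dvd_of_le h3)).trans
        AddSubgroup.index_inf_le
      refine Nat.pos_of_ne_zero (AddSubgroup.index_inf_ne_zero ?_ ?_)
      · exact ne_zero_of_dvd_ne_zero (pow_ne_zero _ hpp.ne_zero) h1
      · exact ne_zero_of_dvd_ne_zero (pow_ne_zero _ hpp1.ne_zero) h2
    refine (Nat.le_of_dvd (pow_pos hpp.pos _) h1).antisymm ?_
    have h7 := Nat.le_of_dvd (pow_pos hpp1.pos _) h2
    exact Nat.le_of_mul_le_mul_right (h6.trans (Nat.mul_le_mul_left _ h7)) (pow_pos hpp1.pos _)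
  refine ⟨K, ⟨⟨hiK, fun x hx => ?_, ?_⟩, le_sup_left⟩, ?_⟩
  · obtain ⟨y, hy⟩ := hmem rfl x hx
    have h1 := mem_rep_smul_iff.1 hD.1 y
    rw [show D.mulVec y = (p' : ℤ) ^ m • x from hy, QuadraticMap.map_smul, smul_eq_mul] at h1
    have h2 : (p : ℤ) ^ 2 ∣ (p' : ℤ) ^ m * (p' : ℤ) ^ m * q₁ x := by
      rw [h1, Nat.cast_mul, mul_pow, mul_assoc]
      exact dvd_mul_right _ _
    refine IsCoprime.dvd_of_dvd_mul_left ?_ h2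
    have h3 := (Nat.isCoprime_iff_coprime.2 hcop)
    exact (h3.pow_right.mul_right h3.pow_right).pow_left
  · have h1 := (exists_mem_colLattice_not_dvd_iff (A := D) (l := p)).2
      ((isPrimitive_iff hm hdet).1 hD.2 p hpp (dvd_mul_right _ _))
    obtain ⟨x, hx, hi⟩ := h1
    exact ⟨x, AddSubgroup.mem_sup_left hx, hi⟩
  · rintro K' ⟨⟨hi, -, -⟩, hle⟩
    have hle' : K ≤ K' := by
      refine sup_le hle fun x hx => ?_
      obtain ⟨y, rfl⟩ := (hmemS _ _).1 hx
      have h := AddSubgroup.nsmul_index_mem K' y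
      rw [hi, ← natCast_zsmul] at h
      exact_mod_cast h
    have h1 := AddSubgroup.relIndex_mul_index hle'
    rw [hi, hiK] at h1
    refine le_antisymm ?_ hle'
    rw [← AddSubgroup.relIndex_eq_one]
    exact Nat.eq_of_mul_eq_mul_right (pow_pos hpp.pos m) (by rw [h1, one_mul])

/-- Each primitive `D` with multiplier `(pp')²` lies in exactly one `p`-neighbour, and inside a
given neighbour `colLattice B` such `D` are the products `B C`. -/
theorem sum_primRep_mul_primRep {k : ℕ} {q q₁ q₃ : Form (2 * k + 1)} {h : ℕ}
    {qs : Fin h → Form (2 * k + 1)} (hq : q.PosDef) (h₁ : Similar q q₁) (h₃ : Similar q q₃)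
    (hqs : IsCompleteSystem q qs) (hpq : ¬ (p : ℤ) ∣ formDet q) (hpp' : p ≠ p') :
    ∑ l, ((PrimRep q₁ (((p : ℤ) ^ 2) • qs l)).ncard : ℚ) / (formUnits (qs l)).ncard *
      (PrimRep (qs l) (((p' : ℤ) ^ 2) • q₃)).ncard =
        (PrimRep q₁ ((((p * p' : ℕ) : ℤ) ^ 2) • q₃)).ncard := by
  classical
  have hm : 2 * k + 1 ≠ 0 := by omega
  have hd₁ : formDet q₁ ≠ 0 := by rw [h₁.1]; exact formDet_ne_zero hq
  have hpq₁ : ¬ (p : ℤ) ∣ formDet q₁ := by rwa [h₁.1]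
  have hd₃ : formDet q₃ = formDet q₁ := by rw [h₁.1, h₃.1]
  rw [sum_primRep_eq_sum_nbrs hq h₁ hqs hpq _ (fun K =>
    ({D | D ∈ PrimRep q₁ ((((p * p' : ℕ) : ℤ) ^ 2) • q₃) ∧ colLattice D ≤ K}.ncard : ℚ))]
  · have hfin := finite_nbrs hpq₁
    have hPR := finite_primRep (posDef_of_similar hq h₁) ((((p * p' : ℕ) : ℤ) ^ 2) • q₃)
    rw [finsum_mem_eq_finite_toFinset_sum _ hfin]
    have hsum := Finset.sum_card_bipartiteAbove_eq_sum_card_bipartiteBelow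
      (s := hfin.toFinset) (t := hPR.toFinset) (fun K D => colLattice D ≤ K)
    have h2 : ∀ K, ({D | D ∈ PrimRep q₁ ((((p * p' : ℕ) : ℤ) ^ 2) • q₃) ∧
        colLattice D ≤ K} : Set _).ncard =
        (hPR.toFinset.bipartiteAbove (fun K D => colLattice D ≤ K) K).card := fun K => by
      rw [← Set.ncard_coe_finset]
      congr 1
      ext D
      simp [Finset.bipartiteAbove]
    have h4 : ∀ D ∈ hPR.toFinset,
        (hfin.toFinset.bipartiteBelow (fun K D => colLattice D ≤ K) D).card = 1 := by
      intro D hD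
      obtain ⟨K, ⟨hK, hKD⟩, huniq⟩ := existsUnique_nbrs_ge hm hd₁ hd₃ hpp'
        ((Set.Finite.mem_toFinset _).1 hD)
      refine Finset.card_eq_one.2 ⟨K, ?_⟩
      ext K'
      rw [Finset.bipartiteBelow, Finset.mem_filter, Set.Finite.mem_toFinset, Finset.mem_singleton]
      exact ⟨fun h => huniq K' h, fun h => h ▸ ⟨hK, hKD⟩⟩
    simp only [h2]
    rw [← Nat.cast_sum, hsum, Finset.sum_congr rfl h4, Finset.sum_const, smul_eq_mul, mul_one,
      Set.ncard_eq_toFinset_card _ hPR]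
  · intro l B hB
    have hd₂ : formDet (qs l) = formDet q₁ := by rw [(hqs.1 l).1, h₁.1]
    rw [← image_mul_primRep hm hd₁ hd₂ hd₃ hB hpp', Set.ncard_image_of_injective]
    exact fun C C' h => mul_left_cancel_of_det_ne_zero
      (det_ne_zero_of_natAbs_eq hp.out.ne_zero (natAbs_det_of_mem_rep hd₁ hd₂ hB.1)) h

theorem commute_eichlerMatrix {k : ℕ} {q : Form (2 * k + 1)} {h : ℕ}
    {qs : Fin h → Form (2 * k + 1)} (hq : q.PosDef) (hqs : IsCompleteSystem q qs)
    (hpq : ¬ (p : ℤ) ∣ formDet q) (hpq' : ¬ (p' : ℤ) ∣ formDet q) (hpp' : p ≠ p') :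
    Commute (eichlerMatrix qs p) (eichlerMatrix qs p') := by
  have hmul : ∀ {r s : ℕ} [Fact r.Prime] [Fact s.Prime], ¬ (r : ℤ) ∣ formDet q → r ≠ s → ∀ i j,
      (eichlerMatrix qs r * eichlerMatrix qs s) i j =
        (PrimRep (qs i) ((((r * s : ℕ) : ℤ) ^ 2) • qs j)).ncard / (formUnits (qs i)).ncard := by
    intro r s _ _ hr hrs i j
    rw [← sum_primRep_mul_primRep hq (hqs.1 i) (hqs.1 j) hqs hr hrs, Matrix.mul_apply,
      Finset.sum_div]
    refine Finset.sum_congr rfl fun l _ => ?_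
    simp only [eichlerMatrix, Matrix.of_apply, normPrimRep]
    ring
  ext i j
  rw [hmul hpq hpp', hmul hpq' hpp'.symm, mul_comm p' p]

end Commutation

end ReprZeta

namespace ReprZeta

/-! ### The Euler product -/

section Assembly

theorem cConst_pos {k p : ℕ} (hk : 1 ≤ k) (hp : p.Prime) : 0 < cConst k p := by
  have hp1 : (1 : ℚ) < p := by exact_mod_cast hp.one_lt
  refine Finset.sum_pos (fun d hd => ?_) ⟨1, Finset.mem_Icc.2 ⟨le_rfl, hk⟩⟩
  have hd' := Finset.mem_Icc.1 hd
  refine mul_pos (Finset.prod_pos fun i hi => ?_) (inv_pos.2 (pow_pos (by linarith) _))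
  have hi' := Finset.mem_Ico.1 hi
  refine div_pos (sub_pos.2 (one_lt_pow₀ hp1 (by omega))) (sub_pos.2 (inv_lt_one_of_one_lt₀ ?_))
  exact one_lt_pow₀ hp1 (by omega)

theorem epsSym_sq_mul {p : Nat.Primes} {n : ℕ} (hn : ¬ (p : ℕ) ∣ n) (a : ℤ) :
    epsSym ((n : ℤ) ^ 2 * a) p = epsSym a p := by
  have : Fact (p : ℕ).Prime := ⟨p.2⟩
  change legendreSym p _ = legendreSym p _
  rw [mul_left_comm, legendreSym.mul, legendreSym.sq_one', one_mul]
  rwa [Ne, ZMod.intCast_zmod_eq_zero_iff_dvd, Int.natCast_dvd_natCast]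

theorem not_sq_dvd_sq_mul {p n : ℕ} (hp : p.Prime) (hn : ¬ p ∣ n) {a : ℤ} (ha : Squarefree a) :
    ¬ (p : ℤ) ^ 2 ∣ (n : ℤ) ^ 2 * a := by
  intro h
  have hpz := Nat.prime_iff_prime_int.1 hp
  have hcop : IsCoprime ((p : ℤ) ^ 2) ((n : ℤ) ^ 2) :=
    IsCoprime.pow (hpz.irreducible.coprime_iff_not_dvd.2 fun h => hn (by exact_mod_cast h))
  have h1 := hcop.dvd_of_dvd_mul_left h
  rw [sq] at h1
  exact hpz.not_isUnit (ha _ h1)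

/-- Solving the two relations for `γ = c_p⁻¹ (T - β_p)` yields the recurrence of the local factor.
As `a` is square-free, `p² ∤ n² a` for `p ∤ n`, so `h₁` governs the initial step and `h₂` all later
ones; the symbol `(2n²a/p)` equals `(2a/p)`. -/
theorem exists_isFormalProduct_of_hecke {k : ℕ} (hk : 1 ≤ k) (q : Form (2 * k + 1)) {a : ℤ}
    (ha : Squarefree a) {R M : Type*} [Ring R] [Algebra ℚ R] [AddCommGroup M] [Module ℚ M]
    (ρ : R →+* AddMonoid.End M) (hρ : ∀ (r : ℚ) (x : M), ρ (algebraMap ℚ R r) x = r • x)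
    (T : ℕ → R) (v : ℤ → M)
    (hT : ∀ p ∈ goodPrimes q, ∀ p' ∈ goodPrimes q, p ≠ p' → Commute (T p) (T p'))
    (h₁ : ∀ p ∈ goodPrimes q, ∀ n : ℤ, ¬ ((p : ℕ) : ℤ) ^ 2 ∣ n → ρ (T p) (v n) =
      cConst k p • v (((p : ℕ) : ℤ) ^ 2 * n) + (betaConst k p + cConst k p *
        (formChar q p * epsSym n p * ((p : ℕ) : ℚ) ^ (k - 1))) • v n)
    (h₂ : ∀ p ∈ goodPrimes q, ∀ n : ℤ, ρ (T p) (v (((p : ℕ) : ℤ) ^ 2 * n)) =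
      cConst k p • v (((p : ℕ) : ℤ) ^ 2 * (((p : ℕ) : ℤ) ^ 2 * n)) +
      betaConst k p • v (((p : ℕ) : ℤ) ^ 2 * n) +
      (cConst k p * ((p : ℕ) : ℚ) ^ (2 * k - 1)) • v n) :
    ∃ Z, IsFormalProduct (goodPrimes q) (fun p => ofPower p (localFactor q a (T p) p)) Z ∧
      ∀ n, squareSeries v (formDet q) a n = ρ (Z n) (v a) := by
  have hrec := fun p : Nat.Primes => localQuotient_recurrence
    (algebraMap ℚ R ((formChar q p : ℚ) * (epsSym a p : ℚ) * ((p : ℕ) : ℚ) ^ (k - 1)))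
    ((cConst k p)⁻¹ • (T p - algebraMap ℚ R (betaConst k p)))
    (algebraMap ℚ R (((p : ℕ) : ℚ) ^ (2 * k - 1)))
    (f := localFactor q a (T p) p) (Algebra.commutes _) rfl
  have hγ : ∀ (p : Nat.Primes) (x y : M),
      ρ (T p) x = cConst k p • y + betaConst k p • x →
        ρ ((cConst k p)⁻¹ • (T p - algebraMap ℚ R (betaConst k p))) x = y := by
    intro p x y h
    rw [Algebra.smul_def, map_mul, map_sub]
    change ρ (algebraMap ℚ R _) (ρ (T p) x - ρ (algebraMap ℚ R (betaConst k p)) x) = y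
    rw [h, hρ, hρ, add_sub_cancel_right, inv_smul_smul₀ (cConst_pos hk p.2).ne']
  refine exists_isFormalProduct_squareSeries (goodPrimes q) _ (fun p _ => (hrec p).1) ?_ ρ v
    (formDet q) a (fun p => Iff.rfl) ?_
  · intro p hp p' hp' hpp' i j
    have hcomm : Commute ((cConst k p)⁻¹ • (T p - algebraMap ℚ R (betaConst k p)))
        ((cConst k p')⁻¹ • (T p' - algebraMap ℚ R (betaConst k p'))) :=
      (((hT p hp p' hp' hpp').sub_left (Algebra.commutes _ _)).sub_right
        (Algebra.commutes _ _).symm).smul_left _ |>.smul_right _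
    refine commute_coeff_of_recurrence (hrec p) (Algebra.commutes _ _) ?_ (Algebra.commutes _ _) i
    exact (commute_coeff_of_recurrence (hrec p') (Algebra.commutes _ _) hcomm.symm
      (Algebra.commutes _ _) j).symm
  · intro p hp n hn e
    have hc := (cConst_pos hk p.2).ne'
    have hu := apply_coeff_of_recurrence (hrec p) ρ
      (fun e => v ((((p : ℕ) ^ e * n : ℕ) : ℤ) ^ 2 * a)) ?_ ?_ e
    · simpa using hu
    · have hsucc : ((((p : ℕ) ^ 1 * n : ℕ) : ℤ) ^ 2 * a) = ((p : ℕ) : ℤ) ^ 2 * ((n : ℤ) ^ 2 * a) := by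
        push_cast; ring
      rw [hsucc, pow_zero, one_mul, hρ]
      refine hγ p _ _ ?_
      rw [h₁ p hp _ (not_sq_dvd_sq_mul p.2 hn ha), epsSym_sq_mul hn, add_smul, smul_add, smul_smul]
      abel
    · intro e
      have hsucc : ∀ e, ((((p : ℕ) ^ (e + 1) * n : ℕ) : ℤ) ^ 2 * a) =
          ((p : ℕ) : ℤ) ^ 2 * ((((p : ℕ) ^ e * n : ℕ) : ℤ) ^ 2 * a) := fun e => by
        push_cast; ring
      rw [hsucc (e + 1), hsucc e, hρ]
      refine hγ p _ _ ?_
      rw [h₂ p hp, smul_add, smul_smul]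
      abel

end Assembly

end ReprZeta

theorem mainTheorem9 {k : ℕ} (hk : 1 ≤ k) (q : ReprZeta.Form (2 * k + 1)) (hq : q.PosDef)
    {h : ℕ} (qs : Fin h → ReprZeta.Form (2 * k + 1)) (hqs : ReprZeta.IsCompleteSystem q qs)
    (a : ℤ) (ha : Squarefree a) :
    (∃ Z : ArithmeticFunction (Matrix (Fin h) (Fin h) ℚ),
      ReprZeta.IsFormalProduct (ReprZeta.goodPrimes q)
        (fun p => ReprZeta.ofPower p
          (ReprZeta.localFactor q a (ReprZeta.eichlerMatrix qs p) p)) Z ∧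
      ∀ n : ℕ, ReprZeta.squareSeries (ReprZeta.repVec qs) (ReprZeta.formDet q) a n =
        (Z n).mulVec (ReprZeta.repVec qs a)) ∧
    (∃ Z : ArithmeticFunction ℚ,
      ReprZeta.IsFormalProduct (ReprZeta.goodPrimes q)
        (fun p => ReprZeta.ofPower p
          (ReprZeta.localFactor q a (ReprZeta.eichlerMean q qs p) p)) Z ∧
      ∀ n : ℕ, ReprZeta.squareSeries (ReprZeta.repMean qs) (ReprZeta.formDet q) a n =
        Z n * ReprZeta.repMean qs a) := by
  have h₁ : ∀ p ∈ ReprZeta.goodPrimes q, ∀ n : ℤ, ¬ ((p : ℕ) : ℤ) ^ 2 ∣ n →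
      (ReprZeta.eichlerMatrix qs p).mulVec (ReprZeta.repVec qs n) =
        ReprZeta.cConst k p • ReprZeta.repVec qs (((p : ℕ) : ℤ) ^ 2 * n) +
        (ReprZeta.betaConst k p + ReprZeta.cConst k p *
          (ReprZeta.formChar q p * ReprZeta.epsSym n p * ((p : ℕ) : ℚ) ^ (k - 1))) •
            ReprZeta.repVec qs n := fun p hp n hn =>
    haveI : Fact (p : ℕ).Prime := ⟨p.2⟩
    ReprZeta.eichlerMatrix_mulVec_repVec_of_not_sq_dvd hk hq hqs hp hn
  have h₂ := fun (p : Nat.Primes) (hp : p ∈ ReprZeta.goodPrimes q) (n : ℤ) =>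
    haveI : Fact (p : ℕ).Prime := ⟨p.2⟩
    ReprZeta.eichlerMatrix_mulVec_repVec_sq_mul hk hq hqs hp n
  have hmean := fun (p : Nat.Primes) (hp : p ∈ ReprZeta.goodPrimes q) (n : ℤ) =>
    haveI : Fact (p : ℕ).Prime := ⟨p.2⟩
    ReprZeta.eichlerMean_mul_repMean hk hq hqs hp n
  have hsum : ∀ (c d : ℚ) (n n' : ℤ), ∑ i, (c • ReprZeta.repVec qs n +
      d • ReprZeta.repVec qs n') i = c • ReprZeta.repMean qs n + d • ReprZeta.repMean qs n' := by
    intro c d n n'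
    simp [ReprZeta.repVec, ReprZeta.repMean, Finset.sum_add_distrib, Finset.mul_sum]
  constructor
  · let ρ : Matrix (Fin h) (Fin h) ℚ →+* AddMonoid.End (Fin h → ℚ) :=
      (Module.toAddMonoidEnd (Module.End ℚ (Fin h → ℚ)) (Fin h → ℚ)).comp
        (Matrix.toLinAlgEquiv' : Matrix (Fin h) (Fin h) ℚ ≃ₐ[ℚ] _).toRingEquiv.toRingHom
    have hρ : ∀ (A : Matrix (Fin h) (Fin h) ℚ) x, ρ A x = A.mulVec x := fun A x => rfl
    refine ReprZeta.exists_isFormalProduct_of_hecke hk q ha ρ ?_ (ReprZeta.eichlerMatrix qs)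
      (ReprZeta.repVec qs) ?_ h₁ h₂
    · intro r x
      rw [hρ, Algebra.algebraMap_eq_smul_one, Matrix.smul_mulVec, Matrix.one_mulVec]
    · intro p hp p' hp' hpp'
      have : Fact (p : ℕ).Prime := ⟨p.2⟩
      have : Fact (p' : ℕ).Prime := ⟨p'.2⟩
      exact ReprZeta.commute_eichlerMatrix hq hqs hp hp' fun h => hpp' (Subtype.ext h)
  · refine ReprZeta.exists_isFormalProduct_of_hecke hk q ha (Module.toAddMonoidEnd ℚ ℚ)
      (fun r x => rfl) (ReprZeta.eichlerMean q qs) (ReprZeta.repMean qs)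
      (fun _ _ _ _ _ => Commute.all _ _) (fun p hp n hn => ?_) fun p hp n => ?_
    -- The scalar relations are the coordinate sums of the vector relations, the mean acting as the
    -- matrix does under summation.
    · refine (hmean p hp n).trans ?_
      rw [h₁ p hp n hn, hsum]
    · refine (hmean p hp _).trans ?_
      rw [h₂ p hp n]
      simp only [Pi.add_apply, Finset.sum_add_distrib]
      simp [ReprZeta.repVec, ReprZeta.repMean, Finset.mul_sum]
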